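/- Let $X=\mathbb P^1_{\mathbb Z}$ with structure morphism $f:X\to\operatorname{Spec}\mathbb Z$, and for $p\in\operatorname{Spec}\mathbb Z$ (the generic point included) let $\iota_p:X_p\to X$ be the fibre of $f$ over $p$; put $\mathcal F_p=\iota_p^*\mathcal F$ for an $\mathcal O_X$-module $\mathcal F$ and $\mathcal O_{X_p}(n)=\iota_p^*\mathcal O_X(n)$. Let $\mathcal E$ be a locally free sheaf of rank two on $X$ with associated triple $(a,b,Z)$; that is, $a\ge b$ are integers, $i:Z\hookrightarrow X$ is a (possibly empty) closed subscheme that is a local complete intersection of codimension two (its ideal is generated, near each point of $Z$, by a regular sequence of length two), and there is an exact sequence $$0\to\mathcal O_X(a)\to\mathcal E\to\mathcal I_Z(b)\to 0,$$ where $\mathcal I_Z=\ker(\mathcal O_X\to i_*\mathcal O_Z)$. Then: 1. $\mathcal E$ is indecomposable (nonzero, and not isomorphic to a direct sum of two nonzero $\mathcal O_X$-modules) if and only if $Z\neq\emptyset$. 2. For every $p\in f(Z)$ there is an integer $n_p>0$ such that there is an exact sequence $$0\to\mathcal O_{X_p}(-n_p)\to\mathcal O_{X_p}\to\iota_p^*(i_*\mathcal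 O_Z)\to 0$$ whose right-hand map is the pullback of the canonical map $\mathcal O_X\to i_*\mathcal O_Z$, and such that $\mathcal E_p\cong\mathcal O_{X_p}(a+n_p)\oplus\mathcal O_{X_p}(b-n_p)$. 3. For every $p\in\operatorname{Spec}\mathbb Z$ with $p\notin f(Z)$ one has $\mathcal E_p\cong\mathcal O_{X_p}(a)\oplus\mathcal O_{X_p}(b)$. -/

import Mathlib

open CategoryTheory Limits AlgebraicGeometry
namespace RankTwoP1
noncomputable section

section Modules
variable {X : Scheme.{0}}

/-- The structure sheaf `𝒪_X` as a module over itself. -/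
abbrev structureSheaf (X : Scheme.{0}) : X.Modules := SheafOfModules.unit X.ringCatSheaf

/-- `j_* (M|_V)` for the open immersion `j : V ⟶ X`: its sections over `U` are `M(U ∩ V)`. -/
def pushRes (M : X.Modules) (V : X.Opens) : X.Modules :=
  (Scheme.Modules.pushforward V.ι).obj (M.restrict V.ι)

lemma pushRes_smul (M : X.Modules) (V U : X.Opens)
    (r : X.presheaf.obj (.op U)) (s : M.presheaf.obj (.op (V.ι ''ᵁ V.ι ⁻¹ᵁ U))) :
    (HSMul.hSMul (β := (pushRes M V).presheaf.obj (.op U))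
      (γ := (pushRes M V).presheaf.obj (.op U)) r s) =
      X.presheaf.map (homOfLE (V.ι.image_preimage_le U)).op r • s := by
  change (V.ι.appIso _).inv (V.ι.app U r) • s = _
  rw [Scheme.Opens.ι_appIso]
  rfl

lemma image_preimage_ι_mono {V W : X.Opens} (h : W ≤ V) (U : X.Opens) :
    W.ι ''ᵁ W.ι ⁻¹ᵁ U ≤ V.ι ''ᵁ V.ι ⁻¹ᵁ U := by
  simp only [Scheme.Hom.image_preimage_eq_opensRange_inf, Scheme.Opens.opensRange_ι]
  exact inf_le_inf_right _ h

lemma image_ι_le (W : X.Opens) (U : W.toScheme.Opens) : W.ι ''ᵁ U ≤ W := by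
  simpa using W.ι.image_le_opensRange U

lemma resMul_naturality (M : X.Modules) {V W : X.Opens} (h : W ≤ V)
    (a : X.presheaf.obj (.op W)) {U U' : X.Opens} (i : U' ⟶ U)
    (s : M.presheaf.obj (.op (V.ι ''ᵁ V.ι ⁻¹ᵁ U))) :
    (X.presheaf.map (homOfLE (image_ι_le W (W.ι ⁻¹ᵁ U'))).op a) •
        (M.presheaf.map (homOfLE (image_preimage_ι_mono h U')).op
          (M.presheaf.map
            (V.ι.opensFunctor.map ((TopologicalSpace.Opens.map V.ι.base).map i)).op s)) =
      M.presheaf.map (W.ι.opensFunctor.map ((TopologicalSpace.Opens.map W.ι.base).map i)).op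
        ((X.presheaf.map (homOfLE (image_ι_le W (W.ι ⁻¹ᵁ U))).op a) •
          (M.presheaf.map (homOfLE (image_preimage_ι_mono h U)).op s)) := by
  rw [Scheme.Modules.map_smul, ← ConcreteCategory.comp_apply, ← ConcreteCategory.comp_apply,
    ← ConcreteCategory.comp_apply, ← Functor.map_comp, ← Functor.map_comp, ← Functor.map_comp]
  rfl

lemma resMul_linear (M : X.Modules) {V W : X.Opens} (h : W ≤ V)
    (a : X.presheaf.obj (.op W)) (U : X.Opens) (r : X.presheaf.obj (.op U))
    (s : M.presheaf.obj (.op (V.ι ''ᵁ V.ι ⁻¹ᵁ U))) :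
    (X.presheaf.map (homOfLE (image_ι_le W (W.ι ⁻¹ᵁ U))).op a) •
        (M.presheaf.map (homOfLE (image_preimage_ι_mono h U)).op
          (X.presheaf.map (homOfLE (V.ι.image_preimage_le U)).op r • s)) =
      X.presheaf.map (homOfLE (W.ι.image_preimage_le U)).op r •
        ((X.presheaf.map (homOfLE (image_ι_le W (W.ι ⁻¹ᵁ U))).op a) •
          (M.presheaf.map (homOfLE (image_preimage_ι_mono h U)).op s)) := by
  rw [Scheme.Modules.map_smul, ← ConcreteCategory.comp_apply, ← Functor.map_comp]
  exact smul_comm _ _ _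

/-- For opens `W ≤ V` and `a ∈ 𝒪_X(W)`, the `𝒪_X`-linear map `j_{V*}(M|_V) ⟶ j_{W*}(M|_W)`,
`s ↦ a • s|_W`. -/
def resMul (M : X.Modules) {V W : X.Opens} (h : W ≤ V)
    (a : X.presheaf.obj (.op W)) : pushRes M V ⟶ pushRes M W :=
  Scheme.Modules.fullyFaithfulToPresheafOfModules.preimage
    (X := pushRes M V) (Y := pushRes M W) <|
    PresheafOfModules.homMk
      { app := fun U ↦ AddCommGrpCat.ofHom
          (AddMonoidHom.mk' (M := M.presheaf.obj (.op (V.ι ''ᵁ V.ι ⁻¹ᵁ U.unop)))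
            (G := M.presheaf.obj (.op (W.ι ''ᵁ W.ι ⁻¹ᵁ U.unop)))
            (fun s ↦ (X.presheaf.map (homOfLE (image_ι_le W (W.ι ⁻¹ᵁ U.unop))).op a) •
              (M.presheaf.map (homOfLE (image_preimage_ι_mono h U.unop)).op s))
            (by intro s t; rw [map_add, smul_add]))
        naturality := by
          intro U U' i
          ext s
          exact resMul_naturality M h a i.unop s }
      (by
        intro U r s
        obtain ⟨U⟩ := U
        refine Eq.trans (congrArg (fun t ↦ (X.presheaf.map (homOfLE
          (image_ι_le W (W.ι ⁻¹ᵁ U))).op a) • (M.presheaf.map (homOfLE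
          (image_preimage_ι_mono h U)).op t)) (pushRes_smul M V U r s)) ?_
        refine Eq.trans ?_ (pushRes_smul M W U r _).symm
        exact resMul_linear M h a U r s)

@[simp]
lemma resMul_app (M : X.Modules) {V W : X.Opens} (h : W ≤ V)
    (a : X.presheaf.obj (.op W)) (U : X.Opens)
    (s : M.presheaf.obj (.op (V.ι ''ᵁ V.ι ⁻¹ᵁ U))) :
    (resMul M h a).app U s = (X.presheaf.map (homOfLE (image_ι_le W (W.ι ⁻¹ᵁ U))).op a) •
      (M.presheaf.map (homOfLE (image_preimage_ι_mono h U)).op s) :=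
  rfl

/-- The canonical map `𝒪_X ⟶ i_* 𝒪_Z` of a morphism `i : Z ⟶ X`. -/
abbrev toPushforward {Z : Scheme.{0}} (i : Z ⟶ X) :
    structureSheaf X ⟶ (Scheme.Modules.pushforward i).obj (structureSheaf Z) :=
  SheafOfModules.unitToPushforwardObjUnit i.toRingCatSheafHom

/-- The sheaf of ideals `ℐ_Z = ker (𝒪_X ⟶ i_* 𝒪_Z)`, as an `𝒪_X`-module. -/
def idealSheaf {Z : Scheme.{0}} (i : Z ⟶ X) : X.Modules := kernel (toPushforward i)

/-- `M` is locally isomorphic to `𝒪^r`. -/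
def IsLocallyFreeOfRank (r : ℕ) (M : X.Modules) : Prop :=
  ∀ x : X, ∃ U : X.Opens, x ∈ U ∧
    Nonempty (M.restrict U.ι ≅ ∐ fun _ : Fin r ↦ structureSheaf U.toScheme)

/-- `Z` is a local complete intersection of codimension `r` in `X`: around each of its points,
its ideal is generated by a regular sequence of length `r`. (Meant for closed immersions `i`.) -/
def IsLCIOfCodim (r : ℕ) {Z : Scheme.{0}} (i : Z ⟶ X) : Prop :=
  ∀ z : Z, ∃ U : X.Opens, IsAffineOpen U ∧ i z ∈ U ∧
    ∃ rs : List (X.presheaf.obj (.op U)), rs.length = r ∧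
      RingTheory.Sequence.IsRegular (X.presheaf.obj (.op U)) rs ∧
      RingHom.ker (i.app U).hom = Ideal.ofList rs
end Modules

section P1
/-- The grading of `ℤ[x₀, x₁]` by degree. -/
abbrev projGrading : ℕ → Submodule ℤ (MvPolynomial (Fin 2) ℤ) :=
  MvPolynomial.homogeneousSubmodule (Fin 2) ℤ

instance : GradedAlgebra projGrading := MvPolynomial.gradedAlgebra

/-- The projective line over `ℤ`. -/
abbrev P1 : Scheme.{0} := Proj projGrading

/-- The scheme `Spec ℤ`. -/
abbrev SpecZ : Scheme.{0} := Spec (.of ℤ)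

/-- The structure morphism of the projective line over `ℤ` (`Spec ℤ` is terminal). -/
def structMap : P1 ⟶ SpecZ := specZIsTerminal.from P1

/-- The standard chart `D₊(xᵢ)`. -/
abbrev chart (i : Fin 2) : P1.Opens := Proj.basicOpen projGrading (MvPolynomial.X i)

/-- The overlap `D₊(x₀ x₁) = D₊(x₀) ∩ D₊(x₁)` of the two standard charts. -/
abbrev overlap : P1.Opens :=
  Proj.basicOpen projGrading (MvPolynomial.X 0 * MvPolynomial.X 1)

lemma overlap_le (i : Fin 2) : overlap ≤ chart i := by
  refine Proj.basicOpen_mono _ _ _ ?_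
  fin_cases i
  · exact Dvd.intro _ rfl
  · exact Dvd.intro_left _ rfl

lemma X_mem (i : Fin 2) : MvPolynomial.X i ∈ projGrading 1 :=
  MvPolynomial.isHomogeneous_X ℤ i

lemma X_mul_X_mem (i j : Fin 2) :
    (MvPolynomial.X i * MvPolynomial.X j : MvPolynomial (Fin 2) ℤ) ∈ projGrading 2 :=
  SetLike.mul_mem_graded (X_mem i) (X_mem j)

/-- The degree-zero fraction `xᵢ² / (x₀ x₁)`. -/
def sqRatio (i : Fin 2) :
    HomogeneousLocalization.Away projGrading (MvPolynomial.X 0 * MvPolynomial.X 1) :=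
  HomogeneousLocalization.Away.mk projGrading (X_mul_X_mem 0 1) 1
    (MvPolynomial.X i * MvPolynomial.X i) (X_mul_X_mem i i)

lemma sqRatio_mul : sqRatio 0 * sqRatio 1 = 1 := by
  rw [HomogeneousLocalization.ext_iff_val, HomogeneousLocalization.val_mul,
    HomogeneousLocalization.val_one, sqRatio, sqRatio, HomogeneousLocalization.Away.val_mk,
    HomogeneousLocalization.Away.val_mk, Localization.mk_mul]
  exact (Localization.mk_eq_mk_iff.mpr (Localization.r_of_eq (by
    simp only [Submonoid.coe_mul, OneMemClass.coe_one]
    ring))).trans Localization.mk_one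

/-- The unit `x₀ / x₁ = x₀² / (x₀ x₁)` on the overlap of the charts, with inverse `x₁ / x₀`. -/
def coordRatio : (P1.presheaf.obj (.op overlap))ˣ where
  val := (Proj.awayToSection projGrading _).hom (sqRatio 0)
  inv := (Proj.awayToSection projGrading _).hom (sqRatio 1)
  val_inv := (map_mul _ _ _).symm.trans ((congrArg _ sqRatio_mul).trans (map_one _))
  inv_val := (map_mul _ _ _).symm.trans
    ((congrArg _ ((mul_comm _ _).trans sqRatio_mul)).trans (map_one _))

/-- The Serre twist `M(n) = M ⊗ 𝒪(n)`, glued from `M|_{D₊(x₀)}` and `M|_{D₊(x₁)}` by the transition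
function of `𝒪(n)`: the sections of `M(n)` over `U` are the pairs `(s, t)` with
`s ∈ M(U ∩ D₊(x₀))`, `t ∈ M(U ∩ D₊(x₁))` and `(x₀ / x₁)ⁿ s = t` on the overlap; such a pair
stands for the section `x₀ⁿ s = x₁ⁿ t`. -/
def twist (M : P1.Modules) (n : ℤ) : P1.Modules :=
  Limits.pullback (resMul M (overlap_le 0) (coordRatio ^ n).val) (resMul M (overlap_le 1) 1)

/-- The line bundle `𝒪(n)` on the projective line over `ℤ`. -/
def O (n : ℤ) : P1.Modules := twist (structureSheaf P1) n

/-- `(a, b, Z)` is a triple associated with `E`: `a ≥ b`, `i : Z ⟶ ℙ¹` is a closed subscheme which is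
a local complete intersection of codimension two, and there is an exact sequence
`0 ⟶ 𝒪(a) ⟶ E ⟶ ℐ_Z(b) ⟶ 0`. -/
def IsAssociatedTriple (E : P1.Modules) (a b : ℤ) {Z : Scheme.{0}} (i : Z ⟶ P1) : Prop :=
  b ≤ a ∧ IsClosedImmersion i ∧ IsLCIOfCodim 2 i ∧
    ∃ (α : O a ⟶ E) (β : E ⟶ twist (idealSheaf i) b) (w : α ≫ β = 0),
      (ShortComplex.mk α β w).ShortExact

/-- Restriction `ι_p^*` of modules to the fibre `X_p` of the projective line over `p`, where
`ι_p : X_p ⟶ X`. The line bundle `𝒪(n)` of `X_p` is `ι_p^* 𝒪(n)`. -/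
def fibreRestrict (p : SpecZ) : P1.Modules ⥤ (structMap.fiber p).Modules :=
  Scheme.Modules.pullback (structMap.fiberι p)

end P1

end
end RankTwoP1

/-!
The line `ℙ¹` over `ℤ` is glued from two affine lines, and so is every fibre of it over `Spec ℤ`.
The whole proof is carried out in these two charts: modules are described by sections over the
charts that form a basis (`IsFrame`) or a dual basis (`DualBasis`), and a module is determined by
the transition matrix between its frames (`nonempty_iso_of_frames`). The extension
`0 ⟶ 𝒪(a) ⟶ E ⟶ ℐ_Z(b) ⟶ 0` becomes a section `α` of `E` and a functional `β` on `E` over each chart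
(`ExtData`), where `α` generates the kernel of `β`, and the image of `β` is the ideal of `Z`
(`ExtData.exists_β_eq`).

*Codimension two.* The rings of the charts are factorial, and the ideal of `Z` lies in no principal
prime ideal (`IsLCIOfCodim.exists_not_dvd`): at the generic point of such a prime, both elements of
a regular sequence generating the ideal would be divisible by the prime. As a consequence `E` has
determinant `𝒪(a + b)`; in terms of the extension, the factors `w` in `β x • y - β y • x = w • α`
generate the unit ideal (`ExtData.span_factors`).

*Fibres.* On a chart of a fibre the ring of functions is a principal ideal domain, so the
restriction of `E` has a frame there, and since the ideal of `Z` does not vanish on the fibre, the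
frame `g`, `f` can be chosen such that `β g = 0`, `β f = h` and `α = h g`, where `h` is an equation
of `Z` on the fibre (`ExtData.exists_pullback_frame`). Comparing the two charts, `h` is a
homogeneous equation of some degree `n`, positive precisely if `Z` meets the fibre, and `g`, `f`
have a triangular transition matrix with diagonal entries `T ^ (a + n)`, `T ^ (b - n)`
(`Atlas.exists_normal_form`). Because `H¹(ℙ¹, 𝒪(a - b + 2 n)) = 0`, the matrix can be made diagonal
(`Atlas.nonempty_iso_biprod`), and multiplication by `h` gives the exact sequence for `𝒪_Z`
(`ExtData.exists_fiber`).

*Indecomposability.* If `Z` is empty, the same splitting argument applied over `ℤ` gives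
`E ≅ 𝒪(a) ⊞ 𝒪(b)` (`ExtData.nonempty_iso_of_isEmpty`). Conversely, a nontrivial direct summand of
`E` is projective of rank one over the factorial ring of each chart, hence free, and units on the
overlap of the charts are monomials; so a decomposition of `E` gives frames with a diagonal
transition matrix (`exists_frame_of_retract`, `Atlas.exists_transition`). The two values of `β` on
such a frame are sections of line bundles whose degrees add up to `b - a ≤ 0`, so one of them
vanishes or both are constant. In either case the ideal of `Z` is principal on both charts, and
since it has codimension two, `Z` is empty (`ExtData.isEmpty_of_diagonal`).
-/

namespace RankTwoP1
noncomputable section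

/-! ### Sections, morphisms and local homomorphisms -/

section Sections
variable {X Y : Scheme.{0}} {M N K : X.Modules} {U V W : X.Opens}

/-- Restriction of sections of an `𝒪_X`-module. -/
def secRes (M : X.Modules) {U V : X.Opens} (h : V ≤ U) : Γ(M, U) →+ Γ(M, V) :=
  (M.presheaf.map (homOfLE h).op).hom

/-- Restriction of functions. -/
def funRes {U V : X.Opens} (h : V ≤ U) : Γ(X, U) →+* Γ(X, V) :=
  (X.presheaf.map (homOfLE h).op).hom

lemma secRes_eq (h : V ≤ U) (x : Γ(M, U)) :
    secRes M h x = M.presheaf.map (homOfLE h).op x := rfl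

lemma funRes_eq (h : V ≤ U) (x : Γ(X, U)) :
    funRes h x = X.presheaf.map (homOfLE h).op x := rfl

@[simp] lemma secRes_secRes (h : V ≤ U) (h' : W ≤ V) (x : Γ(M, U)) :
    secRes M h' (secRes M h x) = secRes M (h'.trans h) x := by
  simp only [secRes_eq, ← ConcreteCategory.comp_apply, ← Functor.map_comp]
  rfl

@[simp] lemma funRes_funRes (h : V ≤ U) (h' : W ≤ V) (x : Γ(X, U)) :
    funRes h' (funRes h x) = funRes (h'.trans h) x := by
  simp only [funRes_eq, ← ConcreteCategory.comp_apply, ← Functor.map_comp]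
  rfl

@[simp] lemma secRes_self (h : U ≤ U) (x : Γ(M, U)) : secRes M h x = x := by
  have : (homOfLE h).op = 𝟙 (Opposite.op U) := rfl
  rw [secRes_eq, this, M.presheaf.map_id]; rfl

@[simp] lemma funRes_self (h : U ≤ U) (x : Γ(X, U)) : funRes h x = x := by
  have : (homOfLE h).op = 𝟙 (Opposite.op U) := rfl
  rw [funRes_eq, this, X.presheaf.map_id]; rfl

@[simp] lemma secRes_smul (h : V ≤ U) (r : Γ(X, U)) (x : Γ(M, U)) :
    secRes M h (r • x) = funRes h r • secRes M h x :=
  M.map_smul (homOfLE h) r x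

@[simp] lemma app_secRes (φ : M ⟶ N) (h : V ≤ U) (x : Γ(M, U)) :
    φ.app V (secRes M h x) = secRes N h (φ.app U x) :=
  congr($(φ.mapPresheaf.naturality (homOfLE h).op) x)

lemma hom_ext_apply {φ ψ : M ⟶ N} (h : ∀ U (x : Γ(M, U)), φ.app U x = ψ.app U x) : φ = ψ := by
  ext U x
  exact h U x

lemma sec_ext_of_cover {ι : Type*} {M : X.Modules} {U : X.Opens} (V : ι → X.Opens)
    (hV : ∀ i, V i ≤ U) (hU : U ≤ iSup V) {x y : Γ(M, U)}
    (h : ∀ i, secRes M (hV i) x = secRes M (hV i) y) : x = y :=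
  TopCat.Sheaf.eq_of_locally_eq' ⟨_, M.isSheaf⟩ V U (fun i ↦ homOfLE (hV i)) hU x y h

lemma exists_glue {ι : Type} {M : X.Modules} {U : X.Opens} (V : ι → X.Opens)
    (hV : ∀ i, V i ≤ U) (hU : U ≤ iSup V) (s : ∀ i, Γ(M, V i))
    (h : ∀ i j, secRes M (inf_le_left : V i ⊓ V j ≤ V i) (s i) =
      secRes M (inf_le_right : V i ⊓ V j ≤ V j) (s j)) :
    ∃ x : Γ(M, U), ∀ i, secRes M (hV i) x = s i := by
  obtain ⟨x, hx, -⟩ := TopCat.Sheaf.existsUnique_gluing' ⟨_, M.isSheaf⟩ V U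
    (fun i ↦ homOfLE (hV i)) hU s h
  exact ⟨x, hx⟩

/-- A morphism of `𝒪_X`-modules from a compatible family of linear maps on sections. -/
def mkHom (f : ∀ U : X.Opens, Γ(M, U) → Γ(N, U))
    (hadd : ∀ U x y, f U (x + y) = f U x + f U y)
    (hsmul : ∀ U (r : Γ(X, U)) x, f U (r • x) = r • f U x)
    (hres : ∀ U V (h : V ≤ U) x, f V (secRes M h x) = secRes N h (f U x)) : M ⟶ N :=
  Scheme.Modules.fullyFaithfulToPresheafOfModules.preimage (X := M) (Y := N) <|
    PresheafOfModules.homMk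
      { app := fun U ↦ AddCommGrpCat.ofHom (AddMonoidHom.mk' (M := Γ(M, U.unop))
            (G := Γ(N, U.unop)) (f U.unop) (hadd U.unop))
        naturality := by
          intro U U' i
          ext s
          exact hres U.unop U'.unop i.unop.le s }
      (by
        intro U r s
        exact hsmul U.unop r s)

/-- An `𝒪_U`-linear map `M|_U ⟶ N|_U`, given by its action on sections over the opens
contained in `U`. -/
@[ext]
structure LocalHom (U : X.Opens) (M N : X.Modules) where
  toFun : ∀ V : X.Opens, V ≤ U → Γ(M, V) → Γ(N, V)
  map_add : ∀ V h x y, toFun V h (x + y) = toFun V h x + toFun V h y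
  map_smul : ∀ V h (r : Γ(X, V)) x, toFun V h (r • x) = r • toFun V h x
  map_res : ∀ V h W (h' : W ≤ V) x,
    toFun W (h'.trans h) (secRes M h' x) = secRes N h' (toFun V h x)

namespace LocalHom

/-- Restriction of a local homomorphism to a smaller open set. -/
def restrict (l : LocalHom U M N) (h : V ≤ U) : LocalHom V M N where
  toFun W hW := l.toFun W (hW.trans h)
  map_add W _ := l.map_add W _
  map_smul W _ := l.map_smul W _
  map_res W _ := l.map_res W _

/-- A local homomorphism bundled as a linear map on sections over one open set. -/
def linMap (l : LocalHom U M N) (h : V ≤ U) : Γ(M, V) →ₗ[Γ(X, V)] Γ(N, V) where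
  toFun := l.toFun V h
  map_add' := l.map_add V h
  map_smul' := l.map_smul V h

@[simp] lemma linMap_apply (l : LocalHom U M N) (h : V ≤ U) (x : Γ(M, V)) :
    l.linMap h x = l.toFun V h x := rfl

/-- The restriction of a morphism to an open set. -/
def ofGlobal (φ : M ⟶ N) (U : X.Opens) : LocalHom U M N where
  toFun V _ x := φ.app V x
  map_add _ _ _ _ := _root_.map_add _ _ _
  map_smul _ _ r x := φ.app_smul r x
  map_res _ _ _ h x := app_secRes φ h x

/-- Composition of local homomorphisms, in diagrammatic order. -/
def comp (l : LocalHom U M N) (m : LocalHom U N K) : LocalHom U M K where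
  toFun V h x := m.toFun V h (l.toFun V h x)
  map_add V h x y := by rw [l.map_add, m.map_add]
  map_smul V h r x := by rw [l.map_smul, m.map_smul]
  map_res V h W h' x := by rw [l.map_res, m.map_res]

end LocalHom

lemma le_image_preimage_ι (h : V ≤ U) : V ≤ U.ι ''ᵁ U.ι ⁻¹ᵁ V := by
  simp [Scheme.Hom.image_preimage_eq_opensRange_inf, h]

/-- A section of `j_* (N|_U)` over `W`, restricted to an open set `V ≤ W ⊓ U`. -/
def fromPush (N : X.Modules) (U : X.Opens) {W V : X.Opens} (h : V ≤ U) (h' : V ≤ W) :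
    Γ(pushRes N U, W) →+ Γ(N, V) :=
  secRes N ((le_image_preimage_ι h).trans (U.ι.image_mono (U.ι.preimage_mono h')))

lemma image_preimage_ι_le_inf (U W : X.Opens) : U.ι ''ᵁ U.ι ⁻¹ᵁ W ≤ W ⊓ U :=
  le_inf (U.ι.image_preimage_le W) (image_ι_le U _)

/-- A section of `N` over `W ⊓ U` as a section of `j_* (N|_U)` over `W`. -/
def toPush (N : X.Modules) (U W : X.Opens) {V : X.Opens} (h : W ⊓ U ≤ V) :
    Γ(N, V) →+ Γ(pushRes N U, W) :=
  secRes N ((image_preimage_ι_le_inf U W).trans h)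

lemma fromPush_toPush {V' : X.Opens} (hU : V ≤ U) (hW : V ≤ W) (h : W ⊓ U ≤ V') (x : Γ(N, V')) :
    fromPush N U hU hW (toPush N U W h x) = secRes N ((le_inf hW hU).trans h) x :=
  secRes_secRes _ _ _

lemma toPush_fromPush (x : Γ(pushRes N U, W)) :
    toPush N U W le_rfl (fromPush N U inf_le_right inf_le_left x) = x :=
  (secRes_secRes (M := N) _ _ _).trans (secRes_self (M := N) _ _)

lemma fromPush_smul (hU : V ≤ U) (hW : V ≤ W) (r : Γ(X, W)) (x : Γ(pushRes N U, W)) :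
    fromPush N U hU hW (r • x) = funRes hW r • fromPush N U hU hW x := by
  refine (congrArg (secRes N _) (pushRes_smul N U W r x)).trans ?_
  refine (secRes_smul _ _ _).trans ?_
  rw [← funRes_eq, funRes_funRes]
  rfl

lemma fromPush_secRes {W' : X.Opens} (hU : V ≤ U) (hW : V ≤ W) (h : W ≤ W')
    (x : Γ(pushRes N U, W')) :
    fromPush N U hU hW (secRes _ h x) = fromPush N U hU (hW.trans h) x := by
  exact secRes_secRes (M := N) (U := U.ι ''ᵁ U.ι ⁻¹ᵁ W') (V := U.ι ''ᵁ U.ι ⁻¹ᵁ W) (W := V)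
    (U.ι.image_mono (U.ι.preimage_mono h)) _ x

lemma secRes_fromPush {V' : X.Opens} (hU : V ≤ U) (hW : V ≤ W) (h : V' ≤ V)
    (x : Γ(pushRes N U, W)) :
    secRes _ h (fromPush N U hU hW x) = fromPush N U (h.trans hU) (h.trans hW) x :=
  secRes_secRes (M := N) _ _ _

lemma pushRes_ext {x y : Γ(pushRes N U, W)}
    (h : fromPush N U (V := W ⊓ U) inf_le_right inf_le_left x =
      fromPush N U inf_le_right inf_le_left y) : x = y := by
  rw [← toPush_fromPush x, h, toPush_fromPush]

/-- The local homomorphism over `U` given by a morphism `M ⟶ j_* (N|_U)`. -/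
def LocalHom.ofHom (φ : M ⟶ pushRes N U) : LocalHom U M N where
  toFun V h x := fromPush N U h le_rfl (φ.app V x)
  map_add V h x y := by rw [_root_.map_add, _root_.map_add]
  map_smul V h r x := by
    rw [Scheme.Modules.Hom.app_smul, fromPush_smul, funRes_self]
  map_res V h W h' x := by
    rw [app_secRes, fromPush_secRes, secRes_fromPush]

/-- The morphism `M ⟶ j_* (N|_U)` given by a local homomorphism over `U`. -/
def LocalHom.toHom (l : LocalHom U M N) : M ⟶ pushRes N U :=
  mkHom (N := pushRes N U) (fun V x ↦ toPush N U V le_rfl (l.toFun (V ⊓ U) inf_le_right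
      (secRes M inf_le_left x)))
    (fun V x y ↦ by rw [_root_.map_add, l.map_add, _root_.map_add])
    (fun V r x ↦ by
      apply pushRes_ext
      rw [secRes_smul, l.map_smul, fromPush_smul, fromPush_toPush, fromPush_toPush, secRes_smul,
        funRes_funRes])
    (fun V W h x ↦ by
      apply pushRes_ext
      rw [fromPush_toPush, fromPush_secRes, fromPush_toPush, ← l.map_res, ← l.map_res,
        secRes_secRes, secRes_secRes, secRes_secRes])

lemma LocalHom.toHom_app (l : LocalHom U M N) (V : X.Opens) (x : Γ(M, V)) :
    l.toHom.app V x =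
      toPush N U V le_rfl (l.toFun (V ⊓ U) inf_le_right (secRes M inf_le_left x)) := rfl

lemma LocalHom.ofHom_toHom (l : LocalHom U M N) : LocalHom.ofHom l.toHom = l := by
  ext V h x
  change fromPush N U _ _ (l.toHom.app V x) = _
  rw [toHom_app, fromPush_toPush, ← l.map_res, secRes_secRes, secRes_self]

end Sections

/-! ### Pullback of sections -/

section Pullback
variable {X Y : Scheme.{0}} {M N : X.Modules} {U V W : X.Opens} (f : Y ⟶ X)

/-- Sections of `f_* K` over `V` as sections of `K` over `f⁻¹ V`. -/
def ofPf (K : Y.Modules) (V : X.Opens) :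
    Γ((Scheme.Modules.pushforward f).obj K, V) ≃+ Γ(K, f ⁻¹ᵁ V) := AddEquiv.refl _

/-- Pullback of functions. -/
def funPb (V : X.Opens) : Γ(X, V) →+* Γ(Y, f ⁻¹ᵁ V) := (f.app V).hom

lemma ofPf_smul (K : Y.Modules) (V : X.Opens) (r : Γ(X, V))
    (x : Γ((Scheme.Modules.pushforward f).obj K, V)) :
    ofPf f K V (r • x) = funPb f V r • ofPf f K V x := rfl

lemma ofPf_secRes (K : Y.Modules) (h : W ≤ V)
    (x : Γ((Scheme.Modules.pushforward f).obj K, V)) :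
    ofPf f K W (secRes _ h x) = secRes K (f.preimage_mono h) (ofPf f K V x) := rfl

lemma funPb_funRes (h : W ≤ V) (r : Γ(X, V)) :
    funPb f W (funRes h r) = funRes (f.preimage_mono h) (funPb f V r) :=
  congr($(f.naturality (homOfLE h).op) r)

/-- Pullback of sections, `Γ(M, V) → Γ(f^* M, f⁻¹ V)`: the unit of the adjunction between `f^*` and
`f_*`. -/
def pbSec (M : X.Modules) (V : X.Opens) :
    Γ(M, V) →+ Γ((Scheme.Modules.pullback f).obj M, f ⁻¹ᵁ V) :=
  (ofPf f _ V).toAddMonoidHom.comp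
    (((Scheme.Modules.pullbackPushforwardAdjunction f).unit.app M).app V).hom

lemma pbSec_eq (x : Γ(M, V)) : pbSec f M V x = ofPf f _ V
    (((Scheme.Modules.pullbackPushforwardAdjunction f).unit.app M).app V x) := rfl

lemma pbSec_smul (r : Γ(X, V)) (x : Γ(M, V)) :
    pbSec f M V (r • x) = funPb f V r • pbSec f M V x := by
  rw [pbSec_eq, Scheme.Modules.Hom.app_smul, ofPf_smul]; rfl

lemma pbSec_secRes (h : W ≤ V) (x : Γ(M, V)) :
    pbSec f M W (secRes M h x) = secRes _ (f.preimage_mono h) (pbSec f M V x) :=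
  congrArg (ofPf f _ W) (app_secRes _ h x)

lemma map_pbSec (φ : M ⟶ N) (x : Γ(M, V)) :
    ((Scheme.Modules.pullback f).map φ).app (f ⁻¹ᵁ V) (pbSec f M V x) =
      pbSec f N V (φ.app V x) := by
  have := (Scheme.Modules.pullbackPushforwardAdjunction f).unit.naturality φ
  exact congr($(this).app V x).symm

/-- A morphism out of `f^* M` is determined by its values on pulled back sections. -/
lemma pullback_hom_ext {K : Y.Modules} {φ ψ : (Scheme.Modules.pullback f).obj M ⟶ K}
    (h : ∀ V (x : Γ(M, V)), φ.app _ (pbSec f M V x) = ψ.app _ (pbSec f M V x)) : φ = ψ := by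
  apply ((Scheme.Modules.pullbackPushforwardAdjunction f).homEquiv _ _).injective
  apply hom_ext_apply
  intro V x
  rw [Adjunction.homEquiv_unit, Adjunction.homEquiv_unit]
  exact h V x

/-- A local homomorphism out of `f^* M` is determined by its values on pulled back sections. -/
lemma pullback_localHom_ext {K : Y.Modules}
    {l m : LocalHom (f ⁻¹ᵁ U) ((Scheme.Modules.pullback f).obj M) K}
    (h : ∀ V (hV : V ≤ U) (x : Γ(M, V)), l.toFun _ (f.preimage_mono hV) (pbSec f M V x) =
      m.toFun _ (f.preimage_mono hV) (pbSec f M V x)) : l = m := by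
  rw [← l.ofHom_toHom, ← m.ofHom_toHom]
  congr 1
  apply pullback_hom_ext f
  intro V x
  rw [LocalHom.toHom_app, LocalHom.toHom_app]
  congr 1
  have := h (V ⊓ U) inf_le_right (secRes M inf_le_left x)
  rwa [pbSec_secRes] at this

/-- A semilinear family of maps from sections of `M` over opens in `U` to sections of `K` over
their preimages extends to a local homomorphism on `f^* M`. -/
lemma exists_pullback_localHom {K : Y.Modules} (g : ∀ V : X.Opens, V ≤ U → Γ(M, V) → Γ(K, f ⁻¹ᵁ V))
    (hadd : ∀ V h x y, g V h (x + y) = g V h x + g V h y)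
    (hsmul : ∀ V h (r : Γ(X, V)) x, g V h (r • x) = funPb f V r • g V h x)
    (hres : ∀ V h W (h' : W ≤ V) x,
      g W (h'.trans h) (secRes M h' x) = secRes K (f.preimage_mono h') (g V h x)) :
    ∃ l : LocalHom (f ⁻¹ᵁ U) ((Scheme.Modules.pullback f).obj M) K,
      ∀ V h x, l.toFun _ (f.preimage_mono h) (pbSec f M V x) = g V h x := by
  have hle (V : X.Opens) : f ⁻¹ᵁ V ⊓ f ⁻¹ᵁ U ≤ f ⁻¹ᵁ (V ⊓ U) := le_rfl
  let φ : M ⟶ (Scheme.Modules.pushforward f).obj (pushRes K (f ⁻¹ᵁ U)) :=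
    mkHom (N := (Scheme.Modules.pushforward f).obj (pushRes K (f ⁻¹ᵁ U)))
      (fun V x ↦ (ofPf f _ V).symm (toPush K (f ⁻¹ᵁ U) (f ⁻¹ᵁ V) (hle V) (g (V ⊓ U) inf_le_right
        (secRes M inf_le_left x))))
      (fun V x y ↦ by rw [_root_.map_add, hadd, _root_.map_add, _root_.map_add])
      (fun V r x ↦ by
        apply (ofPf f _ V).injective
        apply pushRes_ext
        rw [ofPf_smul, AddEquiv.apply_symm_apply, AddEquiv.apply_symm_apply, secRes_smul, hsmul,
          fromPush_smul, fromPush_toPush, fromPush_toPush, funPb_funRes]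
        exact (secRes_smul _ _ _).trans (by rw [funRes_funRes]))
      (fun V W h x ↦ by
        apply (ofPf f _ W).injective
        apply pushRes_ext
        rw [ofPf_secRes, AddEquiv.apply_symm_apply, AddEquiv.apply_symm_apply, fromPush_toPush,
          fromPush_secRes, fromPush_toPush]
        have := hres (V ⊓ U) inf_le_right (W ⊓ U) (inf_le_inf_right _ h) (secRes M inf_le_left x)
        rw [secRes_secRes] at this ⊢
        rw [this]
        exact secRes_secRes _ _ _)
  refine ⟨LocalHom.ofHom
    (((Scheme.Modules.pullbackPushforwardAdjunction f).homEquiv _ _).symm φ), fun V h x ↦ ?_⟩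
  have h1 : ((Scheme.Modules.pullbackPushforwardAdjunction f).homEquiv _ _)
    (((Scheme.Modules.pullbackPushforwardAdjunction f).homEquiv _ _).symm φ) = φ :=
    Equiv.apply_symm_apply _ _
  rw [Adjunction.homEquiv_unit] at h1
  have h2 := congr(ofPf f _ V ($(h1).app V x))
  have h3 := hres (V ⊓ U) inf_le_right V (le_inf le_rfl h) (secRes M inf_le_left x)
  have h4 : fromPush K (f ⁻¹ᵁ U) (f.preimage_mono h) le_rfl
      (ofPf f _ V (φ.app V x)) =
      secRes K ((le_inf le_rfl (f.preimage_mono h)).trans (hle V))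
        (g (V ⊓ U) inf_le_right (secRes M inf_le_left x)) :=
    fromPush_toPush _ _ (hle V) _
  rw [secRes_secRes, secRes_self] at h3
  exact (congrArg (fromPush K (f ⁻¹ᵁ U) (f.preimage_mono h) le_rfl) h2).trans (h4.trans h3.symm)

end Pullback

/-! ### Functionals, frames and dual bases -/

section Frames
variable {X Y : Scheme.{0}} {M N K : X.Modules} {U V W : X.Opens}

/-- Sections of the structure sheaf, seen as a module, are functions. -/
def unitEquiv (V : X.Opens) : Γ(structureSheaf X, V) ≃ₗ[Γ(X, V)] Γ(X, V) where
  toFun x := x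
  invFun x := x
  map_add' _ _ := rfl
  map_smul' _ _ := rfl
  left_inv _ := rfl
  right_inv _ := rfl

lemma unitEquiv_secRes (h : V ≤ U) (x : Γ(structureSheaf X, U)) :
    unitEquiv V (secRes _ h x) = funRes h (unitEquiv U x) := rfl

lemma unitEquiv_symm_funRes (h : V ≤ U) (x : Γ(X, U)) :
    (unitEquiv V).symm (funRes h x) = secRes _ h ((unitEquiv U).symm x) := rfl

/-- An `𝒪_U`-linear functional on `M|_U`, evaluated on a section. -/
def LocalHom.val (l : LocalHom U M (structureSheaf X)) (h : V ≤ U) (x : Γ(M, V)) : Γ(X, V) :=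
  unitEquiv V (l.toFun V h x)

lemma LocalHom.val_add (l : LocalHom U M (structureSheaf X)) (h : V ≤ U) (x y : Γ(M, V)) :
    l.val h (x + y) = l.val h x + l.val h y := by
  rw [val, l.map_add, _root_.map_add]; rfl

lemma LocalHom.val_smul (l : LocalHom U M (structureSheaf X)) (h : V ≤ U) (r : Γ(X, V))
    (x : Γ(M, V)) : l.val h (r • x) = r * l.val h x := by
  rw [val, l.map_smul, _root_.map_smul]; rfl

lemma LocalHom.val_secRes (l : LocalHom U M (structureSheaf X)) (h : V ≤ U) (h' : W ≤ V)
    (x : Γ(M, V)) : l.val (h'.trans h) (secRes M h' x) = funRes h' (l.val h x) := by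
  rw [val, l.map_res, unitEquiv_secRes]; rfl

/-- The functional as a linear map on sections over one open set. -/
def LocalHom.valLin (l : LocalHom U M (structureSheaf X)) (h : V ≤ U) :
    Γ(M, V) →ₗ[Γ(X, V)] Γ(X, V) :=
  (unitEquiv V).toLinearMap.comp (l.linMap h)

@[simp] lemma LocalHom.valLin_apply (l : LocalHom U M (structureSheaf X)) (h : V ≤ U)
    (x : Γ(M, V)) : l.valLin h x = l.val h x := rfl

/-- Construction of a functional from its values. -/
def LocalHom.mkVal (g : ∀ V : X.Opens, V ≤ U → Γ(M, V) → Γ(X, V))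
    (hadd : ∀ V h x y, g V h (x + y) = g V h x + g V h y)
    (hsmul : ∀ V h (r : Γ(X, V)) x, g V h (r • x) = r * g V h x)
    (hres : ∀ V h W (h' : W ≤ V) x, g W (h'.trans h) (secRes M h' x) = funRes h' (g V h x)) :
    LocalHom U M (structureSheaf X) where
  toFun V h x := (unitEquiv V).symm (g V h x)
  map_add V h x y := by rw [hadd, _root_.map_add]
  map_smul V h r x := by rw [hsmul]; rfl
  map_res V h W h' x := by rw [hres]; rfl

@[simp] lemma LocalHom.mkVal_val (g : ∀ V : X.Opens, V ≤ U → Γ(M, V) → Γ(X, V))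
    (hadd hsmul hres) (h : V ≤ U) (x : Γ(M, V)) :
    (LocalHom.mkVal (M := M) g hadd hsmul hres).val h x = g V h x := rfl

/-- The sections `s` of `M` over `U` form a basis of `M|_U`. -/
def IsFrame {ι : Type} [Fintype ι] (M : X.Modules) (U : X.Opens) (s : ι → Γ(M, U)) : Prop :=
  ∀ (V : X.Opens) (h : V ≤ U),
    Function.Bijective (fun a : ι → Γ(X, V) ↦ ∑ j, a j • secRes M h (s j))

/-- Finitely many sections of `M` over `U` together with functionals on `M|_U` such that
`x = ∑ j, coord j x • elt j` for all local sections `x`. -/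
structure DualBasis (M : X.Modules) (U : X.Opens) (ι : Type) [Fintype ι] where
  elt : ι → Γ(M, U)
  coord : ι → LocalHom U M (structureSheaf X)
  sum_eq : ∀ (V : X.Opens) (h : V ≤ U) (x : Γ(M, V)),
    ∑ j, (coord j).val h x • secRes M h (elt j) = x

variable {ι κ : Type} [Fintype ι] [Fintype κ]

lemma IsFrame.restrict {s : ι → Γ(M, U)} (hs : IsFrame M U s) (h : V ≤ U) :
    IsFrame M V (fun j ↦ secRes M h (s j)) := by
  intro W hW
  simpa using hs W (hW.trans h)

lemma IsFrame.ext {s : ι → Γ(M, U)} (hs : IsFrame M U s) (h : V ≤ U) {a b : ι → Γ(X, V)}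
    (hab : ∑ j, a j • secRes M h (s j) = ∑ j, b j • secRes M h (s j)) (j : ι) : a j = b j :=
  congrFun ((hs V h).1 hab) j

/-- A frame, together with its coordinate functionals, is a dual basis. -/
lemma IsFrame.exists_dualBasis {s : ι → Γ(M, U)} (hs : IsFrame M U s) :
    ∃ d : DualBasis M U ι, d.elt = s := by
  classical
  choose g hg using fun (V : X.Opens) (h : V ≤ U) (x : Γ(M, V)) ↦ (hs V h).2 x
  have hu (V : X.Opens) (h : V ≤ U) (x : Γ(M, V)) (a : ι → Γ(X, V))
      (ha : ∑ j, a j • secRes M h (s j) = x) : g V h x = a :=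
    (hs V h).1 ((hg V h x).trans ha.symm)
  refine ⟨⟨s, fun j ↦ LocalHom.mkVal (fun V h x ↦ g V h x j) ?_ ?_ ?_, ?_⟩, rfl⟩
  · intro V h x y
    rw [hu V h (x + y) (g V h x + g V h y)]
    · rfl
    · simp only [Pi.add_apply, add_smul, Finset.sum_add_distrib]
      exact congrArg₂ (· + ·) (hg V h x) (hg V h y)
  · intro V h r x
    rw [hu V h (r • x) (r • g V h x)]
    · rfl
    · simp only [Pi.smul_apply, smul_eq_mul, mul_smul, ← Finset.smul_sum]
      exact congrArg (r • ·) (hg V h x)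
  · intro V h W h' x
    rw [hu W (h'.trans h) (secRes M h' x) (fun j ↦ funRes h' (g V h x j))]
    have := congrArg (secRes M h') (hg V h x)
    simpa [map_sum] using this
  · intro V h x
    simpa using hg V h x

lemma IsFrame.val_self [DecidableEq ι] {s : ι → Γ(M, U)} (hs : IsFrame M U s) (d : DualBasis M U ι)
    (hd : d.elt = s) (j k : ι) : (d.coord j).val le_rfl (s k) = if j = k then 1 else 0 := by
  refine hs.ext le_rfl (a := fun j ↦ (d.coord j).val le_rfl (s k))
    (b := fun j ↦ if j = k then 1 else 0) ?_ j
  have := d.sum_eq U le_rfl (s k)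
  rw [hd] at this
  rw [this]
  simp

/-- A dual basis whose sections and functionals are dual to each other is a frame. -/
lemma DualBasis.isFrame [DecidableEq ι] (d : DualBasis M U ι)
    (hd : ∀ j k, (d.coord j).val le_rfl (d.elt k) = if j = k then 1 else 0) :
    IsFrame M U d.elt := by
  intro V h
  have hd' (j k) : (d.coord j).val h (secRes M h (d.elt k)) = if j = k then 1 else 0 := by
    rw [LocalHom.val_secRes (h := le_rfl), hd]
    split_ifs <;> simp
  refine ⟨fun a b hab ↦ ?_, fun x ↦ ⟨_, d.sum_eq V h x⟩⟩
  ext j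
  have := congrArg ((d.coord j).valLin h) hab
  simpa [map_sum, LocalHom.val_smul, hd'] using this

/-- If `M|_U` has a dual basis, a basis of `M(U)` is a frame. -/
lemma DualBasis.isFrame_basis (d : DualBasis M U ι) (b : Module.Basis κ Γ(X, U) Γ(M, U)) :
    IsFrame M U b := by
  classical
  let e : DualBasis M U κ :=
    { elt := b
      coord := fun k ↦ LocalHom.mkVal
        (fun V h x ↦ ∑ j, (d.coord j).val h x * funRes h (b.repr (d.elt j) k))
        (fun V h x y ↦ by simp [LocalHom.val_add, add_mul, Finset.sum_add_distrib])
        (fun V h r x ↦ by simp [LocalHom.val_smul, Finset.mul_sum, mul_assoc])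
        (fun V h W h' x ↦ by simp [LocalHom.val_secRes (h := h)])
      sum_eq := fun V h x ↦ by
        simp only [LocalHom.mkVal_val, Finset.sum_smul]
        rw [Finset.sum_comm]
        conv_rhs => rw [← d.sum_eq V h x]
        refine Finset.sum_congr rfl fun j _ ↦ ?_
        simp only [mul_smul, ← Finset.smul_sum]
        congr 1
        have := congrArg (secRes M h) (b.sum_repr (d.elt j))
        simpa only [map_sum, secRes_smul] using this }
  refine e.isFrame fun j k ↦ ?_
  have := congrArg (fun x ↦ b.repr x j) (d.sum_eq U le_rfl (b k))
  simp only [secRes_self, map_sum, _root_.map_smul, Finsupp.coe_finsetSum, Finset.sum_apply,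
    Finsupp.smul_apply, smul_eq_mul, Module.Basis.repr_self, Finsupp.single_apply] at this
  simp only [e, LocalHom.mkVal_val, funRes_self, this]
  simp [eq_comm]

/-- The basis of the module of sections given by a frame. -/
def IsFrame.basis {s : ι → Γ(M, U)} (hs : IsFrame M U s) : Module.Basis ι Γ(X, U) Γ(M, U) :=
  .ofEquivFun (LinearEquiv.ofBijective (Fintype.linearCombination Γ(X, U) s)
    (by
      convert hs U le_rfl using 2 with a
      simp [Fintype.linearCombination_apply])).symm

lemma DualBasis.span_eq_top (d : DualBasis M U ι) :
    Submodule.span Γ(X, U) (Set.range d.elt) = ⊤ := by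
  rw [eq_top_iff]
  intro x _
  rw [← d.sum_eq U le_rfl x]
  exact Submodule.sum_mem _ fun j _ ↦ Submodule.smul_mem _ _
    (Submodule.subset_span ⟨j, (secRes_self _ _).symm⟩)

/-- The sections of a module with a dual basis form a finitely generated module. -/
lemma DualBasis.finite (d : DualBasis M U ι) : Module.Finite Γ(X, U) Γ(M, U) :=
  ⟨Submodule.fg_def.mpr ⟨_, Set.finite_range d.elt, d.span_eq_top⟩⟩

/-- The sections of a module with a dual basis form a projective module. -/
lemma DualBasis.projective (d : DualBasis M U ι) : Module.Projective Γ(X, U) Γ(M, U) := by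
  classical
  refine Module.Projective.of_split (M := ι → Γ(X, U))
    (LinearMap.pi fun j ↦ (d.coord j).valLin le_rfl) (Fintype.linearCombination Γ(X, U) d.elt) ?_
  ext x
  simpa [Fintype.linearCombination_apply] using d.sum_eq U le_rfl x

/-- A dual basis of a retract. -/
def DualBasis.retract (d : DualBasis M U ι) (i : N ⟶ M) (r : M ⟶ N) (h : i ≫ r = 𝟙 N) :
    DualBasis N U ι where
  elt j := r.app U (d.elt j)
  coord j := (LocalHom.ofGlobal i U).comp (d.coord j)
  sum_eq V hV x := by
    have := congrArg (r.app V) (d.sum_eq V hV (i.app V x))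
    have h2 : r.app V (i.app V x) = x := congr($(h).app V x)
    rw [map_sum, h2] at this
    refine Eq.trans (Finset.sum_congr rfl fun j _ ↦ ?_) this
    rw [Scheme.Modules.Hom.app_smul, app_secRes]
    rfl

section Pullback
variable (f : Y ⟶ X)

/-- Functionals pull back. -/
lemma LocalHom.exists_pullback_val (l : LocalHom U M (structureSheaf X)) :
    ∃ l' : LocalHom (f ⁻¹ᵁ U) ((Scheme.Modules.pullback f).obj M) (structureSheaf Y),
      ∀ V (h : V ≤ U) (x : Γ(M, V)),
        l'.val (f.preimage_mono h) (pbSec f M V x) = funPb f V (l.val h x) := by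
  obtain ⟨l', hl'⟩ := exists_pullback_localHom (M := M) (U := U) f (K := structureSheaf Y)
    (fun V h x ↦ (unitEquiv _).symm (funPb f V (l.val h x)))
    (fun V h x y ↦ by rw [LocalHom.val_add, _root_.map_add, _root_.map_add])
    (fun V h r x ↦ by rw [LocalHom.val_smul, map_mul]; rfl)
    (fun V h W h' x ↦ by
      rw [LocalHom.val_secRes (h := h), funPb_funRes, unitEquiv_symm_funRes])
  exact ⟨l', fun V h x ↦ by rw [LocalHom.val, hl', LinearEquiv.apply_symm_apply]⟩

/-- Dual bases pull back. -/
lemma DualBasis.exists_pullback (d : DualBasis M U ι) :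
    ∃ e : DualBasis ((Scheme.Modules.pullback f).obj M) (f ⁻¹ᵁ U) ι,
      (∀ j, e.elt j = pbSec f M U (d.elt j)) ∧ ∀ j V (h : V ≤ U) (x : Γ(M, V)),
        (e.coord j).val (f.preimage_mono h) (pbSec f M V x) = funPb f V ((d.coord j).val h x) := by
  choose l hl using fun j ↦ (d.coord j).exists_pullback_val f
  refine ⟨⟨fun j ↦ pbSec f M U (d.elt j), l, fun V h x ↦ ?_⟩, fun _ ↦ rfl, hl⟩
  let T : LocalHom (f ⁻¹ᵁ U) ((Scheme.Modules.pullback f).obj M)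
      ((Scheme.Modules.pullback f).obj M) :=
    { toFun := fun V h x ↦ ∑ j, (l j).val h x • secRes _ h (pbSec f M U (d.elt j))
      map_add := fun V h x y ↦ by
        simp [LocalHom.val_add, add_smul, Finset.sum_add_distrib]
      map_smul := fun V h r x ↦ by simp [LocalHom.val_smul, Finset.smul_sum, mul_smul]
      map_res := fun V h W h' x ↦ by simp [map_sum, LocalHom.val_secRes (h := h)] }
  have hT : T = LocalHom.ofGlobal (𝟙 _) _ := by
    apply pullback_localHom_ext f
    intro V hV x
    change ∑ j, (l j).val _ _ • secRes _ _ (pbSec f M U (d.elt j)) = pbSec f M V x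
    conv_rhs => rw [← d.sum_eq V hV x]
    rw [map_sum]
    refine Finset.sum_congr rfl fun j _ ↦ ?_
    rw [hl, pbSec_smul, pbSec_secRes]
  exact congr(($hT).toFun V h x)

/-- Frames pull back. -/
lemma IsFrame.pullback {s : ι → Γ(M, U)} (hs : IsFrame M U s) :
    IsFrame ((Scheme.Modules.pullback f).obj M) (f ⁻¹ᵁ U) (fun j ↦ pbSec f M U (s j)) := by
  classical
  obtain ⟨d, rfl⟩ := hs.exists_dualBasis
  obtain ⟨e, he, he'⟩ := d.exists_pullback f
  have h : e.elt = fun j ↦ pbSec f M U (d.elt j) := funext he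
  rw [← h]
  refine e.isFrame fun j k ↦ ?_
  rw [he]
  refine (he' j U le_rfl (d.elt k)).trans ?_
  rw [hs.val_self d rfl]
  split_ifs <;> simp

end Pullback

/-- Two frames over a nonempty open set have the same size. -/
lemma IsFrame.card_eq {s : ι → Γ(M, U)} {t : κ → Γ(M, U)} (hs : IsFrame M U s)
    (ht : IsFrame M U t) [Nonempty U] : Fintype.card ι = Fintype.card κ :=
  Fintype.card_congr (hs.basis.indexEquiv ht.basis)

end Frames

/-! ### Gluing homomorphisms along frames -/

section Gluing
variable {X : Scheme.{0}} {M N K : X.Modules} {U : Fin 2 → X.Opens} {ι : Type} [Fintype ι]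

lemma inf_iSup_cover {κ : Type} {U : κ → X.Opens} (hU : ⨆ i, U i = ⊤) (V : X.Opens) :
    V ≤ ⨆ i, V ⊓ U i := by
  rw [← inf_iSup_eq, hU, inf_top_eq]

/-- Local homomorphisms over the members of a cover of `W` that agree on overlaps glue. -/
lemma exists_glue_localHom_of_le {κ : Type} {W : X.Opens} {U : κ → X.Opens} (hUW : ∀ i, U i ≤ W)
    (hU : W ≤ ⨆ i, U i) (l : ∀ i, LocalHom (U i) M N)
    (hl : ∀ i j V (h : V ≤ U i) (h' : V ≤ U j) x, (l i).toFun V h x = (l j).toFun V h' x) :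
    ∃ l' : LocalHom W M N, ∀ i V (h : V ≤ U i) x,
      l'.toFun V (h.trans (hUW i)) x = (l i).toFun V h x := by
  have hc {V : X.Opens} (hV : V ≤ W) : V ≤ ⨆ i, V ⊓ U i := by
    rw [← inf_iSup_eq]; exact le_inf le_rfl (hV.trans hU)
  have key (V : X.Opens) (hV : V ≤ W) (x : Γ(M, V)) : ∃ y : Γ(N, V), ∀ i,
      secRes N (inf_le_left : V ⊓ U i ≤ V) y =
        (l i).toFun (V ⊓ U i) inf_le_right (secRes M inf_le_left x) := by
    refine exists_glue (fun i ↦ V ⊓ U i) (fun i ↦ inf_le_left) (hc hV) _ fun i j ↦ ?_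
    rw [← (l i).map_res, ← (l j).map_res, secRes_secRes, secRes_secRes]
    exact hl _ _ _ _ _ _
  choose g hg using key
  have hu (V : X.Opens) (hV : V ≤ W) (x : Γ(M, V)) (y : Γ(N, V)) (hy : ∀ i,
      secRes N (inf_le_left : V ⊓ U i ≤ V) y =
        (l i).toFun (V ⊓ U i) inf_le_right (secRes M inf_le_left x)) : g V hV x = y :=
    sec_ext_of_cover (fun i ↦ V ⊓ U i) (fun i ↦ inf_le_left) (hc hV)
      fun i ↦ (hg V hV x i).trans (hy i).symm
  refine ⟨⟨g, ?_, ?_, ?_⟩, ?_⟩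
  · intro V hV x y
    refine hu _ _ _ _ fun i ↦ ?_
    rw [map_add, map_add, (l i).map_add, hg, hg]
  · intro V hV r x
    refine hu _ _ _ _ fun i ↦ ?_
    rw [secRes_smul, secRes_smul, (l i).map_smul, hg]
  · intro V hV W' h x
    refine hu _ _ _ _ fun i ↦ ?_
    have := congrArg (secRes N (inf_le_inf_right (U i) h)) (hg V hV x i)
    rw [← (l i).map_res] at this
    simpa only [secRes_secRes] using this
  · intro i V h x
    have := congrArg (secRes N (le_inf le_rfl h)) (hg V (h.trans (hUW i)) x i)
    rw [← (l i).map_res] at this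
    simp only [secRes_secRes, secRes_self] at this
    exact this

/-- Compatible local homomorphisms over the members of an open cover glue. -/
lemma exists_glue_localHom {κ : Type} {U : κ → X.Opens} (hU : ⨆ i, U i = ⊤)
    (l : ∀ i, LocalHom (U i) M N)
    (hl : ∀ i j V (h : V ≤ U i) (h' : V ≤ U j) x, (l i).toFun V h x = (l j).toFun V h' x) :
    ∃ φ : M ⟶ N, ∀ i V (h : V ≤ U i) x, φ.app V x = (l i).toFun V h x := by
  obtain ⟨l', hl'⟩ := exists_glue_localHom_of_le (W := ⊤) (fun _ ↦ le_top) hU.ge l hl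
  exact ⟨mkHom (fun V ↦ l'.toFun V le_top) (fun _ ↦ l'.map_add _ _) (fun _ ↦ l'.map_smul _ _)
    (fun V W h ↦ l'.map_res V le_top W h), hl'⟩

/-- The local homomorphism with prescribed values on a frame. -/
lemma IsFrame.exists_localHom {V : X.Opens} {s : ι → Γ(M, V)} (hs : IsFrame M V s)
    (m : ι → Γ(N, V)) : ∃ l : LocalHom V M N, ∀ j, l.toFun V le_rfl (s j) = m j := by
  classical
  obtain ⟨d, rfl⟩ := hs.exists_dualBasis
  refine ⟨
    { toFun := fun V h x ↦ ∑ j, (d.coord j).val h x • secRes _ h (m j)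
      map_add := fun V h x y ↦ by simp [LocalHom.val_add, add_smul, Finset.sum_add_distrib]
      map_smul := fun V h r x ↦ by simp [LocalHom.val_smul, Finset.smul_sum, mul_smul]
      map_res := fun V h W h' x ↦ by simp [map_sum, LocalHom.val_secRes (h := h)] }, fun j ↦ ?_⟩
  simp [hs.val_self d rfl]

lemma LocalHom.map_sum_smul {V W : X.Opens} (l : LocalHom V M N) (h : W ≤ V) (a : ι → Γ(X, W))
    (s : ι → Γ(M, V)) :
    l.toFun W h (∑ j, a j • secRes M h (s j)) =
      ∑ j, a j • secRes N h (l.toFun V le_rfl (s j)) := by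
  have := map_sum (l.linMap h) (fun j ↦ a j • secRes M h (s j)) Finset.univ
  simp only [_root_.map_smul, LocalHom.linMap_apply] at this
  refine this.trans (Finset.sum_congr rfl fun j _ ↦ ?_)
  rw [← l.map_res]

/-- A local homomorphism is determined by its values on a frame. -/
lemma IsFrame.localHom_ext {V W : X.Opens} {s : ι → Γ(M, V)} (hs : IsFrame M V s)
    {l l' : LocalHom V M N} (h : ∀ j, l.toFun V le_rfl (s j) = l'.toFun V le_rfl (s j))
    (hW : W ≤ V) (x : Γ(M, W)) : l.toFun W hW x = l'.toFun W hW x := by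
  obtain ⟨a, rfl⟩ := (hs W hW).2 x
  simp only [LocalHom.map_sum_smul, h]

/-- A homomorphism is determined by its values on frames over an open cover. -/
lemma hom_ext_of_frames {κ : Type} {U : κ → X.Opens} (hU : ⨆ i, U i = ⊤) {s : ∀ i, ι → Γ(M, U i)}
    (hs : ∀ i, IsFrame M (U i) (s i)) {φ ψ : M ⟶ N}
    (h : ∀ i j, φ.app (U i) (s i j) = ψ.app (U i) (s i j)) : φ = ψ := by
  apply hom_ext_apply
  intro V x
  refine sec_ext_of_cover (fun i ↦ V ⊓ U i) (fun i ↦ inf_le_left) (inf_iSup_cover hU V) fun i ↦ ?_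
  rw [← app_secRes, ← app_secRes]
  exact (hs i).localHom_ext (l := .ofGlobal φ (U i)) (l' := .ofGlobal ψ (U i)) (h i) inf_le_right _

/-- A module with frames over a cover by two open sets maps to any module with sections satisfying
the same transition relation. -/
lemma exists_hom_of_frames (hU : ⨆ i, U i = ⊤) {s : ∀ i, ι → Γ(M, U i)}
    (hs : ∀ i, IsFrame M (U i) (s i)) (m : ∀ i, ι → Γ(N, U i)) (G : ι → ι → Γ(X, U 0 ⊓ U 1))
    (hsG : ∀ j, secRes M inf_le_left (s 0 j) = ∑ k, G j k • secRes M inf_le_right (s 1 k))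
    (hmG : ∀ j, secRes N inf_le_left (m 0 j) = ∑ k, G j k • secRes N inf_le_right (m 1 k)) :
    ∃ φ : M ⟶ N, ∀ i j, φ.app (U i) (s i j) = m i j := by
  choose l hl using fun i ↦ (hs i).exists_localHom (m i)
  have h01 : ∀ V (h : V ≤ U 0) (h' : V ≤ U 1) x, (l 0).toFun V h x = (l 1).toFun V h' x := by
    intro V h h' x
    refine ((hs 0).restrict (inf_le_left : U 0 ⊓ U 1 ≤ U 0)).localHom_ext
      (l := (l 0).restrict inf_le_left) (l' := (l 1).restrict inf_le_right) (fun j ↦ ?_)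
      (le_inf h h') x
    change (l 0).toFun _ _ (secRes M _ (s 0 j)) = (l 1).toFun _ _ (secRes M _ (s 0 j))
    rw [(l 0).map_res _ le_rfl, hl, hsG, LocalHom.map_sum_smul, hmG]
    simp only [hl]
  obtain ⟨φ, hφ⟩ := exists_glue_localHom hU l (by
    intro i j V h h' x
    fin_cases i <;> fin_cases j
    · rfl
    · exact h01 _ _ _ _
    · exact (h01 _ _ _ _).symm
    · rfl)
  exact ⟨φ, fun i j ↦ (hφ i _ le_rfl _).trans (hl i j)⟩

/-- Two modules with frames that have the same transition matrix are isomorphic. -/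
lemma nonempty_iso_of_frames (hU : ⨆ i, U i = ⊤) {s : ∀ i, ι → Γ(M, U i)}
    (hs : ∀ i, IsFrame M (U i) (s i)) {m : ∀ i, ι → Γ(N, U i)} (hm : ∀ i, IsFrame N (U i) (m i))
    (G : ι → ι → Γ(X, U 0 ⊓ U 1))
    (hsG : ∀ j, secRes M inf_le_left (s 0 j) = ∑ k, G j k • secRes M inf_le_right (s 1 k))
    (hmG : ∀ j, secRes N inf_le_left (m 0 j) = ∑ k, G j k • secRes N inf_le_right (m 1 k)) :
    Nonempty (M ≅ N) := by
  obtain ⟨φ, hφ⟩ := exists_hom_of_frames hU hs m G hsG hmG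
  obtain ⟨ψ, hψ⟩ := exists_hom_of_frames hU hm s G hmG hsG
  refine ⟨⟨φ, ψ, ?_, ?_⟩⟩
  · refine hom_ext_of_frames hU hs fun i j ↦ ?_
    exact (congrArg (ψ.app (U i)) (hφ i j)).trans (hψ i j)
  · refine hom_ext_of_frames hU hm fun i j ↦ ?_
    exact (congrArg (φ.app (U i)) (hψ i j)).trans (hφ i j)

/-- Frames of two modules give a frame of their direct sum. -/
lemma IsFrame.biprod {V : X.Opens} {x : Γ(M, V)} {y : Γ(N, V)}
    (hx : IsFrame M V (fun _ : Fin 1 ↦ x)) (hy : IsFrame N V (fun _ : Fin 1 ↦ y)) :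
    IsFrame (M ⊞ N) V
      ![(biprod.inl : M ⟶ M ⊞ N).app V x, (biprod.inr : N ⟶ M ⊞ N).app V y] := by
  intro W h
  have e (a : Fin 2 → Γ(X, W)) : (∑ j, a j • secRes (M ⊞ N) h
      (![(biprod.inl : M ⟶ M ⊞ N).app V x, (biprod.inr : N ⟶ M ⊞ N).app V y] j)) =
      (biprod.inl : M ⟶ M ⊞ N).app W (a 0 • secRes M h x) +
      (biprod.inr : N ⟶ M ⊞ N).app W (a 1 • secRes N h y) := by
    rw [Fin.sum_univ_two, Scheme.Modules.Hom.app_smul, Scheme.Modules.Hom.app_smul, app_secRes,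
      app_secRes]
    rfl
  have h1 (z : Γ(M, W)) : (biprod.fst : M ⊞ N ⟶ M).app W ((biprod.inl : M ⟶ M ⊞ N).app W z) = z :=
    congr($(biprod.inl_fst (X := M) (Y := N)).app W z)
  have h2 (z : Γ(N, W)) : (biprod.fst : M ⊞ N ⟶ M).app W ((biprod.inr : N ⟶ M ⊞ N).app W z) = 0 :=
    congr($(biprod.inr_fst (X := M) (Y := N)).app W z)
  have h3 (z : Γ(M, W)) : (biprod.snd : M ⊞ N ⟶ N).app W ((biprod.inl : M ⟶ M ⊞ N).app W z) = 0 :=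
    congr($(biprod.inl_snd (X := M) (Y := N)).app W z)
  have h4 (z : Γ(N, W)) : (biprod.snd : M ⊞ N ⟶ N).app W ((biprod.inr : N ⟶ M ⊞ N).app W z) = z :=
    congr($(biprod.inr_snd (X := M) (Y := N)).app W z)
  have h5 (z : Γ(M ⊞ N, W)) : (biprod.inl : M ⟶ M ⊞ N).app W ((biprod.fst : M ⊞ N ⟶ M).app W z) +
      (biprod.inr : N ⟶ M ⊞ N).app W ((biprod.snd : M ⊞ N ⟶ N).app W z) = z :=
    congr($(biprod.total (X := M) (Y := N)).app W z)
  constructor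
  · intro a b hab
    simp only [e] at hab
    have ha := congrArg ((biprod.fst : M ⊞ N ⟶ M).app W) hab
    have hb := congrArg ((biprod.snd : M ⊞ N ⟶ N).app W) hab
    simp only [map_add, h1, h2, h3, h4, add_zero, zero_add] at ha hb
    ext j
    fin_cases j
    · exact hx.ext h (a := fun _ ↦ a 0) (b := fun _ ↦ b 0) (by simpa using ha) 0
    · exact hy.ext h (a := fun _ ↦ a 1) (b := fun _ ↦ b 1) (by simpa using hb) 0
  · intro z
    obtain ⟨a, ha⟩ := (hx W h).2 ((biprod.fst : M ⊞ N ⟶ M).app W z)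
    obtain ⟨b, hb⟩ := (hy W h).2 ((biprod.snd : M ⊞ N ⟶ N).app W z)
    refine ⟨![a 0, b 0], ?_⟩
    have ha' : a 0 • secRes M h x = (biprod.fst : M ⊞ N ⟶ M).app W z := by simpa using ha
    have hb' : b 0 • secRes N h y = (biprod.snd : M ⊞ N ⟶ N).app W z := by simpa using hb
    refine (e _).trans ?_
    simp only [Matrix.cons_val_zero, Matrix.cons_val_one]
    rw [ha', hb']
    exact h5 z

end Gluing

/-! ### Exactness in terms of sections -/

section Exactness
variable {X : Scheme.{0}} {M N K : X.Modules} {U V W : X.Opens}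

/-- The functor of sections over an open set. -/
def sections (V : X.Opens) : X.Modules ⥤ AddCommGrpCat.{0} :=
  Scheme.Modules.toPresheaf X ⋙ (CategoryTheory.evaluation _ _).obj (.op V)

instance (V : X.Opens) : PreservesLimits (sections V) :=
  have : PreservesLimits ((CategoryTheory.evaluation (X.Opensᵒᵖ) AddCommGrpCat.{0}).obj (.op V)) :=
    ⟨fun {_} _ ↦ evaluation_preservesLimitsOfShape _⟩
  comp_preservesLimits (Scheme.Modules.toPresheaf X)
    ((CategoryTheory.evaluation (X.Opensᵒᵖ) AddCommGrpCat.{0}).obj (.op V))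

instance (V : X.Opens) : (sections V).PreservesZeroMorphisms where
  map_zero _ _ := rfl

/-- Taking sections is left exact. -/
lemma mem_range_of_exact {φ : M ⟶ N} {ψ : N ⟶ K} (w : φ ≫ ψ = 0)
    (h : (ShortComplex.mk φ ψ w).Exact) [Mono φ] {z : Γ(N, V)} (hz : ψ.app V z = 0) :
    ∃ y, φ.app V y = z := by
  have h1 := h.map_of_mono_of_preservesKernel (sections V) (by assumption) (by infer_instance)
  rw [ShortComplex.ab_exact_iff] at h1
  exact h1 z hz

lemma app_injective_of_mono (φ : M ⟶ N) [Mono φ] (V : X.Opens) :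
    Function.Injective (φ.app V) := by
  have : Mono ((sections V).map φ) := inferInstance
  exact (AddCommGrpCat.mono_iff_injective _).mp this

/-- An epimorphism of sheaves of modules is locally surjective: the sheafification of the presheaf
cokernel vanishes, so every section of that presheaf is locally zero. -/
lemma exists_local_lift_sheafOfModules {R : Sheaf (Opens.grothendieckTopology X) RingCat.{0}}
    {M N : SheafOfModules.{0} R} (φ : M ⟶ N) [Epi φ] (V : X.Opens) (z : N.val.obj (.op V)) (x : X)
    (hx : x ∈ V) :
    ∃ (W : X.Opens) (h : W ≤ V), x ∈ W ∧ ∃ y : M.val.obj (.op W), φ.val.app (.op W) y =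
      N.val.map (homOfLE h).op z := by
  let F := SheafOfModules.forget.{0} R ⋙ PresheafOfModules.restrictScalars (𝟙 R.obj)
  let S := PresheafOfModules.sheafification.{0} (𝟙 R.obj)
  let adj : S ⊣ F := PresheafOfModules.sheafificationAdjunction.{0} (𝟙 R.obj)
  have : IsIso adj.counit :=
    inferInstanceAs (IsIso (PresheafOfModules.sheafificationAdjunction.{0} (𝟙 R.obj)).counit)
  let c : F.obj N ⟶ _ := cokernel.π (F.map φ)
  have hw : F.map φ ≫ c = 0 := cokernel.condition _
  have : Epi (S.map (F.map φ)) := by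
    have h1 := adj.counit.naturality φ
    have h2 : S.map (F.map φ) = adj.counit.app M ≫ φ ≫ inv (adj.counit.app N) := by
      rw [← Category.assoc, IsIso.eq_comp_inv]; exact h1
    have h3 : Epi (adj.counit.app M ≫ φ) := epi_comp' inferInstance ‹_›
    rw [h2, ← Category.assoc]
    exact epi_comp' h3 inferInstance
  have hc : S.map c = 0 := by
    rw [← cancel_epi (S.map (F.map φ)), ← S.map_comp, hw]
    simp
  have h1 : c ≫ adj.unit.app _ = 0 := by
    refine (adj.unit.naturality c).trans ?_
    dsimp only [Functor.comp_map]
    rw [hc]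
    simp
  have h2 := Presheaf.equalizerSieve_mem (Opens.grothendieckTopology X)
    (CategoryTheory.toSheafify (Opens.grothendieckTopology X) (cokernel (F.map φ)).presheaf)
    (X := .op V) (c.app (.op V) z) 0 (by
      rw [map_zero]
      exact congr(($h1).app (.op V) z))
  obtain ⟨W, i, hi, hxW⟩ := h2 x hx
  have h3 : c.app (.op W) ((F.obj N).map i.op z) = 0 :=
    (PresheafOfModules.naturality_apply c i.op z).trans (hi.trans (map_zero _))
  have h4 := (ShortComplex.exact_cokernel (F.map φ)).map_of_epi_of_preservesCokernel
    (PresheafOfModules.evaluation _ (.op W)) (by dsimp; infer_instance) (by infer_instance)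
  rw [ShortComplex.moduleCat_exact_iff] at h4
  obtain ⟨y, hy⟩ := h4 _ h3
  exact ⟨W, i.le, hxW, y, hy⟩

/-- An epimorphism of `𝒪_X`-modules is locally surjective. -/
lemma exists_local_lift (φ : M ⟶ N) [h : Epi φ] (z : Γ(N, V)) (x : X) (hx : x ∈ V) :
    ∃ (W : X.Opens) (h : W ≤ V), x ∈ W ∧ ∃ y : Γ(M, W), φ.app W y = secRes N h z :=
  have : Epi (C := SheafOfModules X.ringCatSheaf) φ := h
  exists_local_lift_sheafOfModules (R := X.ringCatSheaf) (M := M) (N := N) φ V z x hx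

/-- A locally surjective homomorphism is an epimorphism. -/
lemma epi_of_exists_local_lift (φ : M ⟶ N) (h : ∀ (V : X.Opens) (z : Γ(N, V)) (x : X), x ∈ V →
    ∃ (W : X.Opens) (h : W ≤ V), x ∈ W ∧ ∃ y : Γ(M, W), φ.app W y = secRes N h z) : Epi φ := by
  refine ⟨fun {K} g g' hg ↦ hom_ext_apply fun V z ↦ ?_⟩
  choose W hW hx y hy using h V z
  refine sec_ext_of_cover (fun x : V ↦ W x x.2) (fun x ↦ hW x x.2)
    (fun x hxV ↦ TopologicalSpace.Opens.mem_iSup.mpr ⟨⟨x, hxV⟩, hx x hxV⟩) fun x ↦ ?_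
  rw [← app_secRes, ← app_secRes, ← hy]
  exact congr(($hg).app _ (y x x.2))

end Exactness

/-! ### The ideal sheaf of a closed subscheme -/

section Ideal
variable {X Z : Scheme.{0}} (i : Z ⟶ X) {V W : X.Opens}

lemma toPushforward_app (r : Γ(structureSheaf X, V)) :
    unitEquiv _ (ofPf i _ V ((toPushforward i).app V r)) = funPb i V (unitEquiv V r) := rfl

/-- The inclusion of the ideal sheaf in the structure sheaf. -/
def idealHom (U : X.Opens) : LocalHom U (idealSheaf i) (structureSheaf X) :=
  .ofGlobal (kernel.ι (toPushforward i)) U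

lemma idealHom_val_injective {U : X.Opens} (h : V ≤ U) :
    Function.Injective ((idealHom i U).val h) :=
  (unitEquiv V).injective.comp (app_injective_of_mono (kernel.ι (toPushforward i)) V)

lemma funPb_idealHom_val {U : X.Opens} (h : V ≤ U) (x : Γ(idealSheaf i, V)) :
    funPb i V ((idealHom i U).val h x) = 0 := by
  have := congr(($(kernel.condition (toPushforward i))).app V x)
  have h2 := congrArg (fun y ↦ unitEquiv _ (ofPf i _ V y)) this
  exact h2.trans (map_zero (unitEquiv _))

/-- Functions that vanish on `Z` are sections of its ideal sheaf. -/
lemma exists_idealHom_val_eq {U : X.Opens} (h : V ≤ U) {r : Γ(X, V)} (hr : funPb i V r = 0) :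
    ∃ x, (idealHom i U).val h x = r := by
  obtain ⟨x, hx⟩ := mem_range_of_exact (kernel.condition (toPushforward i))
    (ShortComplex.exact_kernel (toPushforward i)) (z := (unitEquiv V).symm r) (by
      apply (ofPf i _ V).injective
      apply (unitEquiv _).injective
      rw [toPushforward_app, LinearEquiv.apply_symm_apply, hr]
      exact (map_zero _).symm)
  exact ⟨x, congrArg (unitEquiv V) hx⟩

instance epi_toPushforward [IsClosedImmersion i] : Epi (toPushforward i) := by
  refine epi_of_exists_local_lift _ fun V z x hx ↦ ?_
  obtain ⟨W, hW, hxW, hWV⟩ := exists_isAffineOpen_mem_and_subset hx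
  obtain ⟨y, hy⟩ := i.app_surjective W hW (unitEquiv _ (ofPf i _ W (secRes _ hWV z)))
  exact ⟨W, hWV, hxW, (unitEquiv _).symm y, hy⟩

end Ideal

/-! ### The twists and the line bundles `𝒪(n)` -/

section Glue
variable {X : Scheme.{0}} {M N P K : X.Modules} {U V W : X.Opens}

/-- The map `resMul` multiplies sections by the given function. -/
lemma fromPush_resMul {V' : X.Opens} (h : W ≤ V) (a : Γ(X, W)) (hW : V' ≤ W) (hU : V' ≤ U)
    (s : Γ(pushRes M V, U)) :
    fromPush M W hW hU ((resMul M h a).app U s) =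
      funRes hW a • fromPush M V (hW.trans h) hU s := by
  have h1 := resMul_app M h a U s
  refine (congrArg (secRes M _) h1).trans ?_
  refine (secRes_smul _ _ _).trans ?_
  rw [← funRes_eq, funRes_funRes]
  congr 1
  exact secRes_secRes (M := M) (U := V.ι ''ᵁ V.ι ⁻¹ᵁ U) (V := W.ι ''ᵁ W.ι ⁻¹ᵁ U) (W := V')
    (image_preimage_ι_mono h U) _ s

lemma ofHom_toFun_secRes (φ : M ⟶ pushRes N U) (h : W ≤ U) (h' : W ≤ V) (x : Γ(M, V)) :
    (LocalHom.ofHom φ).toFun W h (secRes M h' x) = fromPush N U h h' (φ.app V x) := by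
  change fromPush N U h le_rfl (φ.app W (secRes M h' x)) = _
  rw [app_secRes, fromPush_secRes]

lemma pullback_section_ext (f : M ⟶ K) (g : N ⟶ K) {x y : Γ(Limits.pullback f g, V)}
    (h₁ : (pullback.fst f g).app V x = (pullback.fst f g).app V y)
    (h₂ : (pullback.snd f g).app V x = (pullback.snd f g).app V y) : x = y := by
  have h := ((IsPullback.of_hasPullback f g).map (sections V)).map (forget AddCommGrpCat)
  exact Types.ext_of_isPullback h h₁ h₂

lemma exists_pullback_section (f : M ⟶ K) (g : N ⟶ K) {x : Γ(M, V)} {y : Γ(N, V)}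
    (h : f.app V x = g.app V y) : ∃ z : Γ(Limits.pullback f g, V),
      (pullback.fst f g).app V z = x ∧ (pullback.snd f g).app V z = y := by
  have h' := ((IsPullback.of_hasPullback f g).map (sections V)).map (forget AddCommGrpCat)
  exact Types.exists_of_isPullback h' x y h

end Glue

section Twist
variable (M : P1.Modules) (n : ℤ) {V : P1.Opens}

lemma chart_inf : chart 0 ⊓ chart 1 = overlap := (Proj.basicOpen_mul _ _ _).symm

/-- The unit `(x₀ / x₁) ^ n` on the overlap of the charts. -/
def coordPow : Γ(P1, overlap) := (coordRatio ^ n).val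

lemma coordPow_mul_neg (n : ℤ) : coordPow n * coordPow (-n) = 1 := by
  rw [coordPow, coordPow, ← Units.val_mul, ← zpow_add]
  simp

/-- The trivialisation `M(n) ≅ M` over a chart. -/
def twistTriv : ∀ i : Fin 2, LocalHom (chart i) (twist M n) M
  | 0 => .ofHom (pullback.fst (resMul M (overlap_le 0) (coordRatio ^ n).val)
      (resMul M (overlap_le 1) 1))
  | 1 => .ofHom (pullback.snd (resMul M (overlap_le 0) (coordRatio ^ n).val)
      (resMul M (overlap_le 1) 1))

/-- The two trivialisations of `M(n)` differ by `(x₀ / x₁) ^ n`. -/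
lemma twistTriv_compat (h : V ≤ overlap) (z : Γ(twist M n, V)) :
    (twistTriv M n 1).toFun V (h.trans (overlap_le 1)) z =
      funRes h (coordPow n) • (twistTriv M n 0).toFun V (h.trans (overlap_le 0)) z := by
  have h1 := congr(($(pullback.condition (f := resMul M (overlap_le 0) (coordRatio ^ n).val)
    (g := resMul M (overlap_le 1) 1))).app V z)
  have h2 := congrArg (fromPush M overlap h le_rfl) h1
  have h3 := (fromPush_resMul (overlap_le 0) (coordRatio ^ n).val h le_rfl _).symm.trans
    (h2.trans (fromPush_resMul (M := M) (overlap_le 1) 1 h le_rfl _))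
  rw [map_one, one_smul] at h3
  exact h3.symm

lemma twist_ext {x y : Γ(twist M n, V)}
    (h : ∀ i, (twistTriv M n i).toFun (V ⊓ chart i) inf_le_right (secRes _ inf_le_left x) =
      (twistTriv M n i).toFun (V ⊓ chart i) inf_le_right (secRes _ inf_le_left y)) : x = y := by
  refine pullback_section_ext _ _ (pushRes_ext ?_) (pushRes_ext ?_)
  · exact (ofHom_toFun_secRes _ _ _ _).symm.trans ((h 0).trans (ofHom_toFun_secRes _ _ _ _))
  · exact (ofHom_toFun_secRes _ _ _ _).symm.trans ((h 1).trans (ofHom_toFun_secRes _ _ _ _))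

lemma exists_twist_section (s : ∀ i, Γ(M, V ⊓ chart i))
    (hs : secRes M (le_inf inf_le_left (inf_le_right.trans (overlap_le 1))) (s 1) =
      funRes (V := V ⊓ overlap) inf_le_right (coordPow n) • secRes M (V := V ⊓ overlap)
        (le_inf inf_le_left (inf_le_right.trans (overlap_le 0))) (s 0)) :
    ∃ z : Γ(twist M n, V), ∀ i, (twistTriv M n i).toFun (V ⊓ chart i) inf_le_right
      (secRes _ inf_le_left z) = s i := by
  obtain ⟨z, h0, h1⟩ := exists_pullback_section (resMul M (overlap_le 0) (coordRatio ^ n).val)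
    (resMul M (overlap_le 1) 1) (x := toPush M (chart 0) V le_rfl (s 0))
    (y := toPush M (chart 1) V le_rfl (s 1)) (by
      apply pushRes_ext
      rw [fromPush_resMul, fromPush_resMul, fromPush_toPush, fromPush_toPush, map_one, one_smul]
      exact hs.symm)
  refine ⟨z, fun i ↦ ?_⟩
  match i with
  | 0 => exact (ofHom_toFun_secRes _ _ _ _).trans ((congrArg _ h0).trans
      ((fromPush_toPush _ _ _ _).trans (secRes_self _ _)))
  | 1 => exact (ofHom_toFun_secRes _ _ _ _).trans ((congrArg _ h1).trans
      ((fromPush_toPush _ _ _ _).trans (secRes_self _ _)))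

/-- The trivialisations of `M(n)` are isomorphisms: over a chart, the component of a section with
respect to the other chart is determined by the transition function. -/
lemma twistTriv_bijective (i : Fin 2) (h : V ≤ chart i) :
    Function.Bijective ((twistTriv M n i).toFun V h) := by
  have hc (x y : Γ(twist M n, V)) : (twistTriv M n i).toFun V h x = (twistTriv M n i).toFun V h y →
    x = y := by
    intro hxy
    apply twist_ext
    intro j
    have h2 := congrArg (secRes M (inf_le_left : V ⊓ chart j ≤ V)) hxy
    rw [← LocalHom.map_res, ← LocalHom.map_res] at h2
    fin_cases i <;> fin_cases j
    · exact h2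
    · have h3 : V ⊓ chart 1 ≤ overlap := (inf_le_inf_right _ h).trans chart_inf.le
      refine (twistTriv_compat M n h3 _).trans (.trans ?_ (twistTriv_compat M n h3 _).symm)
      exact congrArg _ h2
    · have h3 : V ⊓ chart 0 ≤ overlap :=
        (inf_comm _ _).le.trans ((inf_le_inf_left _ h).trans chart_inf.le)
      have h4 := (twistTriv_compat M n h3 _).symm.trans
        (Eq.trans h2 (twistTriv_compat M n h3 _))
      have h5 := congrArg (funRes h3 (coordPow (-n)) • ·) h4
      simp only [smul_smul, ← map_mul, mul_comm (coordPow (-n)), coordPow_mul_neg, map_one,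
        one_smul] at h5
      exact h5
    · exact h2
  refine ⟨hc, fun y ↦ ?_⟩
  fin_cases i
  · have h3 : V ⊓ chart 1 ≤ overlap := (inf_le_inf_right _ h).trans chart_inf.le
    obtain ⟨z, hz⟩ := exists_twist_section M n (V := V) (fun
      | 0 => secRes M inf_le_left y
      | 1 => funRes h3 (coordPow n) • secRes M inf_le_left y) (by simp)
    refine ⟨z, ?_⟩
    have h6 := congrArg (secRes M (le_inf le_rfl h : V ≤ V ⊓ chart 0)) (hz 0)
    rw [← LocalHom.map_res] at h6
    simpa using h6
  · have h3 : V ⊓ chart 0 ≤ overlap :=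
        (inf_comm _ _).le.trans ((inf_le_inf_left _ h).trans chart_inf.le)
    obtain ⟨z, hz⟩ := exists_twist_section M n (V := V) (fun
      | 0 => funRes h3 (coordPow (-n)) • secRes M inf_le_left y
      | 1 => secRes M inf_le_left y) (by
        simp [smul_smul, ← map_mul, coordPow_mul_neg])
    refine ⟨z, ?_⟩
    have h6 := congrArg (secRes M (le_inf le_rfl h : V ≤ V ⊓ chart 1)) (hz 1)
    rw [← LocalHom.map_res] at h6
    simpa using h6

end Twist

section O
variable (n : ℤ) {V : P1.Opens}

/-- The functions `1` form a frame of the structure sheaf. -/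
lemma isFrame_one (X : Scheme.{0}) (U : X.Opens) :
    IsFrame (structureSheaf X) U (fun _ : Fin 1 ↦ (unitEquiv U).symm 1) := by
  intro V h
  have (a : Fin 1 → Γ(X, V)) : ∑ j, a j • secRes (structureSheaf X) h ((unitEquiv U).symm 1) =
      (unitEquiv V).symm (a 0) := by
    rw [Fin.sum_univ_one, ← unitEquiv_symm_funRes, map_one, ← map_smul, smul_eq_mul, mul_one]
  simp only [this]
  exact (unitEquiv V).symm.bijective.comp (Equiv.funUnique (Fin 1) _).bijective

lemma exists_twist_frame : ∃ e : ∀ i, Γ(twist (structureSheaf P1) n, chart i),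
    (∀ i, IsFrame (twist (structureSheaf P1) n) (chart i) (fun _ : Fin 1 ↦ e i)) ∧
    secRes (twist (structureSheaf P1) n) (overlap_le 0) (e 0) =
      coordPow n • secRes (twist (structureSheaf P1) n) (overlap_le 1) (e 1) := by
  choose e he using fun i ↦ (twistTriv_bijective (structureSheaf P1) n i le_rfl).2
    ((unitEquiv _).symm 1)
  refine ⟨e, fun i V h ↦ ?_, ?_⟩
  · have hb := twistTriv_bijective (structureSheaf P1) n i h
    have hf := isFrame_one P1 (chart i) V h
    rw [← hb.of_comp_iff']
    convert hf using 2 with a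
    rw [Function.comp, LocalHom.map_sum_smul, he]
  · apply (twistTriv_bijective (structureSheaf P1) n 1 (overlap_le 1)).1
    rw [LocalHom.map_smul, twistTriv_compat _ _ le_rfl, funRes_self]
    rw [LocalHom.map_res _ _ le_rfl, LocalHom.map_res _ _ le_rfl, he, he]
    rfl

/-- Generators of `𝒪(n)` over the charts, with transition function `(x₀ / x₁) ^ n`. -/
lemma exists_O_frame : ∃ e : ∀ i, Γ(O n, chart i),
    (∀ i, IsFrame (O n) (chart i) (fun _ : Fin 1 ↦ e i)) ∧
    secRes (O n) (overlap_le 0) (e 0) = coordPow n • secRes (O n) (overlap_le 1) (e 1) :=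
  exists_twist_frame n

end O

/-! ### Extensions in coordinates -/

section Extension
variable {E : P1.Modules} {a b : ℤ} {Z : Scheme.{0}} {i : Z ⟶ P1}

/-- An extension `0 ⟶ 𝒪(a) ⟶ E ⟶ ℐ_Z(b) ⟶ 0` in coordinates: the images `α j` in `E` of the
generators of `𝒪(a)` over the charts, and the functionals `β j` on `E` that the trivialisations of
`ℐ_Z(b)` over the charts induce. The fields state the transition functions, that `α j` is a basis of
the kernel of `β j`, and that the image of `β j`, as a sheaf, consists of the functions that vanish
on `Z`. -/
structure ExtData (E : P1.Modules) (a b : ℤ) {Z : Scheme.{0}} (i : Z ⟶ P1) where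
  α : ∀ j, Γ(E, chart j)
  β : ∀ j, LocalHom (chart j) E (structureSheaf P1)
  α_trans : secRes E (overlap_le 0) (α 0) = coordPow a • secRes E (overlap_le 1) (α 1)
  β_trans : ∀ (V : P1.Opens) (h : V ≤ overlap) (x : Γ(E, V)),
    (β 1).val (h.trans (overlap_le 1)) x =
      funRes h (coordPow b) * (β 0).val (h.trans (overlap_le 0)) x
  β_α : ∀ j, (β j).val le_rfl (α j) = 0
  smul_α_inj : ∀ (j) (V : P1.Opens) (h : V ≤ chart j) (r : Γ(P1, V)),
    r • secRes E h (α j) = 0 → r = 0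
  exists_smul_α : ∀ (j) (V : P1.Opens) (h : V ≤ chart j) (x : Γ(E, V)), (β j).val h x = 0 →
    ∃ r : Γ(P1, V), x = r • secRes E h (α j)
  funPb_β : ∀ (j) (V : P1.Opens) (h : V ≤ chart j) (x : Γ(E, V)), funPb i V ((β j).val h x) = 0
  exists_local_β : ∀ (j) (V : P1.Opens) (h : V ≤ chart j) (r : Γ(P1, V)), funPb i V r = 0 →
    ∀ x ∈ V, ∃ (W : P1.Opens) (hW : W ≤ V), x ∈ W ∧ ∃ y : Γ(E, W),
      (β j).val (hW.trans h) y = funRes hW r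

lemma nonempty_extData (h : IsAssociatedTriple E a b i) : Nonempty (ExtData E a b i) := by
  obtain ⟨-, -, -, α, β, w, h⟩ := h
  obtain ⟨e, he, he'⟩ := exists_O_frame a
  have := h.mono_f
  have : Mono α := this
  have := h.epi_g
  have : Epi β := this
  refine ⟨
    { α := fun j ↦ α.app _ (e j)
      β := fun j ↦ ((LocalHom.ofGlobal β (chart j)).comp (twistTriv _ b j)).comp (idealHom i _)
      α_trans := ?_
      β_trans := ?_
      β_α := ?_
      smul_α_inj := ?_
      exists_smul_α := ?_
      funPb_β := ?_
      exists_local_β := ?_ }⟩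
  · rw [← app_secRes, ← app_secRes, he', Scheme.Modules.Hom.app_smul]
  · intro V hV x
    have h1 := twistTriv_compat (idealSheaf i) b hV (β.app V x)
    have h2 := congrArg ((idealHom i V).val le_rfl) h1
    rw [LocalHom.val_smul] at h2
    exact h2
  · intro j
    have h1 : β.app _ (α.app _ (e j)) = 0 := congr(($w).app _ (e j))
    have h2 := congrArg (((twistTriv _ b j).comp (idealHom i _)).valLin le_rfl) h1
    rw [map_zero] at h2
    exact h2
  · intro j V hV r hr
    rw [← app_secRes, ← Scheme.Modules.Hom.app_smul, ← map_zero (α.app V).hom] at hr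
    have h1 := app_injective_of_mono α V hr
    exact (he j).ext hV (a := fun _ ↦ r) (b := fun _ ↦ 0) (by simpa using h1) 0
  · intro j V hV x hx
    have h1 : (twistTriv _ b j).toFun V hV (β.app V x) = 0 := by
      apply idealHom_val_injective i hV
      rw [← LocalHom.valLin_apply, ← LocalHom.valLin_apply, map_zero]
      exact hx
    have h2 : β.app V x = 0 := by
      apply (twistTriv_bijective _ b j hV).1
      rw [h1, ← LocalHom.linMap_apply, map_zero]
    obtain ⟨y, rfl⟩ := mem_range_of_exact w h.exact h2
    obtain ⟨r, rfl⟩ := (he j V hV).2 y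
    exact ⟨r 0, by simp [Scheme.Modules.Hom.app_smul]⟩
  · intro j V hV x
    exact funPb_idealHom_val i hV _
  · intro j V hV r hr x hx
    obtain ⟨s, hs⟩ := exists_idealHom_val_eq i hV hr
    obtain ⟨z, rfl⟩ := (twistTriv_bijective _ b j hV).2 s
    obtain ⟨W, hW, hxW, y, hy⟩ := exists_local_lift β z x hx
    refine ⟨W, hW, hxW, y, ?_⟩
    rw [← hs, ← LocalHom.val_secRes, ← LocalHom.map_res, ← hy]
    rfl

end Extension

/-! ### Laurent polynomials -/

section Laurent
open LaurentPolynomial Polynomial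
variable {k : Type*} [CommRing k]

/-- Units of Laurent polynomial rings over domains are monomials. -/
lemma exists_eq_C_mul_T_of_isUnit [IsDomain k] {u : k[T;T⁻¹]} (hu : IsUnit u) :
    ∃ (c : k) (m : ℤ), IsUnit c ∧ u = LaurentPolynomial.C c * T m := by
  obtain ⟨v, hv⟩ := hu.exists_right_inv
  obtain ⟨n, p, hp⟩ := exists_T_pow u
  obtain ⟨m, q, hq⟩ := exists_T_pow v
  have h : p * q = X ^ (n + m) := by
    apply toLaurent_injective
    rw [map_mul, hp, hq, toLaurent_X_pow, Nat.cast_add, T_add]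
    linear_combination (T n * T m : k[T;T⁻¹]) * hv
  obtain ⟨i, -, hi⟩ := (dvd_prime_pow prime_X _).mp (Dvd.intro _ h)
  obtain ⟨w, hw⟩ := hi.symm
  obtain ⟨c, hc, hcw⟩ := Polynomial.isUnit_iff.mp w.isUnit
  refine ⟨c, i - n, hc, ?_⟩
  have h2 : u = toLaurent p * T (-n) := by rw [hp, mul_T_assoc]; simp
  rw [h2, ← hw, ← hcw, map_mul, toLaurent_C, toLaurent_X_pow, T_sub]
  ring

/-- The cohomological fact `H¹(ℙ¹, 𝒪(m)) = 0` for `m ≥ -1`, as a statement on Čech cocycles. -/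
lemma exists_eq_toLaurent_add (r : k[T;T⁻¹]) {m : ℤ} (hm : -1 ≤ m) :
    ∃ p q : k[X], r = toLaurent p + T m * invert (toLaurent q) := by
  induction r using LaurentPolynomial.induction_on' with
  | add f g hf hg =>
    obtain ⟨p, q, rfl⟩ := hf
    obtain ⟨p', q', rfl⟩ := hg
    exact ⟨p + p', q + q', by simp only [map_add]; ring⟩
  | C_mul_T n c =>
    rcases le_or_gt 0 n with h | h
    · lift n to ℕ using h
      exact ⟨Polynomial.C c * X ^ n, 0, by simp⟩
    · refine ⟨0, Polynomial.C c * X ^ (m - n).toNat, ?_⟩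
      rw [toLaurent_C_mul_X_pow, map_mul, invert_C, invert_T, Int.toNat_of_nonneg (by omega),
        map_zero, zero_add, neg_sub, T_sub]
      have : (T m * T (-m) : k[T;T⁻¹]) = 1 := by rw [← T_add]; simp
      linear_combination (- (LaurentPolynomial.C c * T n : k[T;T⁻¹])) * this

/-- A polynomial in `T⁻¹` which is a polynomial in `T` times `u T ^ m`, `m ≥ 0`, is constant, and
then `m = 0` unless it vanishes: the line bundle `𝒪(-m)` has no sections for `m > 0`, and only the
constants for `m = 0`. -/
lemma exists_eq_C_of_invert_toLaurent_eq [IsDomain k] {p q : k[X]} {u : k} {m : ℤ} (hu : u ≠ 0)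
    (hp : p ≠ 0) (hm : 0 ≤ m)
    (h : invert (toLaurent q) = LaurentPolynomial.C u * T m * toLaurent p) :
    m = 0 ∧ ∃ c, p = Polynomial.C c ∧ q = Polynomial.C (u * c) := by
  lift m to ℕ using hm
  have h1 : q.reverse = Polynomial.C u * X ^ (m + q.natDegree) * p := by
    apply toLaurent_injective
    rw [toLaurent_reverse, h, map_mul, toLaurent_C_mul_X_pow, Nat.cast_add, T_add]
    ring
  have h2 := congrArg natDegree h1
  rw [natDegree_mul (by simp [hu]) hp, natDegree_C_mul_X_pow _ _ hu] at h2
  have := q.reverse_natDegree_le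
  obtain rfl : m = 0 := by omega
  have h3 := eq_C_of_natDegree_eq_zero (p := p) (by omega)
  refine ⟨rfl, p.coeff 0, h3, toLaurent_injective (invert.injective ?_)⟩
  rw [h, toLaurent_C, invert_C, h3]
  simp

end Laurent

/-! ### Schemes glued from two affine lines -/

section Atlas
open LaurentPolynomial Polynomial

/-- A presentation of `X` as a projective line over `k`: an affine open cover by two affine lines
over `k`, glued along the complements of the origins by inverting the coordinate. The ring of
functions on the chart `U i` is identified with polynomials in the coordinate of that chart. -/
structure Atlas (k : Type) [CommRing k] (X : Scheme.{0}) where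
  U : Fin 2 → X.Opens
  isAffineOpen : ∀ i, IsAffineOpen (U i)
  iSup_eq_top : ⨆ i, U i = ⊤
  poly : ∀ i, k[X] ≃+* Γ(X, U i)
  basicOpen : ∀ i, X.basicOpen (poly i Polynomial.X) = U 0 ⊓ U 1
  poly_C : ∀ c, funRes (inf_le_left : U 0 ⊓ U 1 ≤ U 0) (poly 0 (Polynomial.C c)) =
    funRes inf_le_right (poly 1 (Polynomial.C c))
  mul_eq_one : funRes (inf_le_left : U 0 ⊓ U 1 ≤ U 0) (poly 0 Polynomial.X) *
    funRes inf_le_right (poly 1 Polynomial.X) = 1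

namespace Atlas
variable {k : Type} [CommRing k] {X : Scheme.{0}} (A : Atlas k X)

lemma isLocalization_away {U V : X.Opens} (hU : IsAffineOpen U) (t : Γ(X, U)) (hV : V ≤ U)
    (h : X.basicOpen t = V) :
    letI := (funRes hV).toAlgebra; IsLocalization.Away t Γ(X, V) := by
  subst h
  exact hU.isLocalization_basicOpen t

/-- Functions on the intersection of the two charts are Laurent polynomials in the coordinate of
the second chart. -/
lemma exists_laurent : ∃ e : k[T;T⁻¹] ≃+* Γ(X, A.U 0 ⊓ A.U 1),
    ∀ p, e (toLaurent p) = funRes inf_le_right (A.poly 1 p) := by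
  let := (funRes (inf_le_right : A.U 0 ⊓ A.U 1 ≤ A.U 1)).toAlgebra
  have := isLocalization_away (A.isAffineOpen 1) _ inf_le_right (A.basicOpen 1)
  refine ⟨IsLocalization.ringEquivOfRingEquiv (M := Submonoid.powers (Polynomial.X : k[X]))
    (T := Submonoid.powers (A.poly 1 Polynomial.X)) k[T;T⁻¹] Γ(X, A.U 0 ⊓ A.U 1) (A.poly 1)
    (by simp [Submonoid.map_powers]), fun p ↦ ?_⟩
  exact IsLocalization.ringEquivOfRingEquiv_eq (M := Submonoid.powers (Polynomial.X : k[X]))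
    (T := Submonoid.powers (A.poly 1 Polynomial.X)) (S := k[T;T⁻¹]) (j := A.poly 1) _ p

/-- The identification of functions on the intersection of the two charts with Laurent
polynomials. -/
def laurent : k[T;T⁻¹] ≃+* Γ(X, A.U 0 ⊓ A.U 1) := A.exists_laurent.choose

lemma laurent_toLaurent (p : k[X]) :
    A.laurent (toLaurent p) = funRes inf_le_right (A.poly 1 p) := A.exists_laurent.choose_spec p

/-- In terms of Laurent polynomials, functions on the first chart are polynomials in `T⁻¹`. -/
lemma laurent_invert (p : k[X]) :
    A.laurent (invert (toLaurent p)) = funRes inf_le_left (A.poly 0 p) := by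
  have : (A.laurent.toRingHom.comp ((invert (R := k)).toRingEquiv.toRingHom.comp toLaurent)) =
      (funRes inf_le_left).comp (A.poly 0).toRingHom := by
    apply Polynomial.ringHom_ext
    · intro c
      have := A.laurent_toLaurent (Polynomial.C c)
      rw [← A.poly_C] at this
      simpa using this
    · have h1 := A.laurent_toLaurent Polynomial.X
      have h2 : A.laurent (T (-1)) * A.laurent (T 1) = 1 := by
        rw [← map_mul, ← T_add]; simp
      have h3 := A.mul_eq_one
      rw [← h1, toLaurent_X] at h3
      have h4 : A.laurent (T (-1)) = funRes inf_le_left (A.poly 0 Polynomial.X) := by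
        linear_combination funRes inf_le_left (A.poly 0 Polynomial.X) * h2 -
          A.laurent (T (-1)) * h3
      simpa using h4
  exact congr($this p)

end Atlas
end Atlas

/-! ### The standard atlas of the projective line -/

section Proj
open HomogeneousLocalization MvPolynomial

/-- The other index of a chart. -/
abbrev other (i : Fin 2) : Fin 2 := 1 - i

/-- The coordinate `x_{1-i} / x_i` of the chart `D₊(x_i)`. -/
def awayCoord (i : Fin 2) : Away projGrading (X i : MvPolynomial (Fin 2) ℤ) :=
  Away.mk projGrading (X_mem i) 1 (X (other i)) (by simpa using X_mem (other i))

/-- The ring homomorphism from the polynomial ring that sends the variable to `x_{1-i} / x_i`. -/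
def polyToAway (i : Fin 2) : Polynomial ℤ →+* Away projGrading (X i : MvPolynomial (Fin 2) ℤ) :=
  Polynomial.eval₂RingHom (Int.castRingHom _) (awayCoord i)

/-- Dehomogenisation: the value of a fraction at `x_i = 1`, with `x_{1-i}` as the variable. -/
def awayToPoly (i : Fin 2) : Away projGrading (X i : MvPolynomial (Fin 2) ℤ) →+* Polynomial ℤ :=
  (IsLocalization.Away.lift (S := Localization.Away (X i : MvPolynomial (Fin 2) ℤ)) (X i)
    (g := (aeval (R := ℤ) (fun j ↦ if j = i then (1 : Polynomial ℤ) else Polynomial.X)).toRingHom)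
    (by simp)).comp (algebraMap (Away projGrading (X i : MvPolynomial (Fin 2) ℤ))
      (Localization.Away (X i : MvPolynomial (Fin 2) ℤ)))

/-- A form of degree `n`, evaluated at a multiple of a vector. -/
lemma aeval_mul_of_isHomogeneous {B : Type*} [CommRing B] [Algebra ℤ B] (c : B) (v : Fin 2 → B)
    {a : MvPolynomial (Fin 2) ℤ} {n : ℕ} (ha : a.IsHomogeneous n) :
    aeval (fun j ↦ c * v j) a = c ^ n * aeval v a := by
  simp only [aeval_def, eval₂_eq', Finset.mul_sum]
  refine Finset.sum_congr rfl fun d hd ↦ ?_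
  have h : d 0 + d 1 = n := by
    have := ha (mem_support_iff.mp hd)
    rw [← this, Finsupp.weight_apply, Finsupp.sum_fintype _ _ (by simp)]
    simp
  simp only [Fin.prod_univ_two, mul_pow, ← h, pow_add]
  ring

lemma val_mk_mul (i : Fin 2) (n : ℕ) (a : MvPolynomial (Fin 2) ℤ) (ha) :
    (Away.mk projGrading (X_mem i) n a ha).val *
      algebraMap (MvPolynomial (Fin 2) ℤ) (Localization.Away (X i : MvPolynomial (Fin 2) ℤ))
        (X i) ^ n =
      algebraMap (MvPolynomial (Fin 2) ℤ) _ a := by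
  rw [Away.val_mk, Localization.mk_eq_mk', ← map_pow]
  exact IsLocalization.mk'_spec _ a (⟨X i ^ n, n, rfl⟩ : Submonoid.powers (X i))

lemma awayToPoly_mk (i : Fin 2) (n : ℕ) (a : MvPolynomial (Fin 2) ℤ) (ha) :
    awayToPoly i (Away.mk projGrading (X_mem i) n a ha) =
      aeval (R := ℤ) (fun j ↦ if j = i then (1 : Polynomial ℤ) else Polynomial.X) a := by
  have h := congrArg (IsLocalization.Away.lift
    (S := Localization.Away (X i : MvPolynomial (Fin 2) ℤ)) (X i)
    (g := (aeval (R := ℤ) (fun j ↦ if j = i then (1 : Polynomial ℤ) else Polynomial.X)).toRingHom)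
    (by simp)) (val_mk_mul i n a ha)
  rw [map_mul, map_pow, IsLocalization.Away.lift_eq, IsLocalization.Away.lift_eq] at h
  refine (mul_one _).symm.trans (.trans ?_ h)
  congr 1
  simp

lemma awayToPoly_polyToAway (i : Fin 2) (p : Polynomial ℤ) : awayToPoly i (polyToAway i p) = p := by
  have : (awayToPoly i).comp (polyToAway i) = RingHom.id _ := by
    apply Polynomial.ringHom_ext
    · intro c; simp
    · simp only [polyToAway, RingHom.comp_apply, Polynomial.coe_eval₂RingHom, Polynomial.eval₂_X,
        RingHom.id_apply]
      rw [awayCoord, awayToPoly_mk, aeval_X, if_neg (by fin_cases i <;> simp)]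
  exact congr($this p)

lemma polyToAway_surjective (i : Fin 2) : Function.Surjective (polyToAway i) := by
  intro z
  obtain ⟨n, a, ha, rfl⟩ := Away.mk_surjective projGrading (X_mem i) z
  refine ⟨aeval (R := ℤ) (fun j ↦ if j = i then (1 : Polynomial ℤ) else Polynomial.X) a, ?_⟩
  let L := Localization.Away (X i : MvPolynomial (Fin 2) ℤ)
  let v : Fin 2 → L := fun j ↦ algebraMap (Away projGrading (X i : MvPolynomial (Fin 2) ℤ)) L
    (polyToAway i (if j = i then 1 else Polynomial.X))
  have hv (b : MvPolynomial (Fin 2) ℤ) : algebraMap (Away projGrading (X i)) L (polyToAway i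
      (aeval (R := ℤ) (fun j ↦ if j = i then (1 : Polynomial ℤ) else Polynomial.X) b)) =
        aeval v b := by
    have : (((algebraMap (Away projGrading (X i : MvPolynomial (Fin 2) ℤ)) L).comp
      (polyToAway i)).comp (aeval (R := ℤ)
        (fun j ↦ if j = i then (1 : Polynomial ℤ) else Polynomial.X)).toRingHom) =
        (aeval v).toRingHom := by
      apply MvPolynomial.ringHom_ext
      · intro c; simp
      · intro j; simp [v]
    exact congr($this b)
  have hx (j : Fin 2) : algebraMap (MvPolynomial (Fin 2) ℤ) L (X j) =
      algebraMap (MvPolynomial (Fin 2) ℤ) L (X i) * v j := by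
    by_cases hj : j = i
    · subst hj; simp [v]
    · have hj' : j = other i := by fin_cases i <;> fin_cases j <;> simp_all
      have h1 := val_mk_mul i 1 (X (other i)) (by simpa using X_mem (other i))
      have h2 : v j = (awayCoord i).val := by
        simp only [v, if_neg hj, polyToAway, Polynomial.coe_eval₂RingHom, Polynomial.eval₂_X]
        rfl
      rw [h2, awayCoord, mul_comm, hj']
      simpa using h1.symm
  have h3 : algebraMap (MvPolynomial (Fin 2) ℤ) L a =
      algebraMap (MvPolynomial (Fin 2) ℤ) L (X i) ^ n * aeval v a := by
    have ha' : a.IsHomogeneous n := by simpa using ha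
    rw [← aeval_mul_of_isHomogeneous _ _ ha']
    simp only [← hx]
    have : (algebraMap (MvPolynomial (Fin 2) ℤ) L) =
        (aeval (R := ℤ) fun j ↦ algebraMap (MvPolynomial (Fin 2) ℤ) L (X j)).toRingHom := by
      apply MvPolynomial.ringHom_ext
      · intro c; simp
      · intro j; simp
    exact congr($this a)
  have hu : IsUnit (algebraMap (MvPolynomial (Fin 2) ℤ) L (X i) ^ n) :=
    (IsLocalization.Away.algebraMap_isUnit (S := L) (X i)).pow n
  rw [HomogeneousLocalization.ext_iff_val, ← hu.mul_left_inj]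
  refine Eq.trans ?_ (val_mk_mul i n a ha).symm
  rw [h3, mul_comm, ← hv]
  rfl

/-- The degree zero part of `ℤ[x₀, x₁]` localized at `x_i` is a polynomial ring in
`x_{1-i} / x_i`. -/
def polyEquivAway (i : Fin 2) :
    Polynomial ℤ ≃+* Away projGrading (X i : MvPolynomial (Fin 2) ℤ) :=
  RingEquiv.ofBijective (polyToAway i)
    ⟨Function.LeftInverse.injective (awayToPoly_polyToAway i), polyToAway_surjective i⟩

/-- The ring of functions on a standard chart is a polynomial ring in the coordinate. -/
def chartPoly (i : Fin 2) : Polynomial ℤ ≃+* Γ(P1, chart i) :=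
  (polyEquivAway i).trans
    (Proj.basicOpenIsoAway projGrading _ (X_mem i) one_pos).commRingCatIsoToRingEquiv

lemma chartPoly_X (i : Fin 2) :
    chartPoly i Polynomial.X = (Proj.awayToSection projGrading (X i)).hom (awayCoord i) := by
  change (Proj.awayToSection projGrading (X i)).hom (polyToAway i Polynomial.X) = _
  rw [polyToAway, Polynomial.coe_eval₂RingHom, Polynomial.eval₂_X]

lemma funRes_awayToSection (i : Fin 2)
    (hx : (X 0 * X 1 : MvPolynomial (Fin 2) ℤ) = X i * X (other i))
    (z : Away projGrading (X i : MvPolynomial (Fin 2) ℤ)) :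
    funRes (overlap_le i) ((Proj.awayToSection projGrading (X i)).hom z) =
      (Proj.awayToSection projGrading (X 0 * X 1)).hom
        (awayMap projGrading (X_mem (other i)) hx z) :=
  congr(($(Proj.awayMap_awayToSection projGrading (X_mem (other i)) hx)) z).symm

lemma awayMap_awayCoord (i : Fin 2)
    (hx : (X 0 * X 1 : MvPolynomial (Fin 2) ℤ) = X i * X (other i)) :
    awayMap projGrading (X_mem (other i)) hx (awayCoord i) = sqRatio (other i) := by
  rw [awayCoord, awayMap_mk, HomogeneousLocalization.ext_iff_val, sqRatio, Away.val_mk, Away.val_mk]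
  simp

lemma funRes_chartPoly_one : funRes (overlap_le 1) (chartPoly 1 Polynomial.X) = coordRatio.val := by
  rw [chartPoly_X, funRes_awayToSection 1 (mul_comm _ _), awayMap_awayCoord]
  rfl

lemma funRes_chartPoly_zero :
    funRes (overlap_le 0) (chartPoly 0 Polynomial.X) = coordRatio.inv := by
  rw [chartPoly_X, funRes_awayToSection 0 rfl, awayMap_awayCoord]
  rfl

lemma basicOpen_chartPoly (i : Fin 2) :
    P1.basicOpen (chartPoly i Polynomial.X) = chart i ⊓ chart (other i) := by
  have h1 := Proj.awayι_preimage_basicOpen projGrading (X_mem i) one_pos (X_mem (other i)) one_pos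
  have h2 := congrArg (fun W ↦ (Proj.basicOpenIsoSpec projGrading _ (X_mem i) one_pos).hom ⁻¹ᵁ W) h1
  have h3 : Away.isLocalizationElem (X_mem i) (X_mem (other i)) = awayCoord i := by
    rw [HomogeneousLocalization.ext_iff_val, awayCoord, Away.val_mk, Away.val_mk]
    simp
  have h4 : (chart i).ι ⁻¹ᵁ chart (other i) =
      (chart i).ι ⁻¹ᵁ P1.basicOpen (chartPoly i Polynomial.X) := by
    rw [chartPoly_X]
    refine Eq.trans ?_ (h2.trans ?_)
    · rw [← Scheme.Hom.comp_preimage, Proj.awayι, Iso.hom_inv_id_assoc]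
    · rw [h3, Proj.basicOpenIsoSpec_hom, Proj.basicOpenToSpec]
      exact (chart i).toSpecΓ_preimage_basicOpen _
  have h5 := congrArg ((chart i).ι ''ᵁ ·) h4
  simp only [Scheme.Hom.image_preimage_eq_opensRange_inf, Scheme.Opens.opensRange_ι] at h5
  rw [h5]
  exact (inf_eq_right.mpr (P1.basicOpen_le _)).symm

lemma iSup_chart : ⨆ i, chart i = ⊤ := by
  refine Proj.iSup_basicOpen_eq_top' _ _ (fun i ↦ ⟨1, X_mem i⟩) ?_
  rw [eq_top_iff]
  intro p _
  induction p using MvPolynomial.induction_on with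
  | C c =>
    have : (C c : MvPolynomial (Fin 2) ℤ) = ((c : ℤ) : MvPolynomial (Fin 2) ℤ) := by simp
    rw [this]
    exact intCast_mem _ _
  | add p q hp hq => exact add_mem (hp trivial) (hq trivial)
  | mul_X p i hp => exact mul_mem (hp trivial) (Algebra.subset_adjoin ⟨i, rfl⟩)

/-- The standard atlas of the projective line over `ℤ`. -/
abbrev atlasP1 : Atlas ℤ P1 where
  U := chart
  isAffineOpen i := Proj.isAffineOpen_basicOpen projGrading _ (X_mem i) one_pos
  iSup_eq_top := iSup_chart
  poly := chartPoly
  basicOpen i := by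
    rw [basicOpen_chartPoly]
    fin_cases i
    · rfl
    · exact inf_comm _ _
  poly_C c := by simp
  mul_eq_one := by
    have h : chart 0 ⊓ chart 1 ≤ overlap := chart_inf.le
    have := congrArg (funRes h) coordRatio.inv_val
    rw [map_mul, map_one] at this
    rw [← this]
    congr 1
    · exact (funRes_funRes (overlap_le 0) h _).symm.trans (congrArg _ funRes_chartPoly_zero)
    · exact (funRes_funRes (overlap_le 1) h _).symm.trans (congrArg _ funRes_chartPoly_one)

end Proj

/-! ### Base change of an atlas -/

section BaseChange
variable {X Y : Scheme.{0}} {K : CommRingCat.{0}} {g : Y ⟶ X} {iY : Y ⟶ Spec K} {iX : X ⟶ SpecZ}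
  {f : Spec K ⟶ SpecZ}

/-- Elements of the base ring as functions on an open set. -/
def const (iY : Y ⟶ Spec K) (V : Y.Opens) : K →+* Γ(Y, V) :=
  (iY.appLE ⊤ V le_top).hom.comp (Scheme.ΓSpecIso K).inv.hom

lemma funRes_const {V W : Y.Opens} (h : W ≤ V) (c : K) :
    funRes h (const iY V c) = const iY W c := by
  simp only [const, RingHom.comp_apply, funRes_eq]
  exact congr($(iY.appLE_map (U := ⊤) le_top (homOfLE h).op) ((Scheme.ΓSpecIso K).inv.hom c))

lemma ringHom_Γ_SpecZ_ext {R : CommRingCat.{0}} (φ ψ : Γ(SpecZ, ⊤) ⟶ R) : φ = ψ := by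
  rw [← cancel_epi (Scheme.ΓSpecIso (.of ℤ)).inv]
  ext n
  simp

lemma eval₂_map_eq_funPb {U : X.Opens} (e : Polynomial ℤ ≃+* Γ(X, U)) (c : K →+* Γ(Y, g ⁻¹ᵁ U))
    (p : Polynomial ℤ) :
    Polynomial.eval₂RingHom c (funPb g U (e Polynomial.X)) (p.map (Int.castRingHom K)) =
      funPb g U (e p) := by
  have : (Polynomial.eval₂RingHom c (funPb g U (e Polynomial.X))).comp
      (Polynomial.mapRingHom (Int.castRingHom K)) = (funPb g U).comp e.toRingHom := by
    apply Polynomial.ringHom_ext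
    · intro n; simp
    · simp
  exact congr($this p)

/-- The coordinate ring of a chart after base change: the pullback of an affine line over `ℤ` is the
affine line over `K`, functions on a fibre product of affine schemes being a pushout of rings. -/
lemma bijective_eval₂ (H : IsPullback g iY iX f) {U : X.Opens} (hU : IsAffineOpen U)
    (e : Polynomial ℤ ≃+* Γ(X, U)) :
    Function.Bijective
      (Polynomial.eval₂RingHom (const iY (g ⁻¹ᵁ U)) (funPb g U (e Polynomial.X))) := by
  have h1 := isIso_pushoutSection_of_isAffineOpen H (US := ⊤) (UT := ⊤) (UX := U) (UY := g ⁻¹ᵁ U)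
    le_top le_top (by simp) (isAffineOpen_top _) (isAffineOpen_top _) hU
  have h2 := (isIso_pushoutSection_iff H (US := ⊤) (UT := ⊤) (UX := U) (UY := g ⁻¹ᵁ U)
    le_top le_top (by simp)).mp h1
  let φ : Γ(Y, g ⁻¹ᵁ U) ⟶ .of (Polynomial K) := h2.desc
    (CommRingCat.ofHom ((Polynomial.mapRingHom (Int.castRingHom K)).comp e.symm.toRingHom))
    ((Scheme.ΓSpecIso K).hom ≫ CommRingCat.ofHom Polynomial.C) (ringHom_Γ_SpecZ_ext _ _)
  have hl : ∀ x, φ (funPb g U x) = (e.symm x).map (Int.castRingHom K) := fun x ↦ by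
    have := congr($(h2.inl_desc (CommRingCat.ofHom ((Polynomial.mapRingHom
      (Int.castRingHom K)).comp e.symm.toRingHom)) ((Scheme.ΓSpecIso K).hom ≫
        CommRingCat.ofHom Polynomial.C) (ringHom_Γ_SpecZ_ext _ _)) x)
    rw [funPb, Scheme.Hom.app_eq_appLE]
    exact this
  have hr : ∀ c, φ (const iY (g ⁻¹ᵁ U) c) = Polynomial.C c := fun c ↦ by
    have := congr($(h2.inr_desc (CommRingCat.ofHom ((Polynomial.mapRingHom
      (Int.castRingHom K)).comp e.symm.toRingHom)) ((Scheme.ΓSpecIso K).hom ≫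
        CommRingCat.ofHom Polynomial.C) (ringHom_Γ_SpecZ_ext _ _)) ((Scheme.ΓSpecIso K).inv c))
    refine this.trans ?_
    simp
  let ψ : CommRingCat.of (Polynomial K) ⟶ Γ(Y, g ⁻¹ᵁ U) := CommRingCat.ofHom
    (Polynomial.eval₂RingHom (const iY (g ⁻¹ᵁ U)) (funPb g U (e Polynomial.X)))
  have h3 : ψ ≫ φ = 𝟙 _ := by
    ext1
    apply Polynomial.ringHom_ext
    · intro c
      simp [ψ, hr]
    · simp [ψ, hl]
  have h4 : φ ≫ ψ = 𝟙 _ := by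
    apply h2.hom_ext
    · ext x
      obtain ⟨p, rfl⟩ := e.surjective x
      have h5 := hl (e p)
      rw [e.symm_apply_apply] at h5
      have h6 := (congrArg ψ h5).trans (eval₂_map_eq_funPb e _ p)
      rw [funPb, Scheme.Hom.app_eq_appLE] at h6
      exact h6
    · ext c
      obtain ⟨c, rfl⟩ := (ConcreteCategory.bijective_of_isIso (Scheme.ΓSpecIso K).inv).2 c
      have h5 := congrArg ψ (hr c)
      refine Eq.trans h5 ?_
      simp [ψ]
      rfl
  have : IsIso ψ := ⟨φ, h3, h4⟩
  exact ConcreteCategory.bijective_of_isIso ψ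

/-- The base change of an atlas over `ℤ`. -/
abbrev Atlas.baseChange (A : Atlas ℤ X) (H : IsPullback g iY iX f) : Atlas K Y where
  U i := g ⁻¹ᵁ A.U i
  isAffineOpen i :=
    have : IsAffineHom g := MorphismProperty.of_isPullback H.flip inferInstance
    (A.isAffineOpen i).preimage g
  iSup_eq_top := by
    rw [← Scheme.Hom.preimage_iSup, A.iSup_eq_top]
    rfl
  poly i := RingEquiv.ofBijective _ (bijective_eval₂ H (A.isAffineOpen i) (A.poly i))
  basicOpen i := by
    simp only [RingEquiv.ofBijective_apply, Polynomial.coe_eval₂RingHom, Polynomial.eval₂_X]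
    refine (Scheme.preimage_basicOpen g _).symm.trans ?_
    rw [A.basicOpen]
    rfl
  poly_C c := by
    simp only [RingEquiv.ofBijective_apply, Polynomial.coe_eval₂RingHom, Polynomial.eval₂_C]
    rw [funRes_const, funRes_const]
  mul_eq_one := by
    simp only [RingEquiv.ofBijective_apply, Polynomial.coe_eval₂RingHom, Polynomial.eval₂_X]
    have := congrArg (funPb g _) A.mul_eq_one
    rw [map_mul, map_one, funPb_funRes, funPb_funRes] at this
    exact this

lemma Atlas.baseChange_poly_map (A : Atlas ℤ X) (H : IsPullback g iY iX f) (i : Fin 2)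
    (p : Polynomial ℤ) : (A.baseChange H).poly i (p.map (Int.castRingHom K)) =
      funPb g (A.U i) (A.poly i p) :=
  eval₂_map_eq_funPb (A.poly i) _ p

end BaseChange

/-! ### Local frames of locally free modules -/

section LocallyFree
variable {X : Scheme.{0}} {M N : X.Modules} {U V W : X.Opens} {ι : Type} [Fintype ι]

lemma IsFrame.of_iso {s : ι → Γ(N, U)} (hs : IsFrame N U s) (φ : N ≅ M) :
    IsFrame M U (fun j ↦ φ.hom.app U (s j)) := by
  intro V h
  have h1 : Function.Bijective (φ.hom.app V) := ConcreteCategory.bijective_of_isIso (φ.hom.app V)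
  convert h1.comp (hs V h) using 2 with a
  simp only [Function.comp, map_sum, Scheme.Modules.Hom.app_smul, app_secRes]

/-- Functions act on the sections of `M|_U` as on those of `M`: the isomorphism between the
structure sheaves that enters the definition of the restriction is the identity. -/
lemma smul_restrict (M : X.Modules) (U : X.Opens) (V : U.toScheme.Opens) (r : Γ(X, U.ι ''ᵁ V))
    (s : Γ(M, U.ι ''ᵁ V)) :
    HSMul.hSMul (α := Γ(U.toScheme, V)) (β := Γ(M.restrict U.ι, V)) (γ := Γ(M.restrict U.ι, V)) r s
      = r • s := by
  change (U.ι.appIso _).inv r • s = _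
  rw [Scheme.Opens.ι_appIso]
  rfl

/-- A frame of `M|_U` over the whole of `U` is a frame of `M` over `U`. -/
lemma IsFrame.of_restrict {s : ι → Γ(M.restrict U.ι, ⊤)} (hs : IsFrame (M.restrict U.ι) ⊤ s) :
    IsFrame M U (fun j ↦ secRes M (U := U.ι ''ᵁ ⊤) (by simp) (s j)) := by
  intro W hW
  obtain ⟨W', rfl⟩ : ∃ W', U.ι ''ᵁ W' = W :=
    ⟨U.ι ⁻¹ᵁ W, by simp [Scheme.Hom.image_preimage_eq_opensRange_inf, hW]⟩
  have h := hs W' le_top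
  have h2 : ∀ a : ι → Γ(X, U.ι ''ᵁ W'), ∑ j, a j •
      secRes M hW (secRes M (U := U.ι ''ᵁ ⊤) (by simp) (s j)) =
      ∑ j, HSMul.hSMul (α := Γ(U.toScheme, W')) (β := Γ(M.restrict U.ι, W'))
        (γ := Γ(M.restrict U.ι, W')) (a j)
        (secRes (M.restrict U.ι) (U := ⊤) (V := W') le_top (s j)) := by
    intro a
    refine Finset.sum_congr rfl fun j _ ↦ ?_
    refine Eq.trans ?_ (smul_restrict M U W' _ _).symm
    congr 1
    exact secRes_secRes _ _ _
  simp only [h2]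
  exact h

/-- The standard basis of `𝒪^r`. -/
lemma exists_frame_coprod (X : Scheme.{0}) (r : ℕ) (U : X.Opens) :
    ∃ s : Fin r → Γ(∐ fun _ : Fin r ↦ structureSheaf X, U),
      IsFrame (∐ fun _ : Fin r ↦ structureSheaf X) U s := by
  have : HasFiniteBiproducts X.Modules := Abelian.hasFiniteBiproducts
  let B : X.Modules := ⨁ fun _ : Fin r ↦ structureSheaf X
  let d : DualBasis B U (Fin r) :=
    { elt := fun j ↦ (biproduct.ι (fun _ : Fin r ↦ structureSheaf X) j).app U ((unitEquiv U).symm 1)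
      coord := fun j ↦ .ofGlobal (biproduct.π (fun _ : Fin r ↦ structureSheaf X) j) U
      sum_eq := fun V h x ↦ by
        have h1 := biproduct.total (f := fun _ : Fin r ↦ structureSheaf X)
        have h2 : ∑ j, (biproduct.ι (fun _ : Fin r ↦ structureSheaf X) j).app V
          ((biproduct.π (fun _ : Fin r ↦ structureSheaf X) j).app V x) = x := by
          let ev : (B ⟶ B) →+ Γ(B, V) := AddMonoidHom.mk' (fun φ ↦ φ.app V x) fun _ _ ↦ rfl
          have h3 := congrArg ev h1
          rw [map_sum] at h3
          exact h3
        refine Eq.trans (Finset.sum_congr rfl fun j _ ↦ ?_) h2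
        rw [← app_secRes, ← Scheme.Modules.Hom.app_smul]
        congr 1
        rw [← unitEquiv_symm_funRes, map_one, ← map_smul, smul_eq_mul, mul_one]
        rfl }
  have hd : IsFrame B U d.elt := by
    refine d.isFrame fun j k ↦ ?_
    have h1 := biproduct.ι_π (fun _ : Fin r ↦ structureSheaf X) k j
    have h2 := congr(unitEquiv U (($h1).app U ((unitEquiv U).symm 1)))
    refine h2.trans ?_
    split_ifs with h h' h'
    · subst h; simp
    · exact absurd h.symm h'
    · exact absurd h'.symm h
    · exact map_zero (unitEquiv U)
  exact ⟨_, hd.of_iso (biproduct.isoCoproduct _)⟩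

/-- `M` has frames of size `r` locally on `U`. -/
def HasFrames (r : ℕ) (M : X.Modules) (U : X.Opens) : Prop :=
  ∀ x ∈ U, ∃ W : X.Opens, x ∈ W ∧ ∃ s : Fin r → Γ(M, W), IsFrame M W s

lemma IsLocallyFreeOfRank.hasFrames {r : ℕ} (h : IsLocallyFreeOfRank r M) (U : X.Opens) :
    HasFrames r M U := by
  intro x _
  obtain ⟨W, hx, ⟨φ⟩⟩ := h x
  obtain ⟨s, hs⟩ := exists_frame_coprod W.toScheme r ⊤
  exact ⟨W, hx, _, (hs.of_iso φ.symm).of_restrict⟩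

end LocallyFree

/-! ### Integrality -/

section Integral
variable {k : Type} [CommRing k] [IsDomain k] {X : Scheme.{0}} {U V : X.Opens}

lemma isReduced_sections_of_le (hU : _root_.AlgebraicGeometry.IsReduced U.toScheme) (h : V ≤ U) :
    _root_.IsReduced Γ(X, V) := by
  obtain ⟨W', rfl⟩ : ∃ W', U.ι ''ᵁ W' = V :=
    ⟨U.ι ⁻¹ᵁ V, by simp [Scheme.Hom.image_preimage_eq_opensRange_inf, h]⟩
  exact hU.component_reduced W'

lemma Atlas.isDomain (A : Atlas k X) (i : Fin 2) : IsDomain Γ(X, A.U i) :=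
  (A.poly i).symm.isDomain_iff.mpr inferInstance

lemma Atlas.nonempty_inf (A : Atlas k X) : Nonempty ↥(A.U 0 ⊓ A.U 1) := by
  by_contra h
  have h0 : A.U 0 ⊓ A.U 1 = ⊥ := by
    rw [eq_bot_iff]
    intro x hx
    exact (h ⟨x, hx⟩).elim
  have : Subsingleton Γ(X, A.U 0 ⊓ A.U 1) := by
    rw [h0]; infer_instance
  have : Subsingleton (LaurentPolynomial k) := A.laurent.toEquiv.subsingleton
  exact false_of_nontrivial_of_subsingleton (LaurentPolynomial k)

lemma Atlas.isIntegral_chart (A : Atlas k X) (i : Fin 2) : IsIntegral (A.U i).toScheme := by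
  have : IsAffine (A.U i).toScheme := A.isAffineOpen i
  have := A.isDomain i
  have : IsDomain Γ((A.U i).toScheme, ⊤) :=
    ((A.U i).topIso.commRingCatIsoToRingEquiv).isDomain_iff.mpr inferInstance
  have : Nonempty (A.U i) := by
    obtain ⟨x, h0, h1⟩ := A.nonempty_inf
    fin_cases i
    exacts [⟨⟨x, h0⟩⟩, ⟨⟨x, h1⟩⟩]
  exact isIntegral_of_isAffine_of_isDomain _

/-- A scheme glued from two affine lines over a domain is integral, because the two lines are, and
they meet. -/
lemma Atlas.isIntegral (A : Atlas k X) : IsIntegral X := by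
  have hirr (i) : IsPreirreducible (A.U i : Set X) := by
    have := A.isIntegral_chart i
    have h1 : IrreducibleSpace (A.U i) := irreducibleSpace_of_isIntegral (A.U i).toScheme
    exact isPreirreducible_iff_preirreducibleSpace.mpr h1.toPreirreducibleSpace
  obtain ⟨x, hx0, hx1⟩ := A.nonempty_inf
  have hmeet (u : Set X) (hu : IsOpen u) (hne : u.Nonempty) : ((A.U 0 : Set X) ∩ u).Nonempty := by
    obtain ⟨y, hy⟩ := hne
    have hy' : y ∈ ⨆ i, A.U i := by rw [A.iSup_eq_top]; trivial
    obtain ⟨i, hi⟩ := TopologicalSpace.Opens.mem_iSup.mp hy'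
    fin_cases i
    · exact ⟨y, hi, hy⟩
    · obtain ⟨z, -, hz, hz'⟩ := hirr 1 u (A.U 0) hu (A.U 0).isOpen ⟨y, hi, hy⟩ ⟨x, hx1, hx0⟩
      exact ⟨z, hz', hz⟩
  have : IrreducibleSpace X :=
    { isPreirreducible_univ := by
        intro u v hu hv hu' hv'
        obtain ⟨z, -, hz⟩ := hirr 0 u v hu hv (hmeet u hu (by simpa using hu'))
          (hmeet v hv (by simpa using hv'))
        exact ⟨z, trivial, hz⟩
      toNonempty := ⟨x⟩ }
  have : AlgebraicGeometry.IsReduced X := by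
    refine ⟨fun V ↦ ⟨fun r ⟨n, hn⟩ ↦ ?_⟩⟩
    apply X.IsSheaf.section_ext
    intro y hy
    have hy' : y ∈ ⨆ i, A.U i := by rw [A.iSup_eq_top]; trivial
    obtain ⟨i, hi⟩ := TopologicalSpace.Opens.mem_iSup.mp hy'
    refine ⟨V ⊓ A.U i, inf_le_left, ⟨hy, hi⟩, ?_⟩
    have := A.isIntegral_chart i
    have := isReduced_sections_of_le (X := X) (U := A.U i) (V := V ⊓ A.U i)
      (isReduced_of_isIntegral _) inf_le_right
    have h1 : (funRes (inf_le_left : V ⊓ A.U i ≤ V) r) ^ n = 0 := by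
      rw [← map_pow, hn, map_zero]
    exact (eq_zero_of_pow_eq_zero h1).trans (map_zero (funRes (inf_le_left : V ⊓ A.U i ≤ V))).symm
  exact isIntegral_of_irreducibleSpace_of_isReduced X

end Integral

/-! ### Locally free modules on affine open sets of integral schemes -/

section TorsionFree
variable {X : Scheme.{0}} {M N : X.Modules} {U V W : X.Opens} {r r' : ℕ}

lemma HasFrames.mono (h : HasFrames r M U) (hV : V ≤ U) : HasFrames r M V :=
  fun x hx ↦ h x (hV hx)

lemma funRes_injective [IsIntegral X] (h : V ≤ U) [Nonempty V] :
    Function.Injective (funRes (X := X) h) :=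
  map_injective_of_isIntegral X (homOfLE h)

lemma nonempty_inf [IsIntegral X] (V W : X.Opens) [hV : Nonempty V] [hW : Nonempty W] :
    Nonempty (V ⊓ W : X.Opens) := by
  obtain ⟨⟨x, hx⟩⟩ := hV
  obtain ⟨⟨y, hy⟩⟩ := hW
  obtain ⟨z, -, hz⟩ := (irreducibleSpace_of_isIntegral X).isPreirreducible_univ V W V.isOpen
    W.isOpen ⟨x, trivial, hx⟩ ⟨y, trivial, hy⟩
  exact ⟨z, hz⟩

/-- Sections of a locally free module over an integral scheme are determined by their restriction
to a nonempty open set. -/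
lemma HasFrames.eq_zero_of_secRes [IsIntegral X] (hN : HasFrames r N V) (hW : W ≤ V)
    [Nonempty W] {x : Γ(N, V)} (hx : secRes N hW x = 0) : x = 0 := by
  choose W' hxW s hs using hN
  refine sec_ext_of_cover (fun y : V ↦ V ⊓ W' y y.2) (fun y ↦ inf_le_left)
    (fun y hy ↦ TopologicalSpace.Opens.mem_iSup.mpr ⟨⟨y, hy⟩, hy, hxW y hy⟩) fun y ↦ ?_
  obtain ⟨a, ha⟩ := (hs y y.2 (V ⊓ W' y y.2) inf_le_right).2 (secRes N inf_le_left x)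
  have : Nonempty (V ⊓ W' y y.2 : X.Opens) := ⟨y, y.2, hxW y y.2⟩
  have := nonempty_inf W (V ⊓ W' y y.2)
  have h1 : ∀ j, funRes (inf_le_right : W ⊓ (V ⊓ W' y y.2) ≤ _) (a j) = 0 := by
    refine fun j ↦ (hs y y.2).ext (V := W ⊓ (V ⊓ W' y y.2)) (inf_le_right.trans inf_le_right)
      (a := fun j ↦ funRes inf_le_right (a j)) (b := fun _ ↦ 0) ?_ j
    have h2 := congrArg (secRes N (inf_le_right : W ⊓ (V ⊓ W' y y.2) ≤ _)) ha
    have h3 := congrArg (secRes N (inf_le_left : W ⊓ (V ⊓ W' y y.2) ≤ W)) hx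
    simp only [map_sum, secRes_smul, secRes_secRes, map_zero] at h2 h3
    rw [h2, h3]
    simp
  have h4 : a = 0 := by
    ext j
    exact (funRes_injective inf_le_right) ((h1 j).trans (map_zero _).symm)
  rw [← ha, h4]
  simp

lemma sec_eq_of_isEmpty (hV : ∀ x, x ∉ V) (x y : Γ(N, V)) : x = y :=
  sec_ext_of_cover (fun _ : V ↦ V) (fun _ ↦ le_rfl)
    (fun y hy ↦ (hV y hy).elim) fun y ↦ (hV y y.2).elim

/-- A local homomorphism to a locally free module over an integral scheme is determined by its
restriction to a nonempty open set. -/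
lemma HasFrames.localHom_ext [IsIntegral X] (hN : HasFrames r N U) (hW : W ≤ U) [Nonempty W]
    {l l' : LocalHom U M N} (h : ∀ V (hV : V ≤ W) x, l.toFun V (hV.trans hW) x =
      l'.toFun V (hV.trans hW) x) (hV : V ≤ U) (x : Γ(M, V)) :
    l.toFun V hV x = l'.toFun V hV x := by
  rcases isEmpty_or_nonempty V with hV' | hV'
  · exact sec_eq_of_isEmpty (fun y hy ↦ hV'.false ⟨y, hy⟩) _ _
  · have := nonempty_inf V W
    rw [← sub_eq_zero]
    refine (hN.mono hV).eq_zero_of_secRes (inf_le_left : V ⊓ W ≤ V) ?_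
    rw [map_sub, ← l.map_res, ← l'.map_res, sub_eq_zero]
    exact h _ inf_le_right _

/-- Multiples of local homomorphisms. -/
def LocalHom.smul (l : LocalHom U M N) (t : Γ(X, U)) : LocalHom U M N where
  toFun V h x := funRes h t • l.toFun V h x
  map_add V h x y := by rw [l.map_add, smul_add]
  map_smul V h s x := by rw [l.map_smul, smul_comm]
  map_res V h W h' x := by rw [l.map_res, secRes_smul, funRes_funRes]

/-- A function on `D(t)` extends after multiplication with any sufficiently large power of `t`. -/
lemma exists_funRes_eq_pow_mul (hU : IsAffineOpen U) (t : Γ(X, U)) (hV : V ≤ U)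
    (h : X.basicOpen t = V) (c : Γ(X, V)) :
    ∀ᶠ n in Filter.atTop, ∃ d, funRes hV d = funRes hV t ^ n * c := by
  subst h
  obtain ⟨N, d, hd⟩ := exists_eq_pow_mul_of_isAffineOpen X U hU t c
  filter_upwards [Filter.eventually_ge_atTop N] with n hn
  refine ⟨t ^ (n - N) * d, ?_⟩
  have hd' : funRes hV d = funRes hV t ^ N * c := hd
  rw [map_mul, map_pow, hd', ← mul_assoc, ← pow_add, Nat.sub_add_cancel hn]

/-- An affine open set is covered by finitely many basic open sets over which two given locally free
modules have frames. -/
lemma exists_finite_cover (hU : IsAffineOpen U) (hM : HasFrames r M U) (hN : HasFrames r' N U) :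
    ∃ (κ : Type) (_ : Fintype κ) (s : κ → Γ(X, U)), Ideal.span (Set.range s) = ⊤ ∧
      ∀ j, (∃ e : Fin r → Γ(M, X.basicOpen (s j)), IsFrame M _ e) ∧
        ∃ e : Fin r' → Γ(N, X.basicOpen (s j)), IsFrame N _ e := by
  have h (x : U) : ∃ s : Γ(X, U), x.1 ∈ X.basicOpen s ∧
      (∃ e : Fin r → Γ(M, X.basicOpen s), IsFrame M _ e) ∧
        ∃ e : Fin r' → Γ(N, X.basicOpen s), IsFrame N _ e := by
    obtain ⟨W, hxW, e, he⟩ := hM x x.2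
    obtain ⟨W', hxW', e', he'⟩ := hN x x.2
    obtain ⟨s, hs, hxs⟩ := hU.exists_basicOpen_le (V := W ⊓ W') ⟨x, hxW, hxW'⟩ x.2
    exact ⟨s, hxs, ⟨_, he.restrict (hs.trans inf_le_left)⟩,
      ⟨_, he'.restrict (hs.trans inf_le_right)⟩⟩
  choose s hxs hs using h
  have hspan : Ideal.span (Set.range s) = ⊤ := by
    rw [← hU.iSup_basicOpen_eq_self_iff]
    refine le_antisymm (iSup_le fun i ↦ X.basicOpen_le _) fun x hx ↦ ?_
    exact TopologicalSpace.Opens.mem_iSup.mpr ⟨⟨_, ⟨x, hx⟩, rfl⟩, hxs ⟨x, hx⟩⟩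
  obtain ⟨σ, hσ, hσ'⟩ := (Ideal.span_eq_top_iff_finite _).mp hspan
  refine ⟨σ, inferInstance, Subtype.val, by simpa using hσ', fun j ↦ ?_⟩
  obtain ⟨x, hx⟩ := hσ j.2
  rw [← hx]
  exact hs x

/-- Let `M` and `N` be locally free on the affine open set `U`. After multiplication with a power of
`t`, a homomorphism over `D(t)` extends to `U`. -/
lemma exists_extend [IsIntegral X] (hU : IsAffineOpen U) (hM : HasFrames r M U)
    (hN : HasFrames r' N U)
    (t : Γ(X, U)) (l : LocalHom (X.basicOpen t) M N) :
    ∀ᶠ n in Filter.atTop, ∃ l' : LocalHom U M N, ∀ V (h : V ≤ X.basicOpen t) x,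
      l'.toFun V (h.trans (X.basicOpen_le t)) x = (funRes (h.trans (X.basicOpen_le t)) t) ^ n •
        l.toFun V h x := by
  rcases isEmpty_or_nonempty (X.basicOpen t) with hD | hD
  · refine Filter.Eventually.of_forall fun n ↦ ⟨.ofGlobal 0 U, fun V h x ↦ ?_⟩
    exact sec_eq_of_isEmpty (fun y hy ↦ hD.false ⟨y, h hy⟩) _ _
  obtain ⟨κ, _, s, hs, hs'⟩ := exists_finite_cover hU hM hN
  choose he hf using hs'
  choose e he using he
  choose f hf using hf
  have hle (j) : X.basicOpen (s j) ≤ U := X.basicOpen_le _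
  -- on `D(s j) ∩ D(t)` the homomorphism is a matrix, the entries of which extend to `D(s j)`
  choose c hc using fun j a ↦ (hf j (X.basicOpen (s j) ⊓ X.basicOpen t) inf_le_left).2
    (l.toFun _ inf_le_right (secRes M inf_le_left (e j a)))
  have hev : ∀ᶠ n in Filter.atTop, ∀ j a b, ∃ d : Γ(X, X.basicOpen (s j)),
      funRes inf_le_left d = funRes (V := X.basicOpen (s j) ⊓ X.basicOpen t)
        (inf_le_left.trans (hle j)) t ^ n * c j a b := by
    simp only [Filter.eventually_all]
    intro j a b
    have := exists_funRes_eq_pow_mul (hU.basicOpen (s j)) (funRes (hle j) t)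
      (V := X.basicOpen (s j) ⊓ X.basicOpen t) inf_le_left (X.basicOpen_res t (homOfLE (hle j)).op)
      (c j a b)
    simpa only [funRes_funRes] using this
  filter_upwards [hev] with n hn
  choose d hd using hn
  choose l' hl' using fun j ↦ (he j).exists_localHom (fun a ↦ ∑ b, d j a b • f j b)
  have hl'' (j V) (h : V ≤ X.basicOpen (s j)) (h' : V ≤ X.basicOpen t) (x) :
      (l' j).toFun V h x = (funRes (h.trans (hle j)) t) ^ n • l.toFun V h' x := by
    have h1 := ((he j).restrict (inf_le_left : X.basicOpen (s j) ⊓ X.basicOpen t ≤ _)).localHom_ext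
      (l := (l' j).restrict inf_le_left)
      (l' := (l.restrict inf_le_right).smul (funRes (inf_le_left.trans (hle j)) t ^ n)) (fun a ↦ ?_)
      (le_inf h h') x
    · refine h1.trans ?_
      change funRes (le_inf h h') _ • l.toFun V h' x = _
      rw [map_pow, funRes_funRes]
    · change (l' j).toFun _ _ (secRes M _ (e j a)) = funRes _ _ • l.toFun _ _ (secRes M _ (e j a))
      rw [(l' j).map_res _ le_rfl, hl', ← hc j a, funRes_self]
      simp only [map_sum, secRes_smul, hd, Finset.smul_sum, smul_smul]
  -- the extensions agree on overlaps, because they do so after restriction to `D(t)`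
  obtain ⟨L, hL⟩ := exists_glue_localHom_of_le (W := U) hle (by
    rw [← iSup_range' (fun t ↦ X.basicOpen t) s]
    exact (hU.iSup_basicOpen_eq_self_iff.mpr hs).ge) l' (by
      intro i j V h h' x
      rcases isEmpty_or_nonempty (X.basicOpen (s i) ⊓ X.basicOpen (s j) : X.Opens) with hV' | hV'
      · exact sec_eq_of_isEmpty (fun y hy ↦ hV'.false ⟨y, h hy, h' hy⟩) _ _
      have := nonempty_inf (X.basicOpen (s i) ⊓ X.basicOpen (s j)) (X.basicOpen t)
      refine (hN.mono (inf_le_left.trans (hle i))).localHom_ext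
        (W := (X.basicOpen (s i) ⊓ X.basicOpen (s j)) ⊓ X.basicOpen t)
        (inf_le_left : _ ≤ X.basicOpen (s i) ⊓ X.basicOpen (s j))
        (l := (l' i).restrict inf_le_left) (l' := (l' j).restrict inf_le_right)
        (fun V hV x ↦ ?_) (le_inf h h') x
      exact (hl'' i V _ (hV.trans inf_le_right) x).trans
        (hl'' j V _ (hV.trans inf_le_right) x).symm)
  refine ⟨L, fun V h x ↦ ?_⟩
  refine sec_ext_of_cover (fun j ↦ V ⊓ X.basicOpen (s j)) (fun j ↦ inf_le_left) ?_ fun j ↦ ?_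
  · rw [← inf_iSup_eq]
    refine le_inf le_rfl ((h.trans (X.basicOpen_le t)).trans ?_)
    rw [← iSup_range' (fun t ↦ X.basicOpen t) s]
    exact (hU.iSup_basicOpen_eq_self_iff.mpr hs).ge
  · rw [← L.map_res, hL j _ inf_le_right, hl'' j _ _ (inf_le_left.trans h), secRes_smul, map_pow,
      funRes_funRes, ← l.map_res]

lemma hasFrames_structureSheaf (U : X.Opens) : HasFrames 1 (structureSheaf X) U :=
  fun _ hx ↦ ⟨U, hx, _, isFrame_one X U⟩

/-- After multiplication with a power of `t`, a section of a locally free module over `D(t)` extends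
to the affine open set `U`. -/
lemma exists_extend_section [IsIntegral X] (hU : IsAffineOpen U) (hM : HasFrames r M U)
    (t : Γ(X, U)) (y : Γ(M, X.basicOpen t)) :
    ∀ᶠ n in Filter.atTop, ∃ y' : Γ(M, U), secRes M (X.basicOpen_le t) y' =
      funRes (X.basicOpen_le t) t ^ n • y := by
  obtain ⟨l, hl⟩ := (isFrame_one X (X.basicOpen t)).exists_localHom (fun _ ↦ y)
  filter_upwards [exists_extend hU (hasFrames_structureSheaf U) hM t l] with n ⟨l', hl'⟩
  refine ⟨l'.toFun U le_rfl ((unitEquiv U).symm 1), ?_⟩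
  rw [← l'.map_res _ le_rfl, ← unitEquiv_symm_funRes, map_one, hl' _ le_rfl, hl 0]

lemma eq_zero_of_basicOpen_eq_bot [IsIntegral X] (t : Γ(X, U)) (h : X.basicOpen t = ⊥) : t = 0 :=
  (basicOpen_eq_bot_iff t).mp h

/-- A locally free module on an affine open set of an integral scheme has a dual basis: multiples of
local frames and of their coordinate functionals extend, and a partition of unity assembles them. -/
lemma exists_dualBasis [IsIntegral X] (hU : IsAffineOpen U) (hM : HasFrames r M U) :
    ∃ (κ : Type) (_ : Fintype κ), Nonempty (DualBasis M U κ) := by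
  obtain ⟨κ, _, s, hs, hs'⟩ := exists_finite_cover hU hM hM
  choose he hf using hs'
  choose e he using he
  choose d hd using fun j ↦ (he j).exists_dualBasis
  have hev : ∀ᶠ n in Filter.atTop, (∀ j a, ∃ y' : Γ(M, U), secRes M (X.basicOpen_le (s j)) y' =
      funRes (X.basicOpen_le (s j)) (s j) ^ n • e j a) ∧
      ∀ j a, ∃ l' : LocalHom U M (structureSheaf X), ∀ V (h : V ≤ X.basicOpen (s j)) x,
        l'.toFun V (h.trans (X.basicOpen_le (s j))) x =
          (funRes (h.trans (X.basicOpen_le (s j))) (s j)) ^ n • ((d j).coord a).toFun V h x := by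
    rw [Filter.eventually_and]
    simp only [Filter.eventually_all]
    exact ⟨fun j a ↦ exists_extend_section hU hM (s j) (e j a),
      fun j a ↦ exists_extend hU hM (hasFrames_structureSheaf U) (s j) ((d j).coord a)⟩
  obtain ⟨n, ⟨hy, hl⟩, hn⟩ := (hev.and (Filter.eventually_gt_atTop 0)).exists
  -- over the whole of `U`, multiplication with `s j ^ (2 * n)` factors through a free module
  have key (j : κ) : ∃ (y : Fin r → Γ(M, U)) (l : Fin r → LocalHom U M (structureSheaf X)),
      ∀ V (hV : V ≤ U) x, ∑ a, (l a).val hV x • secRes M hV (y a) =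
        funRes hV (s j) ^ (2 * n) • x := by
    -- for `s j ≠ 0` the open set `D(s j)` is dense, and the identity can be checked there
    by_cases hj : s j = 0
    · refine ⟨0, fun _ ↦ .ofGlobal 0 U, fun V hV x ↦ ?_⟩
      simp [hj, hn.ne']
    have hne : Nonempty (X.basicOpen (s j)) := by
      by_contra h
      refine hj (eq_zero_of_basicOpen_eq_bot (s j) (eq_bot_iff.mpr fun x hx ↦ ?_))
      exact (h ⟨x, hx⟩).elim
    choose y hy using hy j
    choose l hl using hl j
    refine ⟨y, l, fun V hV x ↦ ?_⟩
    let T : LocalHom U M M :=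
      { toFun := fun V h x ↦ ∑ a, (l a).val h x • secRes M h (y a)
        map_add := fun V h x y ↦ by simp [LocalHom.val_add, add_smul, Finset.sum_add_distrib]
        map_smul := fun V h r x ↦ by simp [LocalHom.val_smul, Finset.smul_sum, mul_smul]
        map_res := fun V h W h' x ↦ by simp [map_sum, LocalHom.val_secRes (h := h)] }
    refine (hM.localHom_ext (X.basicOpen_le (s j)) (l := T)
      (l' := (LocalHom.ofGlobal (𝟙 M) U).smul (s j ^ (2 * n))) (fun V hV x ↦ ?_) hV x).trans ?_
    · change ∑ a, (l a).val _ x • secRes M _ (y a) = funRes _ (s j ^ (2 * n)) • x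
      conv_rhs => rw [← (d j).sum_eq V hV x]
      rw [Finset.smul_sum]
      refine Finset.sum_congr rfl fun a _ ↦ ?_
      have h1 : (l a).val (hV.trans (X.basicOpen_le (s j))) x =
          (funRes (hV.trans (X.basicOpen_le (s j))) (s j)) ^ n * ((d j).coord a).val hV x := by
        rw [LocalHom.val, hl, map_smul]; rfl
      have h2 := congrArg (secRes M hV) (hy a)
      rw [secRes_smul, secRes_secRes, map_pow, funRes_funRes] at h2
      rw [h1, h2, hd, smul_smul, smul_smul, map_pow, two_mul, pow_add]
      congr 1
      ring
    · change funRes hV (s j ^ (2 * n)) • x = _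
      rw [map_pow]
  choose y l hyl using key
  have hs2 : (1 : Γ(X, U)) ∈ Ideal.span (Set.range fun j ↦ s j ^ (2 * n)) := by
    have := Ideal.span_pow_eq_top _ hs (2 * n)
    rw [← Set.range_comp] at this
    exact (Ideal.eq_top_iff_one _).mp this
  obtain ⟨c, hc⟩ := Ideal.mem_span_range_iff_exists_fun.mp hs2
  refine ⟨κ × Fin r, inferInstance, ⟨⟨fun p ↦ y p.1 p.2, fun p ↦ (l p.1 p.2).smul (c p.1),
    fun V hV x ↦ ?_⟩⟩⟩
  rw [Fintype.sum_prod_type]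
  have h1 (j : κ) : ∑ a, ((l j a).smul (c j)).val hV x • secRes M hV (y j a) =
      funRes hV (c j * s j ^ (2 * n)) • x := by
    rw [map_mul, map_pow, mul_smul, ← hyl, Finset.smul_sum]
    exact Finset.sum_congr rfl fun a _ ↦ SemigroupAction.mul_smul (α := Γ(X, V))
      (funRes hV (c j)) ((l j a).val hV x) (secRes M hV (y j a))
  rw [Finset.sum_congr rfl fun j _ ↦ h1 j, ← Finset.sum_smul, ← map_sum, hc, map_one, one_smul]

end TorsionFree

/-! ### Closed subschemes of codimension two -/

section ClosedSubscheme
variable {X Z : Scheme.{0}} {i : Z ⟶ X} {U : X.Opens}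

/-- A function that vanishes on `Z` vanishes at the points of `Z`. -/
lemma notMem_basicOpen_of_funPb_eq_zero {z : Z} {V : X.Opens} {r : Γ(X, V)} (hr : funPb i V r = 0) :
    i z ∉ X.basicOpen r := by
  intro h
  have h1 : z ∈ i ⁻¹ᵁ X.basicOpen r := h
  have hr' : i.app V r = 0 := hr
  rw [Scheme.preimage_basicOpen, hr', Scheme.basicOpen_zero] at h1
  exact h1

/-- The points of a closed subscheme over an affine open set are the zeros of its ideal. -/
lemma mem_range_iff_forall_notMem_basicOpen [IsClosedImmersion i] (hU : IsAffineOpen U) {x : X}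
    (hx : x ∈ U) : x ∈ Set.range i ↔ ∀ r : Γ(X, U), funPb i U r = 0 → x ∉ X.basicOpen r := by
  refine ⟨?_, fun h ↦ ?_⟩
  · rintro ⟨z, rfl⟩ r hr
    exact notMem_basicOpen_of_funPb_eq_zero hr
  · have h1 : x ∈ i.ker.support := by
      rw [Scheme.IdealSheafData.mem_support_iff_of_mem (U := ⟨U, hU⟩) hx,
        Scheme.mem_zeroLocus_iff]
      intro r hr
      rw [Scheme.Hom.ker_apply] at hr
      exact h r hr
    have h2 : x ∈ closure (Set.range i) := by
      rw [← Scheme.Hom.support_ker i]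
      exact h1
    rwa [i.isClosedEmbedding.isClosed_range.closure_eq] at h2

end ClosedSubscheme

section Codimension
open RingTheory.Sequence

/-- Elements of a regular sequence of length two do not have a common divisor in a localization. -/
lemma not_dvd_of_isRegular {R S : Type*} [CommRing R] [CommRing S] [IsDomain S] [Algebra R S]
    (m : Submonoid R) [IsLocalization m S] (hinj : Function.Injective (algebraMap R S)) {f g : R}
    (h : IsRegular R [f, g]) {π : S} (hπ : ¬ IsUnit π) (hf : π ∣ algebraMap R S f)
    (hg : π ∣ algebraMap R S g) : False := by
  have := h.nontrivial
  obtain ⟨h1, h2⟩ := (isWeaklyRegular_cons_iff R f [g]).mp h.toIsWeaklyRegular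
  rw [isWeaklyRegular_singleton_iff] at h2
  obtain ⟨f', hf'⟩ := hf
  obtain ⟨g', hg'⟩ := hg
  obtain ⟨a, b, c, ha, hb⟩ := IsLocalization.surj₂ m S f' g'
  have hab : g * a = f * b := by
    apply hinj
    rw [map_mul, map_mul, ← ha, ← hb, hf', hg']
    ring
  have h3 : (Submodule.Quotient.mk a : QuotSMulTop f R) = 0 := by
    apply h2
    change g • (Submodule.Quotient.mk a : QuotSMulTop f R) = g • 0
    rw [smul_zero, ← Submodule.Quotient.mk_smul, Submodule.Quotient.mk_eq_zero, smul_eq_mul, hab]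
    exact Submodule.smul_mem_pointwise_smul b f ⊤ trivial
  rw [Submodule.Quotient.mk_eq_zero] at h3
  obtain ⟨e, -, he⟩ := Submodule.mem_smul_pointwise_iff_exists _ _ _ |>.mp h3
  have hf0 : f' ≠ 0 := by
    rintro rfl
    have : f = 0 := hinj (by rw [hf', mul_zero, map_zero])
    subst this
    have h01 : (1 : R) = 0 := h1 (by simp)
    exact one_ne_zero h01
  refine hπ (isUnit_of_mul_isUnit_left (y := algebraMap R S e) ?_)
  have h4 : f' * algebraMap R S c = f' * (π * algebraMap R S e) := by
    rw [ha, ← he, smul_eq_mul, map_mul, hf']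
    ring
  rw [← mul_left_cancel₀ hf0 h4]
  exact IsLocalization.map_units S c

variable {X Z : Scheme.{0}} {i : Z ⟶ X} {U : X.Opens}

/-- The ideal of a local complete intersection of codimension two does not lie in a principal
prime ideal `(π)`. Otherwise the point given by `(π)` belongs to `Z`, and in its local ring `π`
divides both members of a regular sequence. -/
lemma IsLCIOfCodim.exists_not_dvd [IsIntegral X] [IsClosedImmersion i] (h : IsLCIOfCodim 2 i)
    (hU : IsAffineOpen U) {π : Γ(X, U)} (hπ : Prime π) :
    ∃ r, funPb i U r = 0 ∧ ¬ π ∣ r := by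
  by_contra! hd
  let y : PrimeSpectrum Γ(X, U) := ⟨_, (Ideal.span_singleton_prime hπ.ne_zero).mpr hπ⟩
  have hxU : hU.fromSpec y ∈ U := by
    have := hU.range_fromSpec
    exact this.le ⟨y, rfl⟩
  have hmem (r : Γ(X, U)) (hr : π ∣ r) : hU.fromSpec y ∉ X.basicOpen r := by
    intro h1
    have h2 : y ∈ hU.fromSpec ⁻¹ᵁ X.basicOpen r := h1
    rw [hU.fromSpec_preimage_basicOpen] at h2
    exact h2 (Ideal.mem_span_singleton.mpr hr)
  obtain ⟨z, hz⟩ := (mem_range_iff_forall_notMem_basicOpen (i := i) hU hxU).mpr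
    fun r hr ↦ hmem r (hd r hr)
  obtain ⟨V, hV, hzV, rs, hlen, hreg, hker⟩ := h z
  obtain ⟨f, g, rfl⟩ := List.length_eq_two.mp hlen
  have hxV : hU.fromSpec y ∈ V := hz ▸ hzV
  have hloc := hU.isLocalization_stalk' y hxU
  let := (X.presheaf.germ V (hU.fromSpec y) hxV).hom.toAlgebra
  have hloc' := hV.isLocalization_stalk ⟨_, hxV⟩
  have : Nonempty V := ⟨⟨_, hxV⟩⟩
  have hinj : Function.Injective (X.presheaf.germ V (hU.fromSpec y) hxV).hom :=
    germ_injective_of_isIntegral X _ hxV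
  have hdvd (r : Γ(X, V)) (hr : funPb i V r = 0) :
      X.presheaf.germ U (hU.fromSpec y) hxU π ∣ X.presheaf.germ V (hU.fromSpec y) hxV r := by
    have h1 : hU.fromSpec y ∉ X.basicOpen r := hz ▸ notMem_basicOpen_of_funPb_eq_zero hr
    rw [Scheme.mem_basicOpen _ _ _ hxV] at h1
    have h2 := (IsLocalRing.mem_maximalIdeal _).mpr h1
    let := TopCat.Presheaf.algebra_section_stalk X.presheaf (U := U) ⟨hU.fromSpec y, hxU⟩
    have h3 := @IsLocalization.AtPrime.map_eq_maximalIdeal _ _ y.asIdeal y.isPrime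
      (X.presheaf.stalk (hU.fromSpec y)) _ this hloc inferInstance
    rw [← h3, Ideal.map_span, Set.image_singleton,
      Ideal.mem_span_singleton] at h2
    exact h2
  have hk (r : Γ(X, V)) (hr : r ∈ Ideal.ofList [f, g]) : funPb i V r = 0 := by
    rw [← hker] at hr; exact hr
  refine not_dvd_of_isRegular (S := X.presheaf.stalk (hU.fromSpec y))
    (hV.primeIdealOf ⟨_, hxV⟩).asIdeal.primeCompl hinj hreg
    (π := X.presheaf.germ U (hU.fromSpec y) hxU π) ?_ (hdvd f (hk f ?_)) (hdvd g (hk g ?_))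
  · rw [← Scheme.mem_basicOpen]
    exact hmem π dvd_rfl
  · exact Ideal.subset_span (by simp)
  · exact Ideal.subset_span (by simp)

end Codimension

instance isIntegral_P1 : IsIntegral P1 := atlasP1.isIntegral

lemma nonempty_overlap : Nonempty overlap := by
  rw [← chart_inf]; exact atlasP1.nonempty_inf

instance nonempty_chart (j : Fin 2) : Nonempty (chart j) :=
  nonempty_overlap.map fun x ↦ ⟨x.1, overlap_le j x.2⟩

lemma isAffineOpen_chart (j : Fin 2) : IsAffineOpen (chart j) := atlasP1.isAffineOpen j

/-! ### The image of `β` -/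

section Surjectivity
variable {E : P1.Modules} {a b : ℤ} {Z : Scheme.{0}} {i : Z ⟶ P1}

/-- Over a chart, the functional `β` has the ideal of `Z` as its image. -/
lemma ExtData.exists_β_eq (D : ExtData E a b i) (hE : IsLocallyFreeOfRank 2 E) (j : Fin 2)
    (r : Γ(P1, chart j)) (hr : funPb i (chart j) r = 0) : ∃ y, (D.β j).val le_rfl y = r := by
  -- the functions `s` for which `s r` lies in the image; by local surjectivity they generate `1`
  let J : Ideal Γ(P1, chart j) := Submodule.comap (LinearMap.mulRight Γ(P1, chart j) r)
    (LinearMap.range ((D.β j).valLin le_rfl))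
  have hJ (x) (hx : x ∈ chart j) : ∃ s : J, x ∈ P1.basicOpen s.1 := by
    obtain ⟨W, hW, hxW, y, hy⟩ := D.exists_local_β j _ le_rfl r hr x hx
    obtain ⟨s, hs, hxs⟩ := (isAffineOpen_chart j).exists_basicOpen_le ⟨x, hxW⟩ hx
    obtain ⟨n, ⟨y', hy'⟩, hn⟩ := ((exists_extend_section (isAffineOpen_chart j) (hE.hasFrames _) s
      (secRes E hs y)).and (Filter.eventually_gt_atTop 0)).exists
    refine ⟨⟨s ^ n, y', ?_⟩, ?_⟩
    · have : Nonempty (P1.basicOpen s) := ⟨⟨x, hxs⟩⟩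
      apply funRes_injective (P1.basicOpen_le s)
      rw [LocalHom.valLin_apply, ← LocalHom.val_secRes, hy', LocalHom.val_smul,
        LocalHom.val_secRes (h := hW), hy, funRes_funRes, LinearMap.mulRight_apply, map_mul,
        map_pow]
    · exact (P1.basicOpen_pow s hn).ge hxs
  have h1 : Ideal.span (J : Set Γ(P1, chart j)) = ⊤ := by
    rw [← (isAffineOpen_chart j).iSup_basicOpen_eq_self_iff]
    refine le_antisymm (iSup_le fun s ↦ P1.basicOpen_le _) fun x hx ↦ ?_
    obtain ⟨s, hs⟩ := hJ x hx
    exact TopologicalSpace.Opens.mem_iSup.mpr ⟨s, hs⟩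
  rw [Ideal.span_eq, Ideal.eq_top_iff_one] at h1
  obtain ⟨y, hy⟩ := h1
  exact ⟨y, by simpa using hy⟩

end Surjectivity

/-! ### Modules over unique factorization domains -/

section UniqueFactorization
variable {R P : Type*} [CommRing R] [UniqueFactorizationMonoid R] [AddCommGroup P] [Module R P]

/-- If every prime factor of `w` divides `s`, then `w` divides a power of `s`. -/
lemma exists_dvd_pow_of_prime_dvd {w s : R} (hw : w ≠ 0) (h : ∀ π, Prime π → π ∣ w → π ∣ s) :
    ∃ n, w ∣ s ^ n := by
  induction w using UniqueFactorizationMonoid.induction_on_prime with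
  | h₁ => exact absurd rfl hw
  | h₂ u hu => exact ⟨0, hu.dvd⟩
  | h₃ c π hc hπ ih =>
    obtain ⟨n, hn⟩ := ih hc fun π' hπ' hd ↦ h π' hπ' (hd.mul_left _)
    refine ⟨n + 1, ?_⟩
    rw [pow_succ']
    exact mul_dvd_mul (h π hπ (dvd_mul_right _ _)) hn

/-- Let `P` be a locally free module of rank two, and `β` a functional whose kernel is generated by
`α` and whose image lies in no principal prime ideal. Then `x ∧ y ↦ β x • y - β y • x` identifies
the determinant of `P` with the multiples of `α`: the factors `w` in `β x • y - β y • x = w • α`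
generate the unit ideal. A prime dividing such a factor for a local basis `x`, `y` would divide `β`.
The set `S` and the hypothesis `hloc` express local freeness: after inverting `s ∈ S`, the elements
`x` and `y` are a basis. -/
lemma span_factors_eq_top [IsDomain R] (β : P →ₗ[R] R) (α : P)
    (hker : ∀ x, β x = 0 → ∃ r : R, x = r • α)
    (hcodim : ∀ π, Prime π → ∃ x, ¬ π ∣ β x) (hprime : ∃ π : R, Prime π) (S : Set R)
    (hS : Ideal.span S = ⊤)
    (hloc : ∀ s ∈ S, s ≠ 0 → ∃ x y : P, (∀ c d : R, c • x + d • y = 0 → c = 0 ∧ d = 0) ∧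
      ∀ z, ∃ (n : ℕ) (c d : R), s ^ n • z = c • x + d • y) :
    Ideal.span {w : R | ∃ x y, β x • y - β y • x = w • α} = ⊤ := by
  rw [← Ideal.radical_eq_top, eq_top_iff, ← hS, Ideal.span_le]
  intro s hs
  by_cases hs0 : s = 0
  · rw [hs0]; exact zero_mem _
  obtain ⟨x, y, hindep, hgen⟩ := hloc s hs hs0
  obtain ⟨w, hw⟩ := hker (β x • y - β y • x) (by simp [mul_comm])
  obtain ⟨m, u, v, huv⟩ := hgen α
  have h1 : (w * u + s ^ m * β y) • x + (w * v - s ^ m * β x) • y = 0 := by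
    calc _ = w • (u • x + v • y) - s ^ m • (β x • y - β y • x) := by module
      _ = 0 := by rw [← huv, hw, smul_comm, sub_self]
  obtain ⟨hx, hy⟩ := hindep _ _ h1
  have key (π : R) (hπ : Prime π) (h : ¬ π ∣ s) (hdx : π ∣ β x) (hdy : π ∣ β y) : False := by
    obtain ⟨z, hz⟩ := hcodim π hπ
    obtain ⟨n, c, d, hn⟩ := hgen z
    have h2 : s ^ n * β z = c * β x + d * β y := by
      have := congrArg β hn
      simpa using this
    refine hz ((hπ.dvd_or_dvd (h2 ▸ dvd_add (hdx.mul_left _) (hdy.mul_left _))).resolve_left ?_)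
    exact fun h' ↦ h (hπ.dvd_of_dvd_pow h')
  have hsm : s ^ m ≠ 0 := pow_ne_zero _ hs0
  have hw0 : w ≠ 0 := by
    rintro rfl
    have hx0 : β x = 0 := by simpa [hsm] using hy
    have hy0 : β y = 0 := by simpa [hsm] using hx
    obtain ⟨π, hπ⟩ := hprime
    obtain ⟨z, hz⟩ := hcodim π hπ
    obtain ⟨n, c, d, hn⟩ := hgen z
    have h2 : s ^ n * β z = c * β x + d * β y := by
      have := congrArg β hn
      simpa using this
    rw [hx0, hy0, mul_zero, mul_zero, add_zero] at h2
    rw [(mul_eq_zero.mp h2).resolve_left (pow_ne_zero _ hs0)] at hz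
    exact hz (dvd_zero _)
  -- `w` is a unit after inverting `s`, for its prime factors divide `s`
  obtain ⟨n, hn⟩ := exists_dvd_pow_of_prime_dvd hw0 (s := s) fun π hπ hd ↦ by
    by_contra h
    have h' : ¬ π ∣ s ^ m := fun h' ↦ h (hπ.dvd_of_dvd_pow h')
    refine key π hπ h ((hπ.dvd_or_dvd (a := s ^ m) ?_).resolve_left h')
      ((hπ.dvd_or_dvd (a := s ^ m) ?_).resolve_left h')
    · rw [← sub_eq_zero.mp hy]; exact hd.mul_right _
    · rw [eq_neg_of_add_eq_zero_right hx]; exact (hd.mul_right _).neg_right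
  exact ⟨n, Ideal.mem_of_dvd _ hn (Ideal.subset_span ⟨x, y, hw⟩)⟩

/-- A nonzero projective module of rank one over a unique factorization domain is free: dividing a
functional by the greatest common divisor of its values gives an isomorphism. The hypothesis
`hprop` says that the functionals of a dual basis are proportional. -/
lemma exists_generator_of_dualBasis [IsDomain R] {ι : Type} [Fintype ι] (x : ι → P)
    (l : ι → P →ₗ[R] R)
    (hsum : ∀ z, ∑ i, l i z • x i = z) (hprop : ∀ i j z z', l i z * l j z' = l i z' * l j z)
    (hne : ∃ z : P, z ≠ 0) : ∃ (y : P) (μ : P →ₗ[R] R), μ y = 1 ∧ ∀ z, μ z • y = z := by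
  classical
  have := Classical.choice (inferInstance : Nonempty (NormalizedGCDMonoid R))
  obtain ⟨z₀, hz₀⟩ := hne
  obtain ⟨i₀, hi₀⟩ : ∃ i, l i z₀ ≠ 0 := by
    by_contra! h
    exact hz₀ (by rw [← hsum z₀]; simp [h])
  obtain ⟨m, hm, hm1⟩ := Finset.extract_gcd (s := Finset.univ) (fun i ↦ l i₀ (x i)) ⟨i₀, by simp⟩
  set d := Finset.univ.gcd fun i ↦ l i₀ (x i)
  -- the functional `l i₀` divided by the greatest common divisor `d` of its values
  let μ : P →ₗ[R] R := ∑ i, m i • l i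
  have hμ (z) : d * μ z = l i₀ z := by
    conv_rhs => rw [← hsum z]
    simp only [μ, LinearMap.sum_apply, LinearMap.smul_apply, smul_eq_mul, map_sum, map_smul,
      Finset.mul_sum]
    refine Finset.sum_congr rfl fun i _ ↦ ?_
    rw [hm i (Finset.mem_univ i)]
    ring
  have hd : d ≠ 0 := fun h ↦ hi₀ (by rw [← hμ, h, zero_mul])
  have hμp (i z z') : l i z * μ z' = l i z' * μ z := by
    apply mul_left_cancel₀ hd
    linear_combination l i z * hμ z' - l i z' * hμ z + hprop i i₀ z z'
  have hμx (k) : μ (x k) = m k :=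
    mul_left_cancel₀ hd ((hμ _).trans (hm k (Finset.mem_univ k)))
  obtain ⟨k, hk⟩ : ∃ k, m k ≠ 0 := by
    by_contra! h
    exact hi₀ (by rw [← hμ z₀]; simp [μ, h])
  -- `l i` is a multiple of `μ`: the ratio `l i (x k) / m k` is integral, as the values `m j` of `μ`
  -- have no common divisor
  have hdvd (i) : m k ∣ l i (x k) := by
    have h1 : m k ∣ Finset.univ.gcd fun j ↦ l i (x k) * m j := by
      refine Finset.dvd_gcd fun j _ ↦ ⟨l i (x j), ?_⟩
      rw [← hμx j, hμp, hμx]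
      ring
    have h2 := Finset.gcd_mul_left' Finset.univ m (l i (x k))
    rw [hm1, mul_one] at h2
    exact h1.trans h2.dvd
  choose c hc using hdvd
  have hcm : ∑ i, m i * c i = 1 := by
    apply mul_left_cancel₀ hk
    rw [mul_one, Finset.mul_sum]
    conv_rhs => rw [← hμx k]
    simp only [μ, LinearMap.sum_apply, LinearMap.smul_apply, smul_eq_mul, hc]
    exact Finset.sum_congr rfl fun i _ ↦ by ring
  refine ⟨∑ i, c i • x i, μ, ?_, fun z ↦ ?_⟩
  · rw [map_sum, ← hcm]
    exact Finset.sum_congr rfl fun i _ ↦ by rw [map_smul, hμx, smul_eq_mul, mul_comm]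
  · have h1 : μ (∑ i, c i • x i) = 1 := by
      rw [map_sum, ← hcm]
      exact Finset.sum_congr rfl fun i _ ↦ by rw [map_smul, hμx, smul_eq_mul, mul_comm]
    rw [← hsum (μ z • _), ← hsum z]
    refine Finset.sum_congr rfl fun i _ ↦ ?_
    rw [hsum, map_smul, smul_eq_mul, mul_comm, ← hμp, h1, mul_one]

end UniqueFactorization

/-! ### The factors of the extension on a chart -/

section Factors
variable {E : P1.Modules} {a b : ℤ} {Z : Scheme.{0}} {i : Z ⟶ P1}

instance (j : Fin 2) : IsDomain Γ(P1, chart j) := atlasP1.isDomain j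

instance (j : Fin 2) : UniqueFactorizationMonoid Γ(P1, chart j) :=
  (chartPoly j).toMulEquiv.uniqueFactorizationMonoid inferInstance

lemma exists_prime_chart (j : Fin 2) : ∃ π : Γ(P1, chart j), Prime π :=
  ⟨_, (MulEquiv.prime_iff (chartPoly j)).mpr Polynomial.prime_X⟩

/-- Near a point of an affine open set, sections of a module locally free of rank two become
combinations of two independent sections after multiplication with a power of a function. -/
lemma HasFrames.exists_pow_smul_eq {X : Scheme.{0}} [IsIntegral X] {M : X.Modules} {U : X.Opens}
    (hU : IsAffineOpen U) (hM : HasFrames 2 M U) {s : Γ(X, U)} (hs : s ≠ 0)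
    {e : Fin 2 → Γ(M, X.basicOpen s)} (he : IsFrame M _ e) :
    ∃ x y : Γ(M, U), (∀ c d : Γ(X, U), c • x + d • y = 0 → c = 0 ∧ d = 0) ∧
      ∀ z, ∃ (n : ℕ) (c d : Γ(X, U)), s ^ n • z = c • x + d • y := by
  have hle := X.basicOpen_le s
  have hne : Nonempty (X.basicOpen s) := by
    by_contra h
    refine hs (eq_zero_of_basicOpen_eq_bot s (eq_bot_iff.mpr fun x hx ↦ ?_))
    exact (h ⟨x, hx⟩).elim
  have hne' : Nonempty U := hne.map fun x ↦ ⟨x.1, hle x.2⟩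
  have hs' : funRes hle s ≠ 0 := fun h ↦ hs (funRes_injective hle (h.trans (map_zero _).symm))
  have hinj {z z' : Γ(M, U)} (h : secRes M hle z = secRes M hle z') : z = z' := by
    rw [← sub_eq_zero] at h ⊢
    rw [← map_sub] at h
    exact hM.eq_zero_of_secRes hle h
  obtain ⟨n, ⟨x, hx⟩, ⟨y, hy⟩⟩ := ((exists_extend_section hU hM s (e 0)).and
    (exists_extend_section hU hM s (e 1))).exists
  refine ⟨x, y, fun c d h ↦ ?_, fun z ↦ ?_⟩
  · have h1 := congrArg (secRes M hle) h
    rw [map_add, secRes_smul, secRes_smul, hx, hy, map_zero, smul_smul, smul_smul] at h1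
    have h2 := he.ext le_rfl (a := ![funRes hle c * funRes hle s ^ n,
      funRes hle d * funRes hle s ^ n]) (b := fun _ ↦ 0) (by simpa using h1)
    have h3 := h2 0
    have h4 := h2 1
    simp only [Matrix.cons_val_zero, Matrix.cons_val_one, mul_eq_zero, pow_ne_zero n hs',
      or_false] at h3 h4
    exact ⟨funRes_injective hle (h3.trans (map_zero _).symm),
      funRes_injective hle (h4.trans (map_zero _).symm)⟩
  · obtain ⟨c, hc⟩ := (he _ le_rfl).2 (secRes M hle z)
    simp only [Fin.sum_univ_two, secRes_self] at hc
    obtain ⟨m, ⟨d₀, hd₀⟩, ⟨d₁, hd₁⟩⟩ := ((exists_funRes_eq_pow_mul hU s hle rfl (c 0)).and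
      (exists_funRes_eq_pow_mul hU s hle rfl (c 1))).exists
    refine ⟨n + m, d₀, d₁, hinj ?_⟩
    rw [map_add, secRes_smul, secRes_smul, secRes_smul, hx, hy, hd₀, hd₁, ← hc, map_pow, smul_add,
      smul_smul, smul_smul, smul_smul, smul_smul]
    congr 2 <;> ring

/-- On a chart, the factors `w` in `β x • y - β y • x = w • α` generate the unit ideal. -/
lemma ExtData.span_factors (D : ExtData E a b i) (hE : IsLocallyFreeOfRank 2 E)
    [IsClosedImmersion i] (hZ : IsLCIOfCodim 2 i) (j : Fin 2) :
    Ideal.span {w : Γ(P1, chart j) | ∃ x y, (D.β j).val le_rfl x • y - (D.β j).val le_rfl y • x =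
      w • D.α j} = ⊤ := by
  obtain ⟨κ, _, s, hs, hs'⟩ := exists_finite_cover (isAffineOpen_chart j) (hE.hasFrames (chart j))
    (hE.hasFrames (chart j))
  refine span_factors_eq_top ((D.β j).valLin le_rfl) (D.α j) (fun x hx ↦ ?_)
    (fun π hπ ↦ ?_) (exists_prime_chart j) (Set.range s) hs ?_
  · obtain ⟨r, hr⟩ := D.exists_smul_α j _ le_rfl x hx
    exact ⟨r, by simpa using hr⟩
  · obtain ⟨r, hr, hd⟩ := hZ.exists_not_dvd (isAffineOpen_chart j) hπ
    obtain ⟨y, rfl⟩ := D.exists_β_eq hE j r hr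
    exact ⟨y, hd⟩
  · rintro _ ⟨k, rfl⟩ hk
    obtain ⟨e, he⟩ := (hs' k).1
    exact (hE.hasFrames _).exists_pow_smul_eq (isAffineOpen_chart j) hk he

end Factors

/-! ### Splitting of triangular transition matrices -/

section Frames
variable {X : Scheme.{0}} {M N : X.Modules} {U V : X.Opens}

/-- Change of frame by an invertible two by two matrix. -/
lemma IsFrame.of_det {x y : Γ(M, U)} (h : IsFrame M U ![x, y]) {p q r s d : Γ(X, U)}
    (hd : d * (p * s - q * r) = 1) : IsFrame M U ![p • x + q • y, r • x + s • y] := by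
  intro V hV
  have hd' : funRes hV d * (funRes hV p * funRes hV s - funRes hV q * funRes hV r) = 1 := by
    rw [← map_mul, ← map_mul, ← map_sub, ← map_mul, hd, map_one]
  have e (c : Fin 2 → Γ(X, V)) :
      ∑ j, c j • secRes M hV (![p • x + q • y, r • x + s • y] j) =
      ∑ j, ![c 0 * funRes hV p + c 1 * funRes hV r, c 0 * funRes hV q + c 1 * funRes hV s] j •
        secRes M hV (![x, y] j) := by
    simp only [Fin.sum_univ_two, Matrix.cons_val_zero, Matrix.cons_val_one, map_add, secRes_smul]
    module
  constructor
  · intro c c' hcc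
    simp only [e] at hcc
    have h0 := h.ext hV hcc 0
    have h1 := h.ext hV hcc 1
    simp only [Matrix.cons_val_zero, Matrix.cons_val_one] at h0 h1
    ext j
    fin_cases j
    · change c 0 = c' 0
      linear_combination (funRes hV d * funRes hV s) * h0 - (funRes hV d * funRes hV r) * h1 +
        (c' 0 - c 0) * hd'
    · change c 1 = c' 1
      linear_combination (funRes hV d * funRes hV p) * h1 - (funRes hV d * funRes hV q) * h0 +
        (c' 1 - c 1) * hd'
  · intro z
    obtain ⟨c, rfl⟩ := (h V hV).2 z
    refine ⟨![funRes hV d * (c 0 * funRes hV s - c 1 * funRes hV r),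
      funRes hV d * (c 1 * funRes hV p - c 0 * funRes hV q)], ?_⟩
    refine (e _).trans (Finset.sum_congr rfl fun j _ ↦ ?_)
    congr 1
    fin_cases j
    · simp only [Fin.zero_eta, Matrix.cons_val_zero, Matrix.cons_val_one]
      linear_combination c 0 * hd'
    · simp only [Fin.mk_one, Matrix.cons_val_zero, Matrix.cons_val_one]
      linear_combination c 1 * hd'

lemma IsFrame.not_isZero {ι : Type} [Fintype ι] [Nonempty ι] [Nonempty U] {s : ι → Γ(M, U)}
    (hs : IsFrame M U s) : ¬ IsZero M := by
  intro h
  have h0 (x : Γ(M, U)) : x = 0 := congr($(h.eq_of_src (𝟙 M) 0).app U x)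
  obtain ⟨j⟩ := ‹Nonempty ι›
  exact one_ne_zero (hs.ext le_rfl (a := fun _ ↦ 1) (b := fun _ ↦ 0)
    ((h0 _).trans (h0 _).symm) j)

end Frames

section Splitting
open LaurentPolynomial
variable {k : Type} [CommRing k] {X : Scheme.{0}} (A : Atlas k X) {M L N : X.Modules}

/-- The `n`-th power of the coordinate of the second chart. -/
def Atlas.coord (n : ℤ) : Γ(X, A.U 0 ⊓ A.U 1) := A.laurent (T n)

lemma Atlas.coord_add (m n : ℤ) : A.coord (m + n) = A.coord m * A.coord n := by
  rw [coord, T_add, map_mul]; rfl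

lemma Atlas.coord_zero : A.coord 0 = 1 := by rw [coord, T_zero, map_one]

lemma Atlas.coord_mul_neg (n : ℤ) : A.coord n * A.coord (-n) = 1 := by
  rw [← coord_add, add_neg_cancel, coord_zero]

/-- The powers of the coordinate as a homomorphism. -/
def Atlas.coordHom : Multiplicative ℤ →* Γ(X, A.U 0 ⊓ A.U 1) where
  toFun n := A.coord n.toAdd
  map_one' := A.coord_zero
  map_mul' _ _ := A.coord_add _ _

lemma Atlas.coord_one : A.coord 1 = funRes inf_le_right (A.poly 1 Polynomial.X) := by
  rw [← A.laurent_toLaurent, Polynomial.toLaurent_X]; rfl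

/-- A module with triangular transition matrix, with diagonal entries `T ^ m` and `T ^ n` where
`n ≤ m + 1`, is the direct sum of the corresponding line bundles. -/
lemma Atlas.nonempty_iso_biprod {g f : ∀ i, Γ(M, A.U i)}
    (hgf : ∀ i, IsFrame M (A.U i) ![g i, f i]) {m n : ℤ} (hmn : n ≤ m + 1)
    (hg : secRes M inf_le_left (g 0) = A.coord m • secRes M inf_le_right (g 1))
    (r : Γ(X, A.U 0 ⊓ A.U 1)) (hf : secRes M inf_le_left (f 0) =
      A.coord n • secRes M inf_le_right (f 1) + r • secRes M inf_le_right (g 1))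
    {l : ∀ i, Γ(L, A.U i)} {l' : ∀ i, Γ(N, A.U i)}
    (hl : ∀ i, IsFrame L (A.U i) fun _ : Fin 1 ↦ l i)
    (hl' : ∀ i, IsFrame N (A.U i) fun _ : Fin 1 ↦ l' i)
    (hlm : secRes L inf_le_left (l 0) = A.coord m • secRes L inf_le_right (l 1))
    (hln : secRes N inf_le_left (l' 0) = A.coord n • secRes N inf_le_right (l' 1)) :
    Nonempty (M ≅ L ⊞ N) := by
  obtain ⟨ρ, rfl⟩ := A.laurent.surjective r
  -- `r` is a coboundary, so that `f` can be corrected by multiples of `g` on the two charts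
  obtain ⟨p, q, hpq⟩ := exists_eq_toLaurent_add (T (-n) * ρ) (m := m - n) (by omega)
  have hρ : A.laurent ρ = A.coord n * funRes inf_le_right (A.poly 1 p) +
      A.coord m * funRes inf_le_left (A.poly 0 q) := by
    rw [← A.laurent_toLaurent, ← A.laurent_invert, coord, coord, ← map_mul, ← map_mul, ← map_add]
    congr 1
    have h1 : (T n * T (-n) : k[T;T⁻¹]) = 1 := by rw [← T_add]; simp
    have h2 : (T n * T (m - n) : k[T;T⁻¹]) = T m := by rw [← T_add]; congr 1; omega
    linear_combination T n * hpq - ρ * h1 + invert (Polynomial.toLaurent q) * h2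
  let f' : ∀ i, Γ(M, A.U i) := Fin.cons ((-A.poly 0 q) • g 0 + (1 : Γ(X, A.U 0)) • f 0)
    (Fin.cons (A.poly 1 p • g 1 + (1 : Γ(X, A.U 1)) • f 1) finZeroElim)
  have hframe (i) : IsFrame M (A.U i) ![g i, f' i] := by
    have key (i) (c : Γ(X, A.U i)) :
        IsFrame M (A.U i) ![g i, c • g i + (1 : Γ(X, A.U i)) • f i] := by
      have := (hgf i).of_det (p := 1) (q := 0) (r := c) (s := 1) (d := 1) (by ring)
      simpa using this
    fin_cases i
    · exact key 0 _
    · exact key 1 _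
  refine nonempty_iso_of_frames A.iSup_eq_top hframe (fun i ↦ (hl i).biprod (hl' i))
    (fun j k ↦ if j = k then ![A.coord m, A.coord n] j else 0) (fun j ↦ ?_) (fun j ↦ ?_)
  · fin_cases j
    · simpa using hg
    · have h1 : secRes M inf_le_left (f' 0) = A.coord n • secRes M inf_le_right (f' 1) := by
        change secRes M inf_le_left ((-A.poly 0 q) • g 0 + (1 : Γ(X, A.U 0)) • f 0) =
          A.coord n • secRes M inf_le_right (A.poly 1 p • g 1 + (1 : Γ(X, A.U 1)) • f 1)
        simp only [map_add, secRes_smul, hg, hf, hρ, map_neg, map_one]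
        module
      simpa using h1
  · fin_cases j
    · simp [hlm, Scheme.Modules.Hom.app_smul, ← app_secRes]
    · simp [hln, Scheme.Modules.Hom.app_smul, ← app_secRes]

/-- The transition function of `𝒪(n)` is the `n`-th power of the coordinate of the second chart. -/
lemma funRes_coordPow (n : ℤ) : funRes chart_inf.le (coordPow n) = atlasP1.coord n := by
  let φ : Multiplicative ℤ →* Γ(P1, atlasP1.U 0 ⊓ atlasP1.U 1) :=
    { toFun := fun n ↦ funRes chart_inf.le (coordPow n.toAdd)
      map_one' := by simp [coordPow]
      map_mul' := fun m n ↦ by simp [coordPow, zpow_add] }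
  have h : φ = atlasP1.coordHom := by
    apply MonoidHom.ext_mint
    change funRes chart_inf.le (coordPow 1) = atlasP1.coord 1
    rw [Atlas.coord_one, coordPow, zpow_one, ← funRes_chartPoly_one, funRes_funRes]
  exact congr($h (Multiplicative.ofAdd n))

/-- The line bundle `𝒪(n)` has the transition function `T ^ n`. -/
lemma exists_O_frame_atlas (n : ℤ) : ∃ e : ∀ i, Γ(O n, atlasP1.U i),
    (∀ i, IsFrame (O n) (atlasP1.U i) fun _ : Fin 1 ↦ e i) ∧
    secRes (O n) inf_le_left (e 0) = atlasP1.coord n • secRes (O n) inf_le_right (e 1) := by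
  obtain ⟨e, he, he'⟩ := exists_O_frame n
  refine ⟨e, he, ?_⟩
  have := congrArg (secRes (O n) chart_inf.le) he'
  rw [secRes_smul, funRes_coordPow, secRes_secRes, secRes_secRes] at this
  exact this

lemma not_isZero_O (n : ℤ) : ¬ IsZero (O n) := by
  obtain ⟨e, he, -⟩ := exists_O_frame_atlas n
  have : Nonempty (atlasP1.U 0) := nonempty_chart 0
  exact (he 0).not_isZero

end Splitting

/-! ### The case of the empty subscheme -/

section EmptySubscheme
variable {E : P1.Modules} {a b : ℤ} {Z : Scheme.{0}} {i : Z ⟶ P1}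

namespace ExtData
lemma α_trans_atlas (D : ExtData E a b i) : secRes E inf_le_left (D.α 0) =
    atlasP1.coord a • secRes E (inf_le_right : atlasP1.U 0 ⊓ atlasP1.U 1 ≤ _) (D.α 1) := by
  have := congrArg (secRes E chart_inf.le) D.α_trans
  rw [secRes_smul, funRes_coordPow, secRes_secRes, secRes_secRes] at this
  exact this

lemma β_trans_atlas (D : ExtData E a b i) (x : Γ(E, atlasP1.U 0 ⊓ atlasP1.U 1)) :
    (D.β 1).val inf_le_right x =
      atlasP1.coord b * (D.β 0).val (inf_le_left : atlasP1.U 0 ⊓ atlasP1.U 1 ≤ atlasP1.U 0) x := by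
  rw [← funRes_coordPow]
  exact D.β_trans _ chart_inf.le x

/-- A section `f` with `β f = 1` splits the extension on a chart. -/
lemma isFrame_of_β_eq_one (D : ExtData E a b i) (j : Fin 2) {f : Γ(E, chart j)}
    (hf : (D.β j).val le_rfl f = 1) : IsFrame E (chart j) ![D.α j, f] := by
  intro V hV
  have hα : (D.β j).val hV (secRes E hV (D.α j)) = 0 := by
    rw [LocalHom.val_secRes (h := le_rfl), D.β_α, map_zero]
  have hf' : (D.β j).val hV (secRes E hV f) = 1 := by
    rw [LocalHom.val_secRes (h := le_rfl), hf, map_one]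
  have hβ (c : Fin 2 → Γ(P1, V)) : (D.β j).val hV
      (∑ l, c l • secRes E hV (![D.α j, f] l)) = c 1 := by
    simp [LocalHom.val_add, LocalHom.val_smul, hα, hf']
  constructor
  · intro c c' hcc
    have h1 : c 1 = c' 1 := by
      have := congrArg ((D.β j).val hV) hcc
      rwa [hβ, hβ] at this
    simp only [Fin.sum_univ_two, Matrix.cons_val_zero, Matrix.cons_val_one, h1,
      add_left_inj] at hcc
    have h0 := D.smul_α_inj j V hV (c 0 - c' 0) (by rw [sub_smul, hcc, sub_self])
    ext l
    fin_cases l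
    exacts [sub_eq_zero.mp h0, h1]
  · intro z
    obtain ⟨r, hr⟩ := D.exists_smul_α j V hV (z - (D.β j).val hV z • secRes E hV f) (by
      rw [sub_eq_add_neg, ← neg_smul, LocalHom.val_add, LocalHom.val_smul, hf']
      ring)
    refine ⟨![r, (D.β j).val hV z], ?_⟩
    simp only [Fin.sum_univ_two, Matrix.cons_val_zero, Matrix.cons_val_one]
    rw [← hr, sub_add_cancel]

/-- If `Z` is empty, then `ℐ_Z(b) = 𝒪(b)` and the extension splits. -/
lemma nonempty_iso_of_isEmpty (D : ExtData E a b i) (hE : IsLocallyFreeOfRank 2 E) (hab : b ≤ a)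
    [IsEmpty Z] : Nonempty (E ≅ O a ⊞ O b) := by
  have h (j : Fin 2) : ∃ f, (D.β j).val le_rfl f = 1 := by
    refine D.exists_β_eq hE j 1 ?_
    have : i ⁻¹ᵁ chart j = ⊥ := by
      ext z; exact isEmptyElim z
    have : Subsingleton Γ(Z, i ⁻¹ᵁ chart j) := by rw [this]; infer_instance
    exact Subsingleton.elim _ _
  choose f hf using h
  have h1 : (D.β 1).val inf_le_right (secRes E (inf_le_left : atlasP1.U 0 ⊓ atlasP1.U 1 ≤ _) (f 0) -
      atlasP1.coord b • secRes E (inf_le_right : atlasP1.U 0 ⊓ atlasP1.U 1 ≤ _) (f 1)) = 0 := by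
    rw [sub_eq_add_neg, ← neg_smul, LocalHom.val_add, LocalHom.val_smul, D.β_trans_atlas,
      LocalHom.val_secRes (h := le_rfl), hf, LocalHom.val_secRes (h := le_rfl), hf]
    simp
  obtain ⟨r, hr⟩ := D.exists_smul_α 1 _ inf_le_right _ h1
  obtain ⟨e, he, he'⟩ := exists_O_frame_atlas a
  obtain ⟨e₂, he₂, he₂'⟩ := exists_O_frame_atlas b
  exact atlasP1.nonempty_iso_biprod (g := D.α) (f := f) (fun j ↦ D.isFrame_of_β_eq_one j (hf j))
    (by omega) D.α_trans_atlas r (by rw [← hr]; abel) he he₂ he' he₂'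

end ExtData
end EmptySubscheme

/-! ### Pullback of frames to a fibre -/

section Pullback
variable {X Y : Scheme.{0}} {M : X.Modules} {U : X.Opens} (f : Y ⟶ X) {ι : Type}
  [Fintype ι] {r : ℕ}

lemma HasFrames.pullback (h : HasFrames r M U) :
    HasFrames r ((Scheme.Modules.pullback f).obj M) (f ⁻¹ᵁ U) := by
  intro y hy
  obtain ⟨W, hW, e, he⟩ := h (f y) hy
  exact ⟨f ⁻¹ᵁ W, hW, _, he.pullback f⟩

/-- If `M|_U` has a dual basis, then pulled back sections span the sections of the pullback. -/
lemma DualBasis.span_range_pbSec (d : DualBasis M U ι) :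
    Submodule.span Γ(Y, f ⁻¹ᵁ U) (Set.range (pbSec f M U)) = ⊤ := by
  obtain ⟨e, he, -⟩ := d.exists_pullback f
  rw [eq_top_iff, ← e.span_eq_top]
  refine Submodule.span_mono ?_
  rintro _ ⟨j, rfl⟩
  exact ⟨_, (he j).symm⟩

/-- Over a principal ideal domain, projective modules are free. -/
lemma DualBasis.exists_frame [IsIntegral X] [Nonempty U] [IsPrincipalIdealRing Γ(X, U)]
    (d : DualBasis M U ι) (hM : HasFrames r M U) : ∃ e : Fin r → Γ(M, U), IsFrame M U e := by
  classical
  have := d.finite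
  have := d.projective
  have : Module.Free Γ(X, U) Γ(M, U) := Module.free_of_finite_type_torsion_free'
  have hb := d.isFrame_basis (Module.Free.chooseBasis Γ(X, U) Γ(M, U))
  obtain ⟨⟨x, hx⟩⟩ := ‹Nonempty U›
  obtain ⟨W, hxW, e, he⟩ := hM x hx
  have : Nonempty (U ⊓ W : X.Opens) := ⟨⟨x, hx, hxW⟩⟩
  have hcard := (hb.restrict (inf_le_left : U ⊓ W ≤ U)).card_eq
    (he.restrict (inf_le_right : U ⊓ W ≤ W))
  let b := (Module.Free.chooseBasis Γ(X, U) Γ(M, U)).reindex (Fintype.equivOfCardEq hcard)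
  exact ⟨b, d.isFrame_basis b⟩

end Pullback

section VanishingLocus
variable {X : Scheme.{0}} {U : X.Opens}

/-- The functions on `U` that vanish at the point `x`. -/
def vanishingIdealAt {x : X} (hx : x ∈ U) : Ideal Γ(X, U) :=
  (IsLocalRing.maximalIdeal (X.presheaf.stalk x)).comap (X.presheaf.germ U x hx).hom

lemma mem_vanishingIdealAt {x : X} (hx : x ∈ U) (r : Γ(X, U)) :
    r ∈ vanishingIdealAt hx ↔ x ∉ X.basicOpen r := by
  rw [Scheme.mem_basicOpen _ _ _ hx]
  exact (IsLocalRing.mem_maximalIdeal _)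

/-- A function on an affine open set without zeros is a unit. -/
lemma isUnit_of_le_basicOpen (hU : IsAffineOpen U) {r : Γ(X, U)} (h : U ≤ X.basicOpen r) :
    IsUnit r := by
  rw [← Ideal.span_singleton_eq_top, ← hU.iSup_basicOpen_eq_self_iff]
  refine le_antisymm (iSup_le fun s ↦ X.basicOpen_le _) (h.trans ?_)
  exact le_iSup (fun s : ({r} : Set Γ(X, U)) ↦ X.basicOpen s.1) ⟨r, rfl⟩

end VanishingLocus

section Fibre
variable {E : P1.Modules} {a b : ℤ} {Z : Scheme.{0}} {i : Z ⟶ P1} (p : SpecZ)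

lemma isPullback_fiber : IsPullback (structMap.fiberι p) (structMap.fiberToSpecResidueField p)
    structMap (SpecZ.fromSpecResidueField p) := IsPullback.of_hasPullback _ _

/-- The standard atlas of a fibre of the projective line. -/
abbrev fiberAtlas : Atlas (SpecZ.residueField p) (structMap.fiber p) :=
  atlasP1.baseChange (isPullback_fiber p)

instance : IsIntegral (structMap.fiber p) := (fiberAtlas p).isIntegral

instance nonempty_preimage_chart (j : Fin 2) : Nonempty (structMap.fiberι p ⁻¹ᵁ chart j) := by
  obtain ⟨x, h0, h1⟩ := (fiberAtlas p).nonempty_inf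
  fin_cases j
  exacts [⟨⟨x, h0⟩⟩, ⟨⟨x, h1⟩⟩]

instance (j : Fin 2) : IsPrincipalIdealRing Γ(structMap.fiber p, structMap.fiberι p ⁻¹ᵁ chart j) :=
  IsPrincipalIdealRing.of_surjective _ ((fiberAtlas p).poly j).surjective

/-- A subscheme of codimension two contains no fibre: its ideal does not vanish on `X_p`. The
functions that vanish on `X_p` form a principal prime ideal, generated by the residue
characteristic `c`. -/
lemma IsLCIOfCodim.exists_funPb_fiberι_ne_zero [IsClosedImmersion i] (hZ : IsLCIOfCodim 2 i)
    (j : Fin 2) : ∃ r, funPb i (chart j) r = 0 ∧ funPb (structMap.fiberι p) (chart j) r ≠ 0 := by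
  by_contra! h
  have h' (q : Polynomial ℤ) (hq : funPb i (chart j) (chartPoly j q) = 0) :
      q.map (Int.castRingHom (SpecZ.residueField p)) = 0 := by
    have h1 := h _ hq
    have h2 := atlasP1.baseChange_poly_map (isPullback_fiber p) j q
    have h3 : ((fiberAtlas p).poly j) (q.map (Int.castRingHom (SpecZ.residueField p))) = 0 :=
      h2.trans h1
    exact (map_eq_zero_iff _ ((fiberAtlas p).poly j).injective).mp h3
  obtain ⟨c, hc⟩ := IsPrincipalIdealRing.principal
    (RingHom.ker (Int.castRingHom (SpecZ.residueField p)))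
  rw [Ideal.submodule_span_eq] at hc
  by_cases hc0 : c = 0
  · obtain ⟨π, hπ⟩ := exists_prime_chart j
    obtain ⟨r, hr, hd⟩ := hZ.exists_not_dvd (isAffineOpen_chart j) hπ
    obtain ⟨q, rfl⟩ := (chartPoly j).surjective r
    have hinj : Function.Injective (Int.castRingHom (SpecZ.residueField p)) := by
      rw [RingHom.injective_iff_ker_eq_bot, hc, hc0, Ideal.span_singleton_eq_bot]
    have : q = 0 := (Polynomial.map_eq_zero_iff hinj).mp (h' q hr)
    exact hd (by rw [this, map_zero]; exact dvd_zero _)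
  · have hcp : Prime c := by
      rw [← Ideal.span_singleton_prime hc0, ← hc]
      exact RingHom.ker_isPrime _
    have hπ : Prime (chartPoly j (Polynomial.C c)) :=
      (MulEquiv.prime_iff (chartPoly j)).mpr (Polynomial.prime_C_iff.mpr hcp)
    obtain ⟨r, hr, hd⟩ := hZ.exists_not_dvd (isAffineOpen_chart j) hπ
    obtain ⟨q, rfl⟩ := (chartPoly j).surjective r
    refine hd (map_dvd (chartPoly j) ((Polynomial.C_dvd_iff_dvd_coeff _ _).mpr fun m ↦ ?_))
    rw [← Ideal.mem_span_singleton, ← hc, RingHom.mem_ker]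
    have := congrArg (fun q ↦ q.coeff m) (h' q hr)
    simpa using this

/-- On a chart of the fibre, `E` has a frame `g`, `f` in which the extension has the form
`α = h g`, `β g = 0`, `β f = h`, where `h` is an equation of `Z ∩ X_p`. All that matters about the
fibre is that the functions on its charts form principal ideal domains and that the ideal of `Z`
does not vanish there. -/
lemma ExtData.exists_pullback_frame (D : ExtData E a b i) (hE : IsLocallyFreeOfRank 2 E)
    [IsClosedImmersion i] (hZ : IsLCIOfCodim 2 i) {Y : Scheme.{0}} [IsIntegral Y] (ι : Y ⟶ P1)
    (j : Fin 2) [Nonempty (ι ⁻¹ᵁ chart j)] [IsPrincipalIdealRing Γ(Y, ι ⁻¹ᵁ chart j)]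
    (hne : ∃ r, funPb i (chart j) r = 0 ∧ funPb ι (chart j) r ≠ 0)
    (β' : LocalHom (ι ⁻¹ᵁ chart j) ((Scheme.Modules.pullback ι).obj E) (structureSheaf _))
    (hβ' : ∀ V (h : V ≤ chart j) (x : Γ(E, V)), β'.val (ι.preimage_mono h) (pbSec ι E V x) =
      funPb ι V ((D.β j).val h x)) :
    ∃ (g f : Γ((Scheme.Modules.pullback ι).obj E, ι ⁻¹ᵁ chart j)) (h : Γ(Y, ι ⁻¹ᵁ chart j)),
      IsFrame _ _ ![g, f] ∧ β'.val le_rfl g = 0 ∧ β'.val le_rfl f = h ∧ h ≠ 0 ∧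
      pbSec ι E (chart j) (D.α j) = h • g ∧
      ∀ y ∈ ι ⁻¹ᵁ chart j, y ∈ Y.basicOpen h ↔ ι y ∉ Set.range i := by
  obtain ⟨κ, _, ⟨d⟩⟩ := exists_dualBasis (isAffineOpen_chart j) (hE.hasFrames (chart j))
  obtain ⟨d', -⟩ := d.exists_pullback ι
  have hspan := d.span_range_pbSec ι
  obtain ⟨e, he⟩ := d'.exists_frame ((hE.hasFrames (chart j)).pullback ι)
  have hβlin (z) : β'.val le_rfl z = β'.valLin le_rfl z := rfl
  have hβ0 (x : Γ(E, chart j)) : β'.valLin le_rfl (pbSec ι E _ x) =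
      funPb ι (chart j) ((D.β j).val le_rfl x) := hβ' _ le_rfl x
  simp only [hβlin]
  -- a generator `h` of the image of `β'`
  obtain ⟨h, hh⟩ := IsPrincipalIdealRing.principal
    (Ideal.span {β'.valLin le_rfl (e 0), β'.valLin le_rfl (e 1)})
  rw [Ideal.submodule_span_eq] at hh
  obtain ⟨s, hs⟩ : h ∣ β'.valLin le_rfl (e 0) := by
    rw [← Ideal.mem_span_singleton, ← hh]; exact Ideal.subset_span (by simp)
  obtain ⟨t, ht⟩ : h ∣ β'.valLin le_rfl (e 1) := by
    rw [← Ideal.mem_span_singleton, ← hh]; exact Ideal.subset_span (by simp)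
  obtain ⟨u, v, huv⟩ : ∃ u v, u * β'.valLin le_rfl (e 0) + v * β'.valLin le_rfl (e 1) = h := by
    rw [← Ideal.mem_span_pair, hh]; exact Ideal.mem_span_singleton_self h
  have he2 : IsFrame _ _ ![e 0, e 1] := by
    convert he using 1
    ext l; fin_cases l <;> rfl
  have hcoord (z) : ∃ c c' : Γ(Y, ι ⁻¹ᵁ chart j), z = c • e 0 + c' • e 1 := by
    obtain ⟨c, hc⟩ := (he _ le_rfl).2 z
    exact ⟨c 0, c 1, by rw [← hc]; simp⟩
  have hdvd (z) : h ∣ β'.valLin le_rfl z := by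
    obtain ⟨c, c', rfl⟩ := hcoord z
    rw [map_add, map_smul, map_smul, hs, ht]
    exact ⟨c * s + c' * t, by simp only [smul_eq_mul]; ring⟩
  have hh0 : h ≠ 0 := by
    rintro rfl
    obtain ⟨r, hr, hne⟩ := hne
    obtain ⟨x, rfl⟩ := D.exists_β_eq hE j r hr
    refine hne ?_
    rw [← hβ0]
    exact zero_dvd_iff.mp (hdvd _)
  have hst : u * s + v * t = 1 := by
    apply mul_left_cancel₀ hh0
    rw [mul_one]
    conv_rhs => rw [← huv, hs, ht]
    ring
  have hgf := he2.of_det (p := t) (q := -s) (r := u) (s := v) (d := 1) (by linear_combination hst)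
  set g := t • e 0 + (-s) • e 1 with hg
  set f := u • e 0 + v • e 1 with hf
  have hβg : β'.valLin le_rfl g = 0 := by
    rw [hg, map_add, map_smul, map_smul, hs, ht]; simp only [smul_eq_mul]; ring
  have hβf : β'.valLin le_rfl f = h := by
    rw [hf, map_add, map_smul, map_smul]; exact huv
  have hgf' (z) : ∃ c c' : Γ(Y, ι ⁻¹ᵁ chart j), z = c • g + c' • f := by
    obtain ⟨c, hc⟩ := (hgf _ le_rfl).2 z
    exact ⟨c 0, c 1, by rw [← hc]; simp⟩
  have hginj {c c' : Γ(Y, ι ⁻¹ᵁ chart j)} (hc : c • g = c' • g) : c = c' := by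
    exact hgf.ext le_rfl (a := ![c, 0]) (b := ![c', 0]) (by simpa using hc) 0
  -- `α` is a multiple of `g`
  obtain ⟨x, hx⟩ : ∃ x, pbSec ι E (chart j) (D.α j) = x • g := by
    obtain ⟨x, y, hxy⟩ := hgf' (pbSec ι E (chart j) (D.α j))
    have h1 := hβ0 (D.α j)
    rw [D.β_α, map_zero, hxy, map_add, map_smul, map_smul, hβg, hβf, smul_zero, zero_add,
      smul_eq_mul] at h1
    refine ⟨x, ?_⟩
    rw [hxy, (mul_eq_zero.mp h1).resolve_right hh0, zero_smul, add_zero]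
  -- the factors `w` generate the unit ideal, and `w x` is divisible by `h`
  have hhx : h ∣ x := by
    have h1 : (⊤ : Ideal Γ(P1, chart j)) ≤ Ideal.comap (funPb ι (chart j))
        (Submodule.comap (LinearMap.mulRight _ x) (Ideal.span {h})) := by
      rw [← D.span_factors hE hZ j, Ideal.span_le]
      rintro w ⟨y, y', hw⟩
      obtain ⟨y₁, y₂, hy⟩ := hgf' (pbSec ι E _ y)
      obtain ⟨y₁', y₂', hy'⟩ := hgf' (pbSec ι E _ y')
      change funPb ι (chart j) w * x ∈ Ideal.span {h}
      rw [Ideal.mem_span_singleton]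
      refine ⟨y₂ * y₁' - y₂' * y₁, ?_⟩
      have h2 := congrArg (pbSec ι E (chart j)) hw
      rw [map_sub, pbSec_smul, pbSec_smul, pbSec_smul, hx, ← hβ0, ← hβ0, hy, hy'] at h2
      simp only [map_add, map_smul, hβg, hβf, smul_eq_mul] at h2
      apply hginj
      rw [mul_smul, ← h2]
      module
    have h2 := h1 (show (1 : Γ(P1, chart j)) ∈ ⊤ from trivial)
    have h3 : funPb ι (chart j) 1 * x ∈ Ideal.span {h} := h2
    rwa [map_one, one_mul, Ideal.mem_span_singleton] at h3
  -- `h g = β' f • g - β' g • f` is a multiple of `α = x g`; for pulled back sections in place of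
  -- `f` and `g` this holds because the kernel of `β` is generated by `α`
  have hxh : x ∣ h := by
    have key (z z') : β'.valLin le_rfl z • z' - β'.valLin le_rfl z' • z ∈
        Submodule.span Γ(Y, ι ⁻¹ᵁ chart j) {pbSec ι E (chart j) (D.α j)} := by
      have hz : z ∈ Submodule.span Γ(Y, ι ⁻¹ᵁ chart j) (Set.range (pbSec ι E (chart j))) :=
        hspan ▸ trivial
      have hz' : z' ∈ Submodule.span Γ(Y, ι ⁻¹ᵁ chart j) (Set.range (pbSec ι E (chart j))) :=
        hspan ▸ trivial
      induction hz, hz' using Submodule.span_induction₂ with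
      | mem_mem z z' hz hz' =>
        obtain ⟨y, rfl⟩ := hz
        obtain ⟨y', rfl⟩ := hz'
        obtain ⟨w, hw⟩ := D.exists_smul_α j _ le_rfl
          ((D.β j).val le_rfl y • y' - (D.β j).val le_rfl y' • y) (by
            rw [sub_eq_add_neg, ← neg_smul, LocalHom.val_add, LocalHom.val_smul,
              LocalHom.val_smul]
            ring)
        rw [secRes_self] at hw
        rw [hβ0, hβ0, ← pbSec_smul, ← pbSec_smul, ← map_sub, hw, pbSec_smul]
        exact Submodule.smul_mem _ _ (Submodule.mem_span_singleton_self _)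
      | zero_left =>
        rw [map_zero, zero_smul, smul_zero, sub_zero]; exact zero_mem _
      | zero_right =>
        rw [map_zero, zero_smul, smul_zero, sub_zero]; exact zero_mem _
      | add_left z w z' _ _ _ h1 h2 =>
        convert add_mem h1 h2 using 1
        rw [map_add]; module
      | add_right z w z' _ _ _ h1 h2 =>
        convert add_mem h1 h2 using 1
        rw [map_add]; module
      | smul_left c z z' _ _ h1 =>
        convert Submodule.smul_mem _ c h1 using 1
        rw [map_smul, smul_eq_mul]; module
      | smul_right c z z' _ _ h1 =>
        convert Submodule.smul_mem _ c h1 using 1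
        rw [map_smul, smul_eq_mul]; module
    have h1 := key f g
    rw [hβg, hβf, zero_smul, sub_zero, hx, Submodule.mem_span_singleton] at h1
    obtain ⟨c, hc⟩ := h1
    rw [smul_smul] at hc
    exact ⟨c, by rw [← hginj hc, mul_comm]⟩
  obtain ⟨ε, hε⟩ := associated_of_dvd_dvd hhx hxh
  refine ⟨(ε : Γ(Y, ι ⁻¹ᵁ chart j)) • g, f, h, ?_, ?_, hβf, hh0, ?_, fun y hy ↦ ?_⟩
  · have := hgf.of_det (p := ε) (q := 0) (r := 0) (s := 1) (d := (ε⁻¹ : Units _)) (by simp)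
    simpa using this
  · rw [map_smul, hβg, smul_zero]
  · rw [hx, smul_smul, hε]
  · rw [← not_iff_not, ← mem_vanishingIdealAt hy, not_not,
      mem_range_iff_forall_notMem_basicOpen (isAffineOpen_chart j) hy]
    constructor
    · intro hy' r hr hry
      obtain ⟨w, rfl⟩ := D.exists_β_eq hE j r hr
      have h1 : β'.valLin le_rfl (pbSec ι E _ w) ∈ vanishingIdealAt hy :=
        Ideal.mem_of_dvd _ (hdvd _) hy'
      rw [hβ0, mem_vanishingIdealAt] at h1
      refine h1 ?_
      have h2 : y ∈ ι ⁻¹ᵁ P1.basicOpen ((D.β j).val le_rfl w) := hry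
      rwa [Scheme.preimage_basicOpen] at h2
    · intro hy'
      rw [← hβf]
      have h1 : (⊤ : Submodule Γ(Y, ι ⁻¹ᵁ chart j) _) ≤
          Submodule.comap (β'.valLin le_rfl) (vanishingIdealAt hy) := by
        rw [← hspan, Submodule.span_le]
        rintro _ ⟨w, rfl⟩
        change β'.valLin le_rfl (pbSec ι E _ w) ∈ vanishingIdealAt hy
        rw [hβ0, mem_vanishingIdealAt]
        intro h2
        refine hy' _ (D.funPb_β j _ le_rfl w) ?_
        have h3 : y ∈ ι ⁻¹ᵁ P1.basicOpen ((D.β j).val le_rfl w) := by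
          rw [Scheme.preimage_basicOpen]; exact h2
        exact h3
      exact h1 (show f ∈ ⊤ from trivial)

end Fibre

/-! ### Transition functions and degrees -/

section Gluing
open LaurentPolynomial
variable {k : Type} {X : Scheme.{0}} {M : X.Modules}

instance [CommRing k] [IsDomain k] (A : Atlas k X) : Nonempty (A.U 0 ⊓ A.U 1 : X.Opens) :=
  A.nonempty_inf

lemma Atlas.funRes_poly_C_one [CommRing k] (A : Atlas k X) (c : k) :
    funRes inf_le_right (A.poly 1 (Polynomial.C c)) = A.laurent (LaurentPolynomial.C c) := by
  rw [← A.laurent_toLaurent, Polynomial.toLaurent_C]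

lemma Atlas.funRes_poly_C_zero [CommRing k] (A : Atlas k X) (c : k) :
    funRes inf_le_left (A.poly 0 (Polynomial.C c)) = A.laurent (LaurentPolynomial.C c) := by
  rw [A.poly_C, A.funRes_poly_C_one]

/-- A nonzero section of `𝒪(-m)`, `m ≥ 0`, given by `x₀` and `x₁` on the charts, is constant, and
`m = 0`. The factor `c` allows for a constant in the transition function. -/
lemma Atlas.exists_eq_poly_C [CommRing k] [IsDomain k] (A : Atlas k X) {x₀ : Γ(X, A.U 0)}
    {x₁ : Γ(X, A.U 1)} {c : k} {m : ℤ} (hc : c ≠ 0) (hx : x₁ ≠ 0) (hm : 0 ≤ m)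
    (h : funRes inf_le_left x₀ =
      A.laurent (LaurentPolynomial.C c) * A.coord m * funRes inf_le_right x₁) :
    m = 0 ∧ ∃ d, x₁ = A.poly 1 (Polynomial.C d) ∧ x₀ = A.poly 0 (Polynomial.C (c * d)) := by
  obtain ⟨p, rfl⟩ := (A.poly 1).surjective x₁
  obtain ⟨q, rfl⟩ := (A.poly 0).surjective x₀
  rw [← A.laurent_toLaurent, ← A.laurent_invert, coord, ← map_mul, ← map_mul] at h
  obtain ⟨rfl, d, rfl, rfl⟩ := exists_eq_C_of_invert_toLaurent_eq hc
    (fun h0 ↦ hx (by rw [h0, map_zero])) hm (A.laurent.injective h)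
  exact ⟨rfl, d, rfl, rfl⟩

/-- Units on the intersection of the charts are monomials. -/
lemma Atlas.exists_eq_laurent_C_mul_coord [CommRing k] [IsDomain k] (A : Atlas k X)
    {y : Γ(X, A.U 0 ⊓ A.U 1)} (hy : IsUnit y) :
    ∃ (c : k) (m : ℤ), IsUnit c ∧ y = A.laurent (LaurentPolynomial.C c) * A.coord m := by
  obtain ⟨y, rfl⟩ := A.laurent.surjective y
  have hy' : IsUnit y := by simpa using hy.map A.laurent.symm
  obtain ⟨c, m, hc, rfl⟩ := exists_eq_C_mul_T_of_isUnit hy'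
  exact ⟨c, m, hc, by rw [map_mul]; rfl⟩

/-- Units on a chart are constants. -/
lemma Atlas.exists_eq_poly_C_of_isUnit [CommRing k] [IsDomain k] (A : Atlas k X) {j : Fin 2}
    {x : Γ(X, A.U j)} (hx : IsUnit x) : ∃ c, IsUnit c ∧ x = A.poly j (Polynomial.C c) := by
  obtain ⟨p, rfl⟩ := (A.poly j).surjective x
  have hpu : IsUnit p := by simpa using hx.map (A.poly j).symm
  obtain ⟨c, hc, rfl⟩ := Polynomial.isUnit_iff.mp hpu
  exact ⟨c, hc, rfl⟩

variable [Field k] (A : Atlas k X)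

/-- If equations `h 0`, `h 1` on the charts differ by a unit on the overlap, they are, up to a
constant, an equation of degree `n ≥ 0`; and `n = 0` exactly if they are units. -/
lemma Atlas.exists_degree (h : ∀ j, Γ(X, A.U j)) (hh : ∀ j, h j ≠ 0) {y : Γ(X, A.U 0 ⊓ A.U 1)}
    (hy : IsUnit y) (b : ℤ)
    (hyh : A.coord b * funRes inf_le_left (h 0) = y * funRes inf_le_right (h 1)) :
    ∃ (c : k) (n : ℕ), c ≠ 0 ∧ y = A.laurent (LaurentPolynomial.C c) * A.coord (b - n) ∧
      (n = 0 ↔ ∀ j, IsUnit (h j)) := by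
  obtain ⟨c, m, hc, rfl⟩ := A.exists_eq_laurent_C_mul_coord hy
  have hc0 : c ≠ 0 := hc.ne_zero
  have e : funRes inf_le_left (h 0) =
      A.laurent (LaurentPolynomial.C c) * A.coord (m - b) * funRes inf_le_right (h 1) := by
    rw [sub_eq_add_neg, A.coord_add]
    linear_combination A.coord (-b) * hyh - funRes inf_le_left (h 0) * A.coord_mul_neg b
  have hn : 0 ≤ b - m := by
    by_contra! hlt
    have := (A.exists_eq_poly_C hc0 (hh 1) (by omega) e).1
    omega
  obtain ⟨n, hn⟩ := Int.eq_ofNat_of_zero_le hn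
  refine ⟨c, n, hc0, by congr 2; omega, ?_, fun hu ↦ ?_⟩
  · rintro rfl
    obtain ⟨-, d, h1, h0⟩ := A.exists_eq_poly_C hc0 (hh 1) (by push_cast at hn; omega) e
    have hd : d ≠ 0 := fun hd ↦ hh 1 (by rw [h1, hd, map_zero, map_zero])
    intro j
    fin_cases j
    · exact h0 ▸ ((mul_ne_zero hc0 hd).isUnit.map Polynomial.C).map (A.poly 0)
    · exact h1 ▸ (hd.isUnit.map Polynomial.C).map (A.poly 1)
  · obtain ⟨p, hp, h1⟩ := A.exists_eq_poly_C_of_isUnit (hu 1)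
    obtain ⟨q, hq, h0⟩ := A.exists_eq_poly_C_of_isUnit (hu 0)
    rw [h0, h1, A.funRes_poly_C_zero, A.funRes_poly_C_one] at e
    have := (A.exists_eq_poly_C (x₀ := A.poly 0 (Polynomial.C (c * p))) (x₁ := 1) hq.ne_zero
      (fun h' ↦ hh 1 (by rw [← mul_one (h 1), h', mul_zero])) (m := b - m) (by omega) (by
        have e2 := A.coord_mul_neg (b - m)
        rw [neg_sub] at e2
        rw [A.funRes_poly_C_zero, e, map_mul, map_mul, map_one]
        linear_combination -(A.laurent (LaurentPolynomial.C c) *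
          A.laurent (LaurentPolynomial.C p)) * e2)).1
    omega

/-- Suppose that on both charts an extension `α`, `β` has the form `α = h g`, `β g = 0`, `β f = h`
for a frame `g`, `f`, and that `α` and `β` have the transition functions `T ^ a` and `T ^ b`. Then
`h`, normalised by a constant, is an equation of degree `n ≥ 0`, and `g` and `f` have a triangular
transition matrix with diagonal entries `T ^ (a + n)` and `T ^ (b - n)`. -/
lemma Atlas.exists_normal_form [IsIntegral X] {g f : ∀ j, Γ(M, A.U j)} {h : ∀ j, Γ(X, A.U j)}
    (hgf : ∀ j, IsFrame M (A.U j) ![g j, f j]) (β : ∀ j, LocalHom (A.U j) M (structureSheaf X))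
    (hβg : ∀ j, (β j).val le_rfl (g j) = 0) (hβf : ∀ j, (β j).val le_rfl (f j) = h j)
    (hh : ∀ j, h j ≠ 0) {a b : ℤ}
    (hα : secRes M inf_le_left (h 0 • g 0) = A.coord a • secRes M inf_le_right (h 1 • g 1))
    (hβ : ∀ x : Γ(M, A.U 0 ⊓ A.U 1),
      (β 1).val inf_le_right x = A.coord b * (β 0).val inf_le_left x) :
    ∃ (g' f' : ∀ j, Γ(M, A.U j)) (h' : ∀ j, Γ(X, A.U j)) (n : ℕ),
      (∀ j, IsFrame M (A.U j) ![g' j, f' j]) ∧ (∀ j, (β j).val le_rfl (g' j) = 0) ∧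
      (∀ j, (β j).val le_rfl (f' j) = h' j) ∧ (∀ j, h' j ≠ 0) ∧ (n = 0 ↔ ∀ j, IsUnit (h j)) ∧
      funRes inf_le_left (h' 0) = A.coord (-n) * funRes inf_le_right (h' 1) ∧
      secRes M inf_le_left (g' 0) = A.coord (a + n) • secRes M inf_le_right (g' 1) ∧
      ∃ r : Γ(X, A.U 0 ⊓ A.U 1), secRes M inf_le_left (f' 0) =
        A.coord (b - n) • secRes M inf_le_right (f' 1) + r • secRes M inf_le_right (g' 1) := by
  have hinj (j) (hj : A.U 0 ⊓ A.U 1 ≤ A.U j) : funRes hj (h j) ≠ 0 := fun h0 ↦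
    hh j (funRes_injective hj (h0.trans (map_zero _).symm))
  have hβg' (j) (hj : A.U 0 ⊓ A.U 1 ≤ A.U j) : (β j).val hj (secRes M hj (g j)) = 0 := by
    rw [LocalHom.val_secRes (h := le_rfl), hβg, map_zero]
  have hβf' (j) (hj : A.U 0 ⊓ A.U 1 ≤ A.U j) :
      (β j).val hj (secRes M hj (f j)) = funRes hj (h j) := by
    rw [LocalHom.val_secRes (h := le_rfl), hβf]
  obtain ⟨x, hx⟩ := (hgf 1 _ inf_le_right).2 (secRes M inf_le_left (g 0))
  obtain ⟨y, hy⟩ := (hgf 1 _ inf_le_right).2 (secRes M inf_le_left (f 0))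
  obtain ⟨z, hz⟩ := (hgf 0 _ inf_le_left).2 (secRes M inf_le_right (f 1))
  simp only [Fin.sum_univ_two, Matrix.cons_val_zero, Matrix.cons_val_one] at hx hy hz
  have hx1 : x 1 = 0 := by
    have h1 := hβ (secRes M inf_le_left (g 0))
    rw [hβg' 0 inf_le_left, mul_zero, ← hx, LocalHom.val_add, LocalHom.val_smul, LocalHom.val_smul,
      hβg' 1 inf_le_right, hβf' 1 inf_le_right, mul_zero, zero_add] at h1
    exact (mul_eq_zero.mp h1).resolve_right (hinj 1 inf_le_right)
  rw [hx1, zero_smul, add_zero] at hx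
  have hy1 : A.coord b * funRes inf_le_left (h 0) = y 1 * funRes inf_le_right (h 1) := by
    have h1 := hβ (secRes M inf_le_left (f 0))
    rw [hβf' 0 inf_le_left, ← hy, LocalHom.val_add, LocalHom.val_smul, LocalHom.val_smul,
      hβg' 1 inf_le_right, hβf' 1 inf_le_right, mul_zero, zero_add] at h1
    exact h1.symm
  have hunit : IsUnit (y 1) := by
    refine IsUnit.of_mul_eq_one_right (z 1) ?_
    have h1 := (hgf 1).ext inf_le_right (a := ![z 0 * x 0 + z 1 * y 0, z 1 * y 1]) (b := ![0, 1])
      (by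
        simp only [Fin.sum_univ_two, Matrix.cons_val_zero, Matrix.cons_val_one, zero_smul, zero_add,
          one_smul]
        conv_rhs => rw [← hz, ← hx, ← hy]
        module) 1
    simpa using h1
  obtain ⟨c, n, hc, hyc, hn⟩ := A.exists_degree h hh hunit b hy1
  -- on the second chart, `h` and `f` are scaled by `c`, and `g` by `c⁻¹`
  set C := A.laurent (LaurentPolynomial.C c)
  set D := A.laurent (LaurentPolynomial.C c⁻¹)
  have hCD : C * D = 1 := by rw [← map_mul, ← map_mul, mul_inv_cancel₀ hc, map_one, map_one]
  have hC1 : funRes inf_le_right (A.poly 1 (Polynomial.C c)) = C := A.funRes_poly_C_one c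
  have hD1 : funRes inf_le_right (A.poly 1 (Polynomial.C c⁻¹)) = D := A.funRes_poly_C_one c⁻¹
  have hCD1 : A.poly 1 (Polynomial.C c) * A.poly 1 (Polynomial.C c⁻¹) = 1 := by
    rw [← map_mul, ← map_mul, mul_inv_cancel₀ hc, map_one, map_one]
  have hh01 : funRes inf_le_left (h 0) = A.coord (-n) * (C * funRes inf_le_right (h 1)) := by
    have e1 : A.coord (-n) * A.coord b = A.coord (b - n) := by rw [← A.coord_add]; congr 1; omega
    have e2 := A.coord_mul_neg b
    rw [hyc] at hy1
    linear_combination A.coord (-b) * hy1 - funRes inf_le_left (h 0) * e2 -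
      A.coord (-b) * C * funRes inf_le_right (h 1) * e1 +
      A.coord (-n) * C * funRes inf_le_right (h 1) * e2
  have hx0 : x 0 = D * A.coord (a + n) := by
    have h1 : funRes inf_le_left (h 0) * x 0 = A.coord a * funRes inf_le_right (h 1) := by
      have := (hgf 1).ext inf_le_right (a := ![funRes inf_le_left (h 0) * x 0, 0])
        (b := ![A.coord a * funRes inf_le_right (h 1), 0]) (by
          simp only [Fin.sum_univ_two, Matrix.cons_val_zero, Matrix.cons_val_one, zero_smul,
            add_zero, mul_smul, hx]
          simpa only [secRes_smul] using hα) 0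
      simpa using this
    rw [hh01] at h1
    have e1 : A.coord (a + n) = A.coord a * A.coord n := A.coord_add _ _
    have e2 := A.coord_mul_neg n
    apply mul_right_cancel₀ (hinj 1 inf_le_right)
    rw [e1]
    linear_combination D * A.coord n * h1 - x 0 * funRes inf_le_right (h 1) * (hCD +
      (C * D) * e2)
  let g' : ∀ j, Γ(M, A.U j) := Fin.cons (g 0) (Fin.cons (A.poly 1 (Polynomial.C c⁻¹) • g 1)
    finZeroElim)
  let f' : ∀ j, Γ(M, A.U j) := Fin.cons (f 0) (Fin.cons (A.poly 1 (Polynomial.C c) • f 1)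
    finZeroElim)
  let h' : ∀ j, Γ(X, A.U j) := Fin.cons (h 0) (Fin.cons (A.poly 1 (Polynomial.C c) * h 1)
    finZeroElim)
  refine ⟨g', f', h', n, fun j ↦ ?_, fun j ↦ ?_, fun j ↦ ?_, fun j ↦ ?_, hn, ?_, ?_,
    D * y 0 * C * C, ?_⟩
  · fin_cases j
    · exact hgf 0
    · have := (hgf 1).of_det (p := A.poly 1 (Polynomial.C c⁻¹)) (q := 0) (r := 0)
        (s := A.poly 1 (Polynomial.C c)) (d := 1) (by linear_combination hCD1)
      simp only [zero_smul, add_zero, zero_add] at this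
      exact this
  · fin_cases j
    · exact hβg 0
    · change (β 1).val le_rfl (A.poly 1 (Polynomial.C c⁻¹) • g 1) = 0
      rw [LocalHom.val_smul, hβg, mul_zero]
  · fin_cases j
    · exact hβf 0
    · change (β 1).val le_rfl (A.poly 1 (Polynomial.C c) • f 1) = A.poly 1 (Polynomial.C c) * h 1
      rw [LocalHom.val_smul, hβf]
  · fin_cases j
    · exact hh 0
    · intro h0
      have h1 : A.poly 1 (Polynomial.C c) * h 1 = 0 := h0
      refine hh 1 ?_
      linear_combination A.poly 1 (Polynomial.C c⁻¹) * h1 - h 1 * hCD1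
  · change funRes inf_le_left (h 0) = A.coord (-n) *
      funRes inf_le_right (A.poly 1 (Polynomial.C c) * h 1)
    rw [map_mul, hC1, hh01]
  · change secRes M inf_le_left (g 0) = A.coord (a + n) •
      secRes M inf_le_right (A.poly 1 (Polynomial.C c⁻¹) • g 1)
    rw [secRes_smul, hD1, ← hx, hx0, smul_smul, mul_comm]
  · change secRes M inf_le_left (f 0) = A.coord (b - n) •
      secRes M inf_le_right (A.poly 1 (Polynomial.C c) • f 1) +
      (D * y 0 * C * C) • secRes M inf_le_right (A.poly 1 (Polynomial.C c⁻¹) • g 1)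
    rw [secRes_smul, secRes_smul, hC1, hD1, ← hy, hyc, smul_smul, smul_smul, add_comm]
    congr 2
    · ring
    · linear_combination -(y 0 * (C * D + 1)) * hCD

end Gluing

/-! ### Transition functions on the fibres -/

section Transition
variable (p : SpecZ)

/-- The coordinates of the fibre are the restrictions of those of the projective line. -/
lemma funPb_coord (n : ℤ) : funPb (structMap.fiberι p) (chart 0 ⊓ chart 1) (atlasP1.coord n) =
    (fiberAtlas p).coord n := by
  have h : (funPb (structMap.fiberι p) (chart 0 ⊓ chart 1)).toMonoidHom.comp atlasP1.coordHom =
      (fiberAtlas p).coordHom := by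
    apply MonoidHom.ext_mint
    change funPb (structMap.fiberι p) (chart 0 ⊓ chart 1) (atlasP1.coord 1) =
      (fiberAtlas p).coord 1
    rw [Atlas.coord_one, Atlas.coord_one, funPb_funRes,
      ← atlasP1.baseChange_poly_map (isPullback_fiber p) 1, Polynomial.map_X]
    rfl
  exact congr($h (Multiplicative.ofAdd n))

/-- Restriction to a fibre preserves transition functions. -/
lemma pbSec_transition {M : P1.Modules} {x : Γ(M, chart 0)} {y : Γ(M, chart 1)} {n : ℤ}
    (h : secRes M inf_le_left x = atlasP1.coord n • secRes M inf_le_right y) :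
    secRes _ inf_le_left (pbSec (structMap.fiberι p) M (chart 0) x) =
      (fiberAtlas p).coord n •
        secRes _ inf_le_right (pbSec (structMap.fiberι p) M (chart 1) y) := by
  have := congrArg (pbSec (structMap.fiberι p) M (chart 0 ⊓ chart 1)) h
  rw [pbSec_smul, pbSec_secRes, pbSec_secRes, funPb_coord] at this
  exact this

/-- On a fibre, too, the line bundle `𝒪(n)` has the transition function `T ^ n`. -/
lemma exists_O_frame_fiber (n : ℤ) :
    ∃ e : ∀ j, Γ((Scheme.Modules.pullback (structMap.fiberι p)).obj (O n), (fiberAtlas p).U j),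
    (∀ j, IsFrame _ ((fiberAtlas p).U j) fun _ : Fin 1 ↦ e j) ∧
    secRes _ inf_le_left (e 0) = (fiberAtlas p).coord n • secRes _ inf_le_right (e 1) := by
  obtain ⟨e, he, he'⟩ := exists_O_frame_atlas n
  exact ⟨fun j ↦ pbSec (structMap.fiberι p) (O n) (chart j) (e j),
    fun j ↦ (he j).pullback (structMap.fiberι p), pbSec_transition p he'⟩

end Transition

/-! ### The restriction of the extension to a fibre -/

section Cokernel
variable {X Y Z : Scheme.{0}} (i : Z ⟶ X) (ι : Y ⟶ X)

instance epi_pullback_map_toPushforward [IsClosedImmersion i] :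
    Epi ((Scheme.Modules.pullback ι).map (toPushforward i)) := by
  have := Functor.preservesEpimorphisms_of_adjunction
    (Scheme.Modules.pullbackPushforwardAdjunction ι)
  infer_instance

/-- `ι^* 𝒪_X ⟶ ι^* i_* 𝒪_Z` is a cokernel of every morphism that it annihilates and whose image
contains the pullbacks of all functions that vanish on `Z`. -/
lemma exact_pullback_toPushforward [IsClosedImmersion i] {L : Y.Modules}
    (γ : L ⟶ (Scheme.Modules.pullback ι).obj (structureSheaf X))
    (w : γ ≫ (Scheme.Modules.pullback ι).map (toPushforward i) = 0)
    (h : ∀ {K : Y.Modules} (φ : (Scheme.Modules.pullback ι).obj (structureSheaf X) ⟶ K),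
      γ ≫ φ = 0 → ∀ V (r : Γ(X, V)), funPb i V r = 0 →
        φ.app _ (pbSec ι _ V ((unitEquiv V).symm r)) = 0) :
    (ShortComplex.mk γ ((Scheme.Modules.pullback ι).map (toPushforward i)) w).Exact := by
  let adj := Scheme.Modules.pullbackPushforwardAdjunction ι
  have key {K : Y.Modules} (φ : (Scheme.Modules.pullback ι).obj (structureSheaf X) ⟶ K)
      (hφ : γ ≫ φ = 0) : ∃ l, (Scheme.Modules.pullback ι).map (toPushforward i) ≫ l = φ := by
    have h1 : kernel.ι (toPushforward i) ≫ adj.homEquiv _ _ φ = 0 := by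
      refine hom_ext_apply fun V x ↦ ?_
      rw [Adjunction.homEquiv_unit]
      exact h φ hφ V _ (funPb_idealHom_val i le_rfl x)
    have h2 : (toPushforward i) ≫ (ShortComplex.exact_kernel (toPushforward i)).desc _ h1 =
      adj.homEquiv _ _ φ := (ShortComplex.exact_kernel (toPushforward i)).g_desc _ h1
    refine ⟨(adj.homEquiv _ _).symm ((ShortComplex.exact_kernel (toPushforward i)).desc _ h1), ?_⟩
    rw [← Adjunction.homEquiv_naturality_left_symm, h2, Equiv.symm_apply_apply]
  choose l hl using @key
  exact ShortComplex.exact_of_g_is_cokernel _ (CokernelCofork.IsColimit.ofπ _ _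
    (fun φ hφ ↦ l φ hφ) (fun φ hφ ↦ hl φ hφ) (fun φ hφ m hm ↦ by
      rw [← cancel_epi ((Scheme.Modules.pullback ι).map (toPushforward i)), hl, hm]))

end Cokernel

section Fibre
variable {E : P1.Modules} {a b : ℤ} {Z : Scheme.{0}} {i : Z ⟶ P1} (p : SpecZ)

/-- The section `1` of `ι^* 𝒪`. The canonical isomorphism from `ι^* 𝒪` to the structure sheaf is
avoided: `ι^* 𝒪` is free with this section as its basis. -/
def pbOne {X Y : Scheme.{0}} (ι : Y ⟶ X) (U : X.Opens) :
    Γ((Scheme.Modules.pullback ι).obj (structureSheaf X), ι ⁻¹ᵁ U) :=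
  pbSec ι _ U ((unitEquiv U).symm 1)

lemma isFrame_pbOne {X Y : Scheme.{0}} (ι : Y ⟶ X) (U : X.Opens) :
    IsFrame _ (ι ⁻¹ᵁ U) fun _ : Fin 1 ↦ pbOne ι U := (isFrame_one X U).pullback ι

lemma secRes_pbOne {X Y : Scheme.{0}} (ι : Y ⟶ X) {U V : X.Opens} (h : V ≤ U) :
    secRes _ (ι.preimage_mono h) (pbOne ι U) = pbOne ι V := by
  rw [pbOne, ← pbSec_secRes (h := h), ← unitEquiv_symm_funRes, map_one]; rfl

lemma pbSec_unitEquiv_symm {X Y : Scheme.{0}} (ι : Y ⟶ X) (U : X.Opens) (r : Γ(X, U)) :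
    pbSec ι _ U ((unitEquiv U).symm r) = funPb ι U r • pbOne ι U := by
  rw [pbOne, ← pbSec_smul, ← map_smul, smul_eq_mul, mul_one]

/-- A functional on `M` over `U` as a homomorphism to `ι^* 𝒪`. -/
def LocalHom.smulPbOne {X Y : Scheme.{0}} {ι : Y ⟶ X} {U : X.Opens} {M : Y.Modules}
    (l : LocalHom (ι ⁻¹ᵁ U) M (structureSheaf Y)) :
    LocalHom (ι ⁻¹ᵁ U) M ((Scheme.Modules.pullback ι).obj (structureSheaf X)) where
  toFun V h x := l.val h x • secRes _ h (pbOne ι U)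
  map_add V h x y := by rw [l.val_add, add_smul]
  map_smul V h r x := by rw [l.val_smul, mul_smul]
  map_res V h W h' x := by rw [l.val_secRes (h := h), secRes_smul, secRes_secRes]

/-- The exact sequence `0 ⟶ 𝒪(-n) ⟶ 𝒪 ⟶ 𝒪_Z ⟶ 0` on a fibre, given by an equation `h` of `Z`. -/
lemma ExtData.exists_shortExact (D : ExtData E a b i) [IsClosedImmersion i]
    (β' : ∀ j, LocalHom (structMap.fiberι p ⁻¹ᵁ chart j)
      ((Scheme.Modules.pullback (structMap.fiberι p)).obj E) (structureSheaf _))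
    (hβ' : ∀ j V (h : V ≤ chart j) (x : Γ(E, V)),
      (β' j).val ((structMap.fiberι p).preimage_mono h) (pbSec (structMap.fiberι p) E V x) =
        funPb (structMap.fiberι p) V ((D.β j).val h x))
    {g f : ∀ j, Γ((Scheme.Modules.pullback (structMap.fiberι p)).obj E, (fiberAtlas p).U j)}
    {h : ∀ j, Γ(structMap.fiber p, (fiberAtlas p).U j)}
    (hgf : ∀ j, IsFrame _ ((fiberAtlas p).U j) ![g j, f j])
    (hβg : ∀ j, (β' j).val le_rfl (g j) = 0) (hβf : ∀ j, (β' j).val le_rfl (f j) = h j)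
    (hh : ∀ j, h j ≠ 0) {n : ℤ} (hhn : funRes inf_le_left (h 0) =
      (fiberAtlas p).coord n * funRes inf_le_right (h 1)) :
    ∃ (γ : (Scheme.Modules.pullback (structMap.fiberι p)).obj (O n) ⟶
        (Scheme.Modules.pullback (structMap.fiberι p)).obj (structureSheaf P1))
      (w : γ ≫ (Scheme.Modules.pullback (structMap.fiberι p)).map (toPushforward i) = 0),
      (ShortComplex.mk γ ((Scheme.Modules.pullback (structMap.fiberι p)).map
        (toPushforward i)) w).ShortExact := by
  obtain ⟨e, he, he'⟩ := exists_O_frame_fiber p n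
  obtain ⟨γ, hγ⟩ := exists_hom_of_frames (fiberAtlas p).iSup_eq_top he
    (N := (Scheme.Modules.pullback (structMap.fiberι p)).obj (structureSheaf P1))
    (fun j _ ↦ h j • pbOne (structMap.fiberι p) (chart j)) (fun _ _ ↦ (fiberAtlas p).coord n)
    (fun _ ↦ by simpa using he') (fun _ ↦ by
      have h1 := secRes_pbOne (structMap.fiberι p) (inf_le_left : chart 0 ⊓ chart 1 ≤ _)
      have h2 := secRes_pbOne (structMap.fiberι p) (inf_le_right : chart 0 ⊓ chart 1 ≤ _)
      simp only [secRes_smul, Finset.univ_unique, Finset.sum_singleton, hhn, mul_smul]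
      exact congrArg (fun z ↦ (fiberAtlas p).coord n • funRes inf_le_right (h 1) • z)
        (h1.trans h2.symm))
  have hγ' (j) : γ.app _ (e j) = (β' j).smulPbOne.toFun _ le_rfl (f j) := by
    refine (hγ j 0).trans ?_
    change _ = (β' j).val le_rfl (f j) • secRes _ le_rfl _
    rw [hβf, secRes_self]
  have hzero (j) : (β' j).smulPbOne.toFun _ le_rfl (g j) = 0 := by
    change (β' j).val le_rfl (g j) • secRes _ le_rfl _ = 0
    rw [hβg, zero_smul]
  have hpb (j V) (hV : V ≤ chart j) (x : Γ(E, V)) :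
      (β' j).smulPbOne.toFun _ ((structMap.fiberι p).preimage_mono hV)
        (pbSec (structMap.fiberι p) E V x) =
      pbSec (structMap.fiberι p) _ V ((unitEquiv V).symm ((D.β j).val hV x)) := by
    rw [pbSec_unitEquiv_symm]
    change (β' j).val _ _ • secRes _ _ _ = _
    rw [hβ' j V hV, secRes_pbOne _ hV]
  have w : γ ≫ (Scheme.Modules.pullback (structMap.fiberι p)).map (toPushforward i) = 0 := by
    refine hom_ext_of_frames (fiberAtlas p).iSup_eq_top he fun j _ ↦ ?_
    have h1 : (β' j).smulPbOne.comp (.ofGlobal ((Scheme.Modules.pullback (structMap.fiberι p)).map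
        (toPushforward i)) _) = .ofGlobal 0 _ := by
      apply pullback_localHom_ext
      intro V hV x
      change ((Scheme.Modules.pullback (structMap.fiberι p)).map (toPushforward i)).app _
        ((β' j).smulPbOne.toFun _ _ _) = 0
      rw [hpb j V hV, map_pbSec]
      have h2 : (toPushforward i).app V ((unitEquiv V).symm ((D.β j).val hV x)) = 0 := by
        apply (ofPf i _ V).injective
        apply (unitEquiv _).injective
        rw [toPushforward_app, LinearEquiv.apply_symm_apply, D.funPb_β]
        exact (map_zero _).symm
      rw [h2, map_zero]
    change ((Scheme.Modules.pullback (structMap.fiberι p)).map (toPushforward i)).app _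
      (γ.app _ (e j)) = 0
    rw [hγ']
    exact congr(($h1).toFun _ le_rfl (f j))
  refine ⟨γ, w, { exact := ?_, mono_f := ?_, epi_g := ?_ }⟩
  · refine exact_pullback_toPushforward i _ γ w fun {K} φ hφ V r hr ↦ ?_
    have hcover (x : V) : ∃ (j : Fin 2) (W : P1.Opens) (_ : W ≤ V) (_ : W ≤ chart j), x.1 ∈ W ∧
        φ.app _ (pbSec (structMap.fiberι p) _ W ((unitEquiv W).symm (funRes ‹W ≤ V› r))) = 0 := by
      have hx : x.1 ∈ ⨆ j, chart j := by rw [iSup_chart]; trivial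
      obtain ⟨j, hj⟩ := TopologicalSpace.Opens.mem_iSup.mp hx
      obtain ⟨W, hW, hxW, y, hy⟩ := D.exists_local_β j (V ⊓ chart j) inf_le_right
        (funRes inf_le_left r) (by rw [funPb_funRes, hr, map_zero]) x ⟨x.2, hj⟩
      refine ⟨j, W, hW.trans inf_le_left, hW.trans inf_le_right, hxW, ?_⟩
      rw [funRes_funRes] at hy
      rw [← hy, ← hpb j W (hW.trans inf_le_right)]
      refine (hgf j).localHom_ext (l := (β' j).smulPbOne.comp (.ofGlobal φ _)) (l' := .ofGlobal 0 _)
        (fun l ↦ ?_) _ _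
      fin_cases l
      · change φ.app _ ((β' j).smulPbOne.toFun _ _ (g j)) = 0
        rw [hzero, map_zero]
      · change φ.app _ ((β' j).smulPbOne.toFun _ _ (f j)) = 0
        rw [← hγ']
        exact congr(($hφ).app _ (e j))
    choose j W hWV hWj hxW hW using hcover
    refine sec_ext_of_cover (fun x : V ↦ (structMap.fiberι p) ⁻¹ᵁ W x)
      (fun x ↦ (structMap.fiberι p).preimage_mono (hWV x)) (fun y hy ↦ ?_) fun x ↦ ?_
    · exact TopologicalSpace.Opens.mem_iSup.mpr ⟨⟨_, hy⟩, hxW ⟨_, hy⟩⟩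
    · rw [← app_secRes, ← pbSec_secRes (h := hWV x), ← unitEquiv_symm_funRes, hW, map_zero]
  · refine Preadditive.mono_of_cancel_zero _ fun {K} φ hφ ↦ hom_ext_apply fun V x ↦ ?_
    refine sec_ext_of_cover (fun j ↦ V ⊓ (fiberAtlas p).U j) (fun j ↦ inf_le_left)
      (inf_iSup_cover (fiberAtlas p).iSup_eq_top V) fun j ↦ ?_
    rw [← app_secRes]
    obtain ⟨c, hc⟩ := (he j _ inf_le_right).2
      (φ.app (V ⊓ (fiberAtlas p).U j) (secRes K inf_le_left x))
    simp only [Finset.univ_unique, Finset.sum_singleton] at hc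
    have h1 : γ.app _ (φ.app (V ⊓ (fiberAtlas p).U j) (secRes K inf_le_left x)) = 0 :=
      congr(($hφ).app _ _)
    rw [← hc, Scheme.Modules.Hom.app_smul, app_secRes, hγ j 0, secRes_smul, smul_smul] at h1
    have h2 := (isFrame_pbOne (structMap.fiberι p) (chart j)).ext
      (inf_le_right : V ⊓ (fiberAtlas p).U j ≤ _) (a := fun _ ↦ c 0 * funRes inf_le_right (h j))
      (b := fun _ ↦ 0) (by simpa using h1) 0
    change φ.app _ _ = secRes _ _ 0
    rw [map_zero, ← hc]
    rcases isEmpty_or_nonempty (V ⊓ (fiberAtlas p).U j : (structMap.fiber p).Opens) with hV | hV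
    · exact sec_eq_of_isEmpty (fun y hy ↦ hV.false ⟨y, hy⟩) _ _
    · have h3 : funRes (inf_le_right : V ⊓ (fiberAtlas p).U j ≤ _) (h j) ≠ 0 := fun h0 ↦
        hh j (funRes_injective inf_le_right (h0.trans (map_zero _).symm))
      have h4 : c 0 = 0 := (mul_eq_zero.mp h2).resolve_right h3
      exact (congrArg (· • _) h4).trans (zero_smul _ _)
  · exact epi_pullback_map_toPushforward i (structMap.fiberι p)

/-- On the fibre over `p`, let `n` be the degree of an equation of `Z`. Then `𝒪_Z` is the cokernel
of `𝒪(-n) ⟶ 𝒪`, and `E` splits as `𝒪(a + n) ⊞ 𝒪(b - n)`. -/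
lemma ExtData.exists_fiber (D : ExtData E a b i) (hE : IsLocallyFreeOfRank 2 E) (hab : b ≤ a)
    [IsClosedImmersion i] (hZ : IsLCIOfCodim 2 i) :
    ∃ n : ℕ, (n = 0 ↔ p ∉ Set.range (i ≫ structMap)) ∧
      (∃ (γ : (Scheme.Modules.pullback (structMap.fiberι p)).obj (O (-n)) ⟶
          (Scheme.Modules.pullback (structMap.fiberι p)).obj (structureSheaf P1))
        (w : γ ≫ (Scheme.Modules.pullback (structMap.fiberι p)).map (toPushforward i) = 0),
        (ShortComplex.mk γ ((Scheme.Modules.pullback (structMap.fiberι p)).map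
          (toPushforward i)) w).ShortExact) ∧
      Nonempty ((Scheme.Modules.pullback (structMap.fiberι p)).obj E ≅
        (Scheme.Modules.pullback (structMap.fiberι p)).obj (O (a + n)) ⊞
          (Scheme.Modules.pullback (structMap.fiberι p)).obj (O (b - n))) := by
  choose β' hβ' using fun j ↦ (D.β j).exists_pullback_val (structMap.fiberι p)
  choose g f h hgf hβg hβf hh hα hhZ using fun j ↦
    D.exists_pullback_frame hE hZ (structMap.fiberι p) j (hZ.exists_funPb_fiberι_ne_zero p j)
      (β' j) (hβ' j)
  have hαt := pbSec_transition p D.α_trans_atlas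
  rw [hα, hα] at hαt
  have hβt (x : Γ((Scheme.Modules.pullback (structMap.fiberι p)).obj E,
      (fiberAtlas p).U 0 ⊓ (fiberAtlas p).U 1)) : (β' 1).val inf_le_right x =
      (fiberAtlas p).coord b * (β' 0).val inf_le_left x := by
    have h1 : ((β' 1).restrict ((structMap.fiberι p).preimage_mono
        (inf_le_right : chart 0 ⊓ chart 1 ≤ _))) = ((β' 0).restrict
        ((structMap.fiberι p).preimage_mono (inf_le_left : chart 0 ⊓ chart 1 ≤ _))).smul
        ((fiberAtlas p).coord b) := by
      apply pullback_localHom_ext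
      intro V hV x
      apply (unitEquiv _).injective
      refine (hβ' 1 V (hV.trans inf_le_right) x).trans ?_
      have h2 := D.β_trans V (hV.trans chart_inf.le) x
      rw [← funRes_funRes chart_inf.le hV, funRes_coordPow] at h2
      rw [h2, map_mul, funPb_funRes, funPb_coord, ← hβ' 0 V (hV.trans inf_le_left) x]
      rfl
    have h2 := congr(($h1).val le_rfl x)
    refine h2.trans ?_
    change funRes le_rfl _ * (β' 0).val _ x = _
    rw [funRes_self]
  obtain ⟨g', f', h', n, hgf', hβg', hβf', hh', hn, hhn, hg't, r, hf't⟩ :=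
    (fiberAtlas p).exists_normal_form (g := g) (f := f) (h := h) hgf β' hβg hβf hh hαt hβt
  refine ⟨n, hn.trans ?_, D.exists_shortExact p β' hβ' hgf' hβg' hβf' hh' hhn, ?_⟩
  · constructor
    · rintro hu ⟨z, hz⟩
      have hz' : i z ∈ Set.range (structMap.fiberι p) := by
        rw [Scheme.Hom.range_fiberι]
        exact hz
      obtain ⟨y, hy⟩ := hz'
      have hx : i z ∈ ⨆ j, chart j := by rw [iSup_chart]; trivial
      obtain ⟨j, hj⟩ := TopologicalSpace.Opens.mem_iSup.mp hx
      have hyj : y ∈ structMap.fiberι p ⁻¹ᵁ chart j := by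
        change structMap.fiberι p y ∈ chart j
        rwa [hy]
      refine (hhZ j y hyj).mp ?_ ⟨z, hy.symm⟩
      rw [Scheme.basicOpen_of_isUnit _ (hu j)]
      exact hyj
    · intro hp j
      refine isUnit_of_le_basicOpen ((fiberAtlas p).isAffineOpen j) fun y hy ↦ (hhZ j y hy).mpr ?_
      rintro ⟨z, hz⟩
      refine hp ⟨z, ?_⟩
      have : structMap.fiberι p y ∈ Set.range (structMap.fiberι p) := ⟨y, rfl⟩
      rw [Scheme.Hom.range_fiberι, ← hz] at this
      exact this
  · obtain ⟨e, he, he'⟩ := exists_O_frame_fiber p (a + n)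
    obtain ⟨e₂, he₂, he₂'⟩ := exists_O_frame_fiber p (b - n)
    exact (fiberAtlas p).nonempty_iso_biprod hgf' (by omega) hg't r hf't he he₂ he' he₂'

end Fibre

/-! ### Direct summands of rank one -/

section Retract
variable {X : Scheme.{0}} {M N N' : X.Modules} {U V : X.Opens}

/-- Sections of a free module over an integral scheme have no torsion. -/
lemma IsFrame.smul_eq_zero [IsIntegral X] [Nonempty U] {ι : Type} [Fintype ι] {s : ι → Γ(M, U)}
    (hs : IsFrame M U s) {c : Γ(X, U)} {x : Γ(M, U)} (h : c • x = 0) : c = 0 ∨ x = 0 := by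
  obtain ⟨a, rfl⟩ := (hs U le_rfl).2 x
  by_cases hc : c = 0
  · exact Or.inl hc
  · refine Or.inr (Finset.sum_eq_zero fun j _ ↦ ?_)
    have := hs.ext le_rfl (a := fun j ↦ c * a j) (b := fun _ ↦ 0) (by
      simp only [mul_smul, ← Finset.smul_sum, zero_smul, Finset.sum_const_zero]
      exact h) j
    rw [(mul_eq_zero.mp this).resolve_left hc, zero_smul]

variable {i : N ⟶ M} {r : M ⟶ N}

lemma app_retract (h : i ≫ r = 𝟙 N) (x : Γ(N, U)) : r.app U (i.app U x) = x :=
  congr($(h).app U x)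

lemma app_eq_zero_of_retract (h : i ≫ r = 𝟙 N) {x : Γ(N, U)} (hx : i.app U x = 0) : x = 0 := by
  rw [← app_retract h x, hx, map_zero]

lemma eq_zero_of_secRes_of_retract [IsIntegral X] {n : ℕ} (hM : HasFrames n M U)
    (h : i ≫ r = 𝟙 N) (hV : V ≤ U) [Nonempty V] {x : Γ(N, U)} (hx : secRes N hV x = 0) : x = 0 := by
  refine app_eq_zero_of_retract h (hM.eq_zero_of_secRes hV ?_)
  rw [← app_secRes, hx, map_zero]

/-- A nonzero direct summand of a locally free module has nonzero sections over each member of an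
affine open cover: if it vanishes on one member, then it vanishes on all, its sections having no
torsion. -/
lemma exists_section_ne_zero_of_retract [IsIntegral X] {n : ℕ} {κ : Type} {U : κ → X.Opens}
    (hU : ⨆ j, U j = ⊤) (hUa : ∀ j, IsAffineOpen (U j)) [∀ j, Nonempty (U j)]
    (hM : ∀ V, HasFrames n M V) (h : i ≫ r = 𝟙 N) (hN : ¬ IsZero N) (j : κ) :
    ∃ x : Γ(N, U j), x ≠ 0 := by
  by_contra! h0
  have h1 (l : κ) (hl : ∀ x : Γ(N, U l), x = 0) (V) (hV : V ≤ U l) (x : Γ(N, V)) : x = 0 := by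
    obtain ⟨ι, _, ⟨d⟩⟩ := exists_dualBasis (hUa l) (hM _)
    rw [← (d.retract i r h).sum_eq V hV x]
    exact Finset.sum_eq_zero fun m _ ↦ by rw [hl ((d.retract i r h).elt m), map_zero, smul_zero]
  have h2 (l : κ) (x : Γ(N, U l)) : x = 0 := by
    have := nonempty_inf (U j) (U l)
    exact eq_zero_of_secRes_of_retract (hM _) h (inf_le_right : U j ⊓ U l ≤ U l)
      (h1 j h0 _ inf_le_left _)
  refine hN ((IsZero.iff_id_eq_zero N).mpr (hom_ext_apply fun V x ↦ ?_))
  refine sec_ext_of_cover (fun l ↦ V ⊓ U l) (fun _ ↦ inf_le_left) (inf_iSup_cover hU V) fun l ↦ ?_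
  exact (h1 l (h2 l) _ inf_le_right _).trans (h1 l (h2 l) _ inf_le_right _).symm

/-- A nonzero direct summand `N` of a locally free module of rank two with nonzero complement `N'`
is free of rank one over an affine open set with factorial ring of functions. -/
lemma exists_frame_of_retract [IsIntegral X] [Nonempty U] [UniqueFactorizationMonoid Γ(X, U)]
    (hU : IsAffineOpen U) (hM : HasFrames 2 M U) (h : i ≫ r = 𝟙 N)
    {i' : N' ⟶ M} {r' : M ⟶ N'} (h' : i' ≫ r' = 𝟙 N') (hir : i ≫ r' = 0) (hir' : i' ≫ r = 0)
    (hN : ∃ x : Γ(N, U), x ≠ 0) (hN' : ∃ x : Γ(N', U), x ≠ 0) :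
    ∃ y : Γ(N, U), IsFrame N U fun _ : Fin 1 ↦ y := by
  obtain ⟨κ, _, ⟨d₀⟩⟩ := exists_dualBasis hU hM
  let d := d₀.retract i r h
  obtain ⟨w, hw⟩ := hN'
  obtain ⟨⟨x₀, hx₀⟩⟩ := ‹Nonempty U›
  obtain ⟨W, hxW, e, he⟩ := hM x₀ hx₀
  have hne : Nonempty (U ⊓ W : X.Opens) := ⟨⟨x₀, hx₀, hxW⟩⟩
  have he' := he.restrict (inf_le_right : U ⊓ W ≤ W)
  have hUW : U ⊓ W ≤ U := inf_le_left
  -- any two sections of `N` are dependent on `U ⊓ W`, where they and `w` lie in a free module of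
  -- rank two
  have hdep (z z' : Γ(N, U)) : ∃ c c' : Γ(X, U ⊓ W), (c ≠ 0 ∨ c' ≠ 0) ∧
      c • secRes N hUW z + c' • secRes N hUW z' = 0 := by
    have h1 : ¬ LinearIndependent Γ(X, U ⊓ W) ![i.app _ (secRes N hUW z),
        i.app _ (secRes N hUW z'), i'.app _ (secRes N' hUW w)] := by
      intro hli
      have := he'.basis.card_le_card_of_linearIndependent hli
      simp at this
    obtain ⟨c, hc, hc'⟩ := Fintype.not_linearIndependent_iff.mp h1
    simp only [Fin.sum_univ_three, Matrix.cons_val_zero, Matrix.cons_val_one,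
      Matrix.cons_val_two, Matrix.tail_cons, Matrix.head_cons] at hc
    have hz (x : Γ(N, U ⊓ W)) : r'.app _ (i.app _ x) = 0 := congr($(hir).app _ x)
    have hz' (x : Γ(N', U ⊓ W)) : r.app _ (i'.app _ x) = 0 := congr($(hir').app _ x)
    have h2 := congrArg (r.app _) hc
    have h3 := congrArg (r'.app _) hc
    simp only [map_add, Scheme.Modules.Hom.app_smul, hz, hz', app_retract h, app_retract h',
      smul_zero, add_zero, zero_add, map_zero] at h2 h3
    have h4 : c 2 = 0 := by
      have h5 := congrArg (i'.app _) h3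
      rw [Scheme.Modules.Hom.app_smul, map_zero] at h5
      refine (he'.smul_eq_zero h5).resolve_right fun h6 ↦ hw ?_
      exact eq_zero_of_secRes_of_retract hM h' hUW (app_eq_zero_of_retract h' h6)
    refine ⟨c 0, c 1, ?_, h2⟩
    by_contra! hcc
    obtain ⟨l, hl⟩ := hc'
    fin_cases l
    exacts [hl hcc.1, hl hcc.2, hl h4]
  have hprop (k l : κ) (z z' : Γ(N, U)) :
      (d.coord k).valLin le_rfl z * (d.coord l).valLin le_rfl z' =
      (d.coord k).valLin le_rfl z' * (d.coord l).valLin le_rfl z := by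
    obtain ⟨c, c', hcc, hc⟩ := hdep z z'
    have h1 (m : κ) : c * funRes hUW ((d.coord m).val le_rfl z) +
        c' * funRes hUW ((d.coord m).val le_rfl z') = 0 := by
      have := congrArg ((d.coord m).valLin hUW) hc
      rw [map_add, map_smul, map_smul, map_zero] at this
      simp only [LocalHom.valLin_apply, smul_eq_mul] at this
      rwa [LocalHom.val_secRes (h := le_rfl), LocalHom.val_secRes (h := le_rfl)] at this
    apply funRes_injective hUW
    simp only [LocalHom.valLin_apply, map_mul]
    rcases hcc with hcc | hcc
    · apply mul_left_cancel₀ hcc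
      linear_combination funRes hUW ((d.coord l).val le_rfl z') * h1 k -
        funRes hUW ((d.coord k).val le_rfl z') * h1 l
    · apply mul_left_cancel₀ hcc
      linear_combination funRes hUW ((d.coord k).val le_rfl z) * h1 l -
        funRes hUW ((d.coord l).val le_rfl z) * h1 k
  obtain ⟨y, μ, hy, hμ⟩ := exists_generator_of_dualBasis d.elt (fun k ↦ (d.coord k).valLin le_rfl)
    (fun z ↦ by simpa using d.sum_eq U le_rfl z) hprop hN
  have hli : LinearIndependent Γ(X, U) fun _ : Fin 1 ↦ y := by
    refine Fintype.linearIndependent_iff.mpr fun c hc l ↦ ?_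
    have := congrArg μ hc
    simpa [hy, Fin.fin_one_eq_zero l] using this
  let b := Module.Basis.mk hli (fun z _ ↦ by
    rw [← hμ z]
    exact Submodule.smul_mem _ _ (Submodule.subset_span ⟨0, rfl⟩))
  have hb : ⇑b = fun _ ↦ y := Module.Basis.coe_mk _ _
  exact ⟨y, hb ▸ d.isFrame_basis b⟩

/-- A module that is free of rank one on both charts has a monomial transition function. -/
lemma Atlas.exists_transition {k : Type} [CommRing k] [IsDomain k] (A : Atlas k X)
    {y : ∀ j, Γ(N, A.U j)} (hy : ∀ j, IsFrame N (A.U j) fun _ : Fin 1 ↦ y j) :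
    ∃ (c : k) (m : ℤ), IsUnit c ∧ secRes N inf_le_left (y 0) =
      (A.laurent (LaurentPolynomial.C c) * A.coord m) • secRes N inf_le_right (y 1) := by
  obtain ⟨u, hu⟩ := (hy 1 _ inf_le_right).2 (secRes N (inf_le_left : A.U 0 ⊓ A.U 1 ≤ _) (y 0))
  obtain ⟨v, hv⟩ := (hy 0 _ inf_le_left).2 (secRes N (inf_le_right : A.U 0 ⊓ A.U 1 ≤ _) (y 1))
  simp only [Finset.univ_unique, Finset.sum_singleton] at hu hv
  have h1 := (hy 1).ext inf_le_right (a := fun _ ↦ v default * u default) (b := fun _ ↦ 1) (by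
    simp only [Finset.univ_unique, Finset.sum_singleton, mul_smul, one_smul]
    rw [hu, hv]) 0
  obtain ⟨c, m, hc, hcm⟩ := A.exists_eq_laurent_C_mul_coord (IsUnit.of_mul_eq_one_right _ h1)
  exact ⟨c, m, hc, by rw [← hu, hcm]⟩

end Retract

/-! ### Indecomposability -/

section Indecomposable
variable {E : P1.Modules} {a b : ℤ} {Z : Scheme.{0}} {i : Z ⟶ P1}

/-- For a frame `y`, `w` of `E` over a chart, `β y • w - β w • y` is a unit multiple of `α`. -/
lemma ExtData.exists_isUnit_smul_α (D : ExtData E a b i) (hE : IsLocallyFreeOfRank 2 E)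
    [IsClosedImmersion i] (hZ : IsLCIOfCodim 2 i) {j : Fin 2} {y w : Γ(E, chart j)}
    (hyw : IsFrame E (chart j) ![y, w]) : ∃ ω : Γ(P1, chart j), IsUnit ω ∧
      (D.β j).val le_rfl y • w - (D.β j).val le_rfl w • y = ω • D.α j := by
  obtain ⟨ω, hω⟩ := D.exists_smul_α j _ le_rfl
    ((D.β j).val le_rfl y • w - (D.β j).val le_rfl w • y) (by
      rw [sub_eq_add_neg, ← neg_smul, LocalHom.val_add, LocalHom.val_smul, LocalHom.val_smul]
      ring)
  rw [secRes_self] at hω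
  refine ⟨ω, ?_, hω⟩
  rw [← Ideal.span_singleton_eq_top, eq_top_iff, ← D.span_factors hE hZ j, Ideal.span_le]
  rintro c ⟨x, x', hx⟩
  obtain ⟨p, rfl⟩ := (hyw _ le_rfl).2 x
  obtain ⟨q, rfl⟩ := (hyw _ le_rfl).2 x'
  simp only [Fin.sum_univ_two, Matrix.cons_val_zero, Matrix.cons_val_one, secRes_self,
    LocalHom.val_add, LocalHom.val_smul] at hx
  have h1 : (c - (p 0 * q 1 - p 1 * q 0) * ω) • secRes E le_rfl (D.α j) = 0 := by
    rw [secRes_self, sub_smul, mul_smul, ← hω, ← hx]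
    module
  have h2 := D.smul_α_inj j _ le_rfl _ h1
  rw [sub_eq_zero.mp h2]
  exact Ideal.mul_mem_left _ _ (Ideal.mem_span_singleton_self ω)

/-- If the ideal of `Z` is principal on a chart, then `Z` does not meet that chart, having
codimension two. -/
lemma ExtData.notMem_chart_of_span_eq_singleton (D : ExtData E a b i) (hE : IsLocallyFreeOfRank 2 E)
    [IsClosedImmersion i] (hZ : IsLCIOfCodim 2 i) {j : Fin 2} {y w : Γ(E, chart j)}
    (hyw : IsFrame E (chart j) ![y, w]) (δ : Γ(P1, chart j))
    (hδ : Ideal.span {(D.β j).val le_rfl y, (D.β j).val le_rfl w} = Ideal.span {δ}) (z : Z) :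
    i z ∉ chart j := by
  have hδu : IsUnit δ := by
    have key (π : Γ(P1, chart j)) (hπ : Prime π) : ¬ π ∣ δ := by
      intro hd
      obtain ⟨r, hr, hr'⟩ := hZ.exists_not_dvd (isAffineOpen_chart j) hπ
      obtain ⟨x, rfl⟩ := D.exists_β_eq hE j r hr
      refine hr' (hd.trans ?_)
      obtain ⟨p, rfl⟩ := (hyw _ le_rfl).2 x
      rw [← Ideal.mem_span_singleton, ← hδ, Ideal.mem_span_pair]
      refine ⟨p 0, p 1, ?_⟩
      simp [LocalHom.val_add, LocalHom.val_smul]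
    by_contra hu
    by_cases h0 : δ = 0
    · obtain ⟨π, hπ⟩ := exists_prime_chart j
      exact key π hπ (h0 ▸ dvd_zero _)
    · obtain ⟨π, hπ, hd⟩ := WfDvdMonoid.exists_irreducible_factor hu h0
      exact key π hπ.prime hd
  rw [Ideal.span_singleton_eq_top.mpr hδu, Ideal.eq_top_iff_one, Ideal.mem_span_pair] at hδ
  obtain ⟨c, c', hcc⟩ := hδ
  have h1 : funPb i (chart j) 1 = 0 := by
    rw [← hcc, map_add, map_mul, map_mul, D.funPb_β, D.funPb_β, mul_zero, mul_zero, add_zero]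
  have := notMem_basicOpen_of_funPb_eq_zero (z := z) h1
  rwa [Scheme.basicOpen_of_isUnit _ isUnit_one] at this

/-- Let `y`, `w` be a frame of `E` with diagonal transition matrix. Then the values of `β` on it
generate principal ideals: `β y` is a section of `𝒪(b - c)`, and in view of `α` also of `𝒪(d - a)`,
whereas `β w` is one of `𝒪(b - d)` and of `𝒪(c - a)`. If neither vanishes, then `a ≤ c ≤ b` and
`a ≤ d ≤ b`, so all four integers are equal, and both values are constants. -/
lemma ExtData.isEmpty_of_diagonal (D : ExtData E a b i) (hE : IsLocallyFreeOfRank 2 E) (hab : b ≤ a)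
    [IsClosedImmersion i] (hZ : IsLCIOfCodim 2 i) {y w : ∀ j, Γ(E, chart j)}
    (hyw : ∀ j, IsFrame E (chart j) ![y j, w j]) {ε ε' : ℤ} {c d : ℤ} (hε : IsUnit ε)
    (hε' : IsUnit ε')
    (hy : secRes E inf_le_left (y 0) = (atlasP1.laurent (LaurentPolynomial.C ε) *
      atlasP1.coord c) • secRes E inf_le_right (y 1))
    (hw : secRes E inf_le_left (w 0) = (atlasP1.laurent (LaurentPolynomial.C ε') *
      atlasP1.coord d) • secRes E inf_le_right (w 1)) : IsEmpty Z := by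
  have hC {η η' : ℤ} : atlasP1.laurent (LaurentPolynomial.C (η * η')) =
      atlasP1.laurent (LaurentPolynomial.C η) * atlasP1.laurent (LaurentPolynomial.C η') := by
    rw [map_mul, map_mul]
  -- the transition functions of the values of `β`, first from that of `β` itself
  have hβ (x : ∀ j, Γ(E, chart j)) (η m : ℤ)
      (hx : secRes E inf_le_left (x 0) = (atlasP1.laurent (LaurentPolynomial.C η) *
        atlasP1.coord m) • secRes E inf_le_right (x 1)) :
      funRes inf_le_left ((D.β 0).val le_rfl (x 0)) = atlasP1.laurent (LaurentPolynomial.C η) *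
        atlasP1.coord (m - b) * funRes inf_le_right ((D.β 1).val le_rfl (x 1)) := by
    have h1 := D.β_trans_atlas (secRes E inf_le_left (x 0))
    rw [LocalHom.val_secRes (h := le_rfl), hx, LocalHom.val_smul,
      LocalHom.val_secRes (h := le_rfl)] at h1
    rw [sub_eq_add_neg, atlasP1.coord_add]
    linear_combination -atlasP1.coord (-b) * h1 -
      funRes inf_le_left ((D.β 0).val le_rfl (x 0)) * atlasP1.coord_mul_neg b
  have hs := hβ y ε c hy
  have ht := hβ w ε' d hw
  choose ω hωu hω using fun j ↦ D.exists_isUnit_smul_α hE hZ (hyw j)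
  obtain ⟨o₀, ho₀, hω₀⟩ := atlasP1.exists_eq_poly_C_of_isUnit (j := 0) (hωu 0)
  obtain ⟨o₁, ho₁, hω₁⟩ := atlasP1.exists_eq_poly_C_of_isUnit (j := 1) (hωu 1)
  -- the comparison of `ω α` on the two charts gives a second formula for these transition functions
  have hl : chart 0 ⊓ chart 1 ≤ chart 0 := inf_le_left
  have hr : chart 0 ⊓ chart 1 ≤ chart 1 := inf_le_right
  have hα : (atlasP1.laurent (LaurentPolynomial.C o₁)) •
      (funRes hl ((D.β 0).val le_rfl (y 0)) • secRes E hl (w 0) -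
        funRes hl ((D.β 0).val le_rfl (w 0)) • secRes E hl (y 0)) =
      (atlasP1.laurent (LaurentPolynomial.C o₀) * atlasP1.coord a) •
      (funRes hr ((D.β 1).val le_rfl (y 1)) • secRes E hr (w 1) -
        funRes hr ((D.β 1).val le_rfl (w 1)) • secRes E hr (y 1)) := by
    have h0 := congrArg (secRes E hl) (hω 0)
    have h1 := congrArg (secRes E hr) (hω 1)
    rw [map_sub, secRes_smul, secRes_smul, secRes_smul, hω₀, atlasP1.funRes_poly_C_zero,
      D.α_trans_atlas] at h0
    rw [map_sub, secRes_smul, secRes_smul, secRes_smul, hω₁, atlasP1.funRes_poly_C_one] at h1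
    rw [h0, h1, smul_smul, smul_smul, smul_smul]
    congr 1
    ring
  rw [hy, hw] at hα
  have hcoef := fun l ↦ (hyw 1).ext (inf_le_right : chart 0 ⊓ chart 1 ≤ _)
    (a := ![-(atlasP1.laurent (LaurentPolynomial.C o₁) *
        funRes inf_le_left ((D.β 0).val le_rfl (w 0)) *
        (atlasP1.laurent (LaurentPolynomial.C ε) * atlasP1.coord c)),
      atlasP1.laurent (LaurentPolynomial.C o₁) * funRes inf_le_left ((D.β 0).val le_rfl (y 0)) *
        (atlasP1.laurent (LaurentPolynomial.C ε') * atlasP1.coord d)])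
    (b := ![-(atlasP1.laurent (LaurentPolynomial.C o₀) * atlasP1.coord a *
        funRes inf_le_right ((D.β 1).val le_rfl (w 1))),
      atlasP1.laurent (LaurentPolynomial.C o₀) * atlasP1.coord a *
        funRes inf_le_right ((D.β 1).val le_rfl (y 1))]) (by
      simp only [Fin.sum_univ_two, Matrix.cons_val_zero, Matrix.cons_val_one]
      refine Eq.trans ?_ (hα.trans ?_) <;> module) l
  have key {η : ℤ} {m : ℤ} (hη : IsUnit η) {x₀ x₁ : Γ(P1, chart 0 ⊓ chart 1)}
      (h : atlasP1.laurent (LaurentPolynomial.C o₁) * x₀ *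
        (atlasP1.laurent (LaurentPolynomial.C η) * atlasP1.coord m) =
          atlasP1.laurent (LaurentPolynomial.C o₀) * atlasP1.coord a * x₁) :
      x₀ = atlasP1.laurent (LaurentPolynomial.C (o₀ * o₁ * η)) * atlasP1.coord (a - m) * x₁ := by
    have e1 : atlasP1.laurent (LaurentPolynomial.C (o₁ * o₁)) = 1 := by
      rw [Int.isUnit_mul_self ho₁, map_one, map_one]
    have e2 : atlasP1.laurent (LaurentPolynomial.C (η * η)) = 1 := by
      rw [Int.isUnit_mul_self hη, map_one, map_one]
    rw [hC] at e1 e2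
    rw [hC, hC, sub_eq_add_neg, atlasP1.coord_add]
    have e3 := atlasP1.coord_mul_neg m
    linear_combination (atlasP1.laurent (LaurentPolynomial.C o₁) *
      atlasP1.laurent (LaurentPolynomial.C η) * atlasP1.coord (-m)) * h - x₀ *
      (atlasP1.laurent (LaurentPolynomial.C η) * atlasP1.laurent (LaurentPolynomial.C η) *
        atlasP1.coord m * atlasP1.coord (-m)) * e1 - x₀ * (atlasP1.coord m * atlasP1.coord (-m)) *
        e2 - x₀ * e3
  have ht' := key hε (neg_injective (hcoef 0))
  have hs' := key hε' (hcoef 1)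
  suffices h : ∀ j, ∃ δ, Ideal.span {(D.β j).val le_rfl (y j), (D.β j).val le_rfl (w j)} =
      Ideal.span {δ} by
    refine ⟨fun z ↦ ?_⟩
    have hx : i z ∈ ⨆ j, chart j := by rw [iSup_chart]; trivial
    obtain ⟨j, hj⟩ := TopologicalSpace.Opens.mem_iSup.mp hx
    obtain ⟨δ, hδ⟩ := h j
    exact D.notMem_chart_of_span_eq_singleton hE hZ (hyw j) δ hδ z hj
  have hres0 {x : Γ(P1, chart 0)} (hx : funRes (inf_le_left : chart 0 ⊓ chart 1 ≤ _) x = 0) :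
      x = 0 := by
    have : Nonempty (chart 0 ⊓ chart 1 : P1.Opens) := atlasP1.nonempty_inf
    exact funRes_injective inf_le_left (hx.trans (map_zero _).symm)
  by_cases hs0 : (D.β 1).val le_rfl (y 1) = 0
  · have hs1 : (D.β 0).val le_rfl (y 0) = 0 := hres0 (by rw [hs, hs0, map_zero, mul_zero])
    intro j
    refine ⟨(D.β j).val le_rfl (w j), ?_⟩
    fin_cases j
    · exact hs1 ▸ Ideal.span_insert_zero
    · exact hs0 ▸ Ideal.span_insert_zero
  by_cases ht0 : (D.β 1).val le_rfl (w 1) = 0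
  · have ht1 : (D.β 0).val le_rfl (w 0) = 0 := hres0 (by rw [ht, ht0, map_zero, mul_zero])
    intro j
    refine ⟨(D.β j).val le_rfl (y j), ?_⟩
    fin_cases j
    · exact ht1 ▸ Ideal.span_pair_zero _
    · exact ht0 ▸ Ideal.span_pair_zero _
  have hunit : ∀ {η : ℤ}, IsUnit η → o₀ * o₁ * η ≠ 0 := fun hη ↦ ((ho₀.mul ho₁).mul hη).ne_zero
  have h1 : a ≤ c := by
    by_contra! hlt
    have := (atlasP1.exists_eq_poly_C (hunit hε) ht0 (by omega) ht').1
    omega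
  have h2 : d ≤ b := by
    by_contra! hlt
    have := (atlasP1.exists_eq_poly_C hε'.ne_zero ht0 (by omega) ht).1
    omega
  have h3 : a ≤ d := by
    by_contra! hlt
    have := (atlasP1.exists_eq_poly_C (hunit hε') hs0 (by omega) hs').1
    omega
  obtain ⟨-, τ, ht1, ht0⟩ := atlasP1.exists_eq_poly_C hε'.ne_zero ht0 (by omega) ht
  obtain ⟨-, σ, hs1, hs0⟩ := atlasP1.exists_eq_poly_C (m := c - b) hε.ne_zero hs0 (by omega) hs
  -- constants generate principal ideals, since `ℤ` is a principal ideal domain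
  have hprin (j : Fin 2) (m n : ℤ) : ∃ δ, Ideal.span {atlasP1.poly j (Polynomial.C m),
      atlasP1.poly j (Polynomial.C n)} = Ideal.span {δ} := by
    obtain ⟨δ, hδ⟩ := IsPrincipalIdealRing.principal (Ideal.span {m, n})
    refine ⟨atlasP1.poly j (Polynomial.C δ), ?_⟩
    have := congrArg (Ideal.map ((atlasP1.poly j).toRingHom.comp Polynomial.C)) hδ
    rw [Ideal.submodule_span_eq, Ideal.map_span, Ideal.map_span, Set.image_pair,
      Set.image_singleton] at this
    exact this
  intro j
  fin_cases j
  · exact hs0 ▸ ht0 ▸ hprin 0 _ _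
  · exact hs1 ▸ ht1 ▸ hprin 1 _ _

/-- If `Z` is nonempty, `E` is indecomposable. -/
lemma ExtData.indecomposable (D : ExtData E a b i) (hE : IsLocallyFreeOfRank 2 E) (hab : b ≤ a)
    [IsClosedImmersion i] (hZ : IsLCIOfCodim 2 i) [Nonempty Z] : Indecomposable E := by
  constructor
  · obtain ⟨⟨x, hx⟩⟩ := nonempty_chart 0
    obtain ⟨W, hxW, e, he⟩ := hE.hasFrames _ x hx
    have : Nonempty W := ⟨⟨x, hxW⟩⟩
    exact he.not_isZero
  · intro M N φ
    by_contra! hMN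
    have hi : (biprod.inl ≫ φ.inv) ≫ (φ.hom ≫ biprod.fst) = 𝟙 M := by simp
    have hi' : (biprod.inr ≫ φ.inv) ≫ (φ.hom ≫ biprod.snd) = 𝟙 N := by simp
    have hii : (biprod.inl ≫ φ.inv) ≫ (φ.hom ≫ biprod.snd) = (0 : M ⟶ N) := by simp
    have hii' : (biprod.inr ≫ φ.inv) ≫ (φ.hom ≫ biprod.fst) = (0 : N ⟶ M) := by simp
    have hM := exists_section_ne_zero_of_retract iSup_chart isAffineOpen_chart hE.hasFrames hi hMN.1
    have hN := exists_section_ne_zero_of_retract iSup_chart isAffineOpen_chart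
      hE.hasFrames hi' hMN.2
    choose y hy using fun j ↦ exists_frame_of_retract (isAffineOpen_chart j) (hE.hasFrames _) hi hi'
      hii hii' (hM j) (hN j)
    choose w hw using fun j ↦ exists_frame_of_retract (isAffineOpen_chart j) (hE.hasFrames _) hi' hi
      hii' hii (hN j) (hM j)
    obtain ⟨ε, c, hε, hyt⟩ := atlasP1.exists_transition hy
    obtain ⟨ε', d, hε', hwt⟩ := atlasP1.exists_transition hw
    have hframe (j) : IsFrame E (chart j) ![(biprod.inl ≫ φ.inv).app _ (y j),
        (biprod.inr ≫ φ.inv).app _ (w j)] := by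
      have := ((hy j).biprod (hw j)).of_iso φ.symm
      convert this using 1
      ext l
      fin_cases l <;> rfl
    refine not_isEmpty_of_nonempty Z (D.isEmpty_of_diagonal hE hab hZ (c := c) (d := d) hframe hε
      hε' ?_ ?_)
    · rw [← app_secRes, ← app_secRes, hyt, Scheme.Modules.Hom.app_smul]
    · rw [← app_secRes, ← app_secRes, hwt, Scheme.Modules.Hom.app_smul]

end Indecomposable

end
end RankTwoP1

theorem mainTheorem1 (E : RankTwoP1.P1.Modules) (hE : RankTwoP1.IsLocallyFreeOfRank 2 E)
    (a b : ℤ) {Z : Scheme.{0}} (i : Z ⟶ RankTwoP1.P1)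
    (h : RankTwoP1.IsAssociatedTriple E a b i) :
    (Indecomposable E ↔ Nonempty Z) ∧
    (∀ p : RankTwoP1.SpecZ, p ∈ Set.range (i ≫ RankTwoP1.structMap) →
      ∃ n : ℕ, 0 < n ∧
        (∃ (γ : (RankTwoP1.fibreRestrict p).obj (RankTwoP1.O (-n)) ⟶
              (RankTwoP1.fibreRestrict p).obj (RankTwoP1.structureSheaf RankTwoP1.P1))
            (w : γ ≫ (RankTwoP1.fibreRestrict p).map (RankTwoP1.toPushforward i) = 0),
          (ShortComplex.mk γ ((RankTwoP1.fibreRestrict p).map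
            (RankTwoP1.toPushforward i)) w).ShortExact) ∧
        Nonempty ((RankTwoP1.fibreRestrict p).obj E ≅
          (RankTwoP1.fibreRestrict p).obj (RankTwoP1.O (a + n)) ⊞
            (RankTwoP1.fibreRestrict p).obj (RankTwoP1.O (b - n)))) ∧
    (∀ p : RankTwoP1.SpecZ, p ∉ Set.range (i ≫ RankTwoP1.structMap) →
      Nonempty ((RankTwoP1.fibreRestrict p).obj E ≅
        (RankTwoP1.fibreRestrict p).obj (RankTwoP1.O a) ⊞
          (RankTwoP1.fibreRestrict p).obj (RankTwoP1.O b))) := by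
  obtain ⟨D⟩ := RankTwoP1.nonempty_extData h
  obtain ⟨hab, _, hZ, -⟩ := h
  refine ⟨⟨fun hind ↦ ?_, fun _ ↦ D.indecomposable hE hab hZ⟩, fun p hp ↦ ?_, fun p hp ↦ ?_⟩
  · by_contra hne
    rw [not_nonempty_iff] at hne
    obtain ⟨φ⟩ := D.nonempty_iso_of_isEmpty hE hab
    exact (hind.2 _ _ φ).elim (RankTwoP1.not_isZero_O a) (RankTwoP1.not_isZero_O b)
  · obtain ⟨n, hn, hγ, hiso⟩ := D.exists_fiber p hE hab hZ
    exact ⟨n, Nat.pos_of_ne_zero fun h0 ↦ hn.mp h0 hp, hγ, hiso⟩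
  · obtain ⟨n, hn, -, hiso⟩ := D.exists_fiber p hE hab hZ
    obtain rfl := hn.mpr hp
    simp only [Nat.cast_zero, add_zero, sub_zero] at hiso
    exact hiso
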